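/- A buyer's valuation takes the values $0\le v_1<v_2<\dots<v_n$ with probabilities $p_1,\dots,p_n>0$, $\sum_i p_i=1$, where all $v_i,p_i$ are rational and given explicitly. A signaling scheme with $m$ signals is a matrix $X=(x_{i,\sigma})_{1\le i\le n,\,1\le\sigma\le m}$ with $x_{i,\sigma}\ge 0$ and $\sum_\sigma x_{i,\sigma}=p_i$ for every $i$ ($x_{i,\sigma}$ is the probability that the valuation is $v_i$ and $\sigma$ is sent). On receiving $\sigma$, the seller posts a price $v_k$ maximizing $v_k\sum_{i\ge k}x_{i,\sigma}$ over $k\in\{1,\dots,n\}$; ties are broken in favor of welfare, i.e. towards the lowest index, and the chosen index is called $k(\sigma)$. The social welfare of $X$ is $\mathrm{W}(X)=\sum_{\sigma}\sum_{i\ge k(\sigma)}v_i\,x_{i,\sigma}$. There is an algorithm that, given an integer $M>1$ (in binary) and the list of pairs $(v_i,p_i)$, runs in time polynomial in the bit length of its input and outputs a signaling scheme $X$ with rational entries and at most $M$ signals such that $$\mathrm{W}(X)\;\ge\;\frac{M-1}{M}\Bigl(1-\frac1e\Bigr)\,\mathrm{W}(Y)$$ for every signaling scheme $Y$ (with real entries)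 with at most $M$ signals. -/

import Mathlib

namespace LimitedSignaling

/-! ## Bilateral trade with a bounded number of signals

Buyer types are indexed by `Fin n`; type `i` has valuation `v i` and prior probability `p i`. -/

/-- An explicitly represented distribution of buyer valuations: finite support
`v 0 < v 1 < ...`, nonnegative values, positive probabilities summing to one.
The data are rational numbers, since they are the input of an algorithm. -/
structure IsMarket {n : ℕ} (v p : Fin n → ℚ) : Prop where
  strictMono : StrictMono v
  nonneg : ∀ i, 0 ≤ v i
  pos : ∀ i, 0 < p i
  sum_eq_one : ∑ i, p i = 1

/-- A signaling scheme with `m` signals for the prior `p`, in unnormalized form: `X i σ` is the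
probability that the buyer has type `i` and the signal `σ` is sent. -/
structure IsScheme {n m : ℕ} (p : Fin n → ℝ) (X : Fin n → Fin m → ℝ) : Prop where
  nonneg : ∀ i σ, 0 ≤ X i σ
  sum_eq : ∀ i, ∑ σ, X i σ = p i

/-- Seller's (unnormalized) revenue from the segment `x` at price `v k`: the price times the
probability that the valuation is at least the price. -/
noncomputable def revenue {n : ℕ} (v x : Fin n → ℝ) (k : Fin n) : ℝ :=
  v k * ∑ i ∈ Finset.Ici k, x i

/-- `v k` is a best response (revenue-maximizing price) of the seller to the segment `x`. -/
def IsBestPrice {n : ℕ} (v x : Fin n → ℝ) (k : Fin n) : Prop :=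
  ∀ j, revenue v x j ≤ revenue v x k

open scoped Classical in
/-- Served social welfare of the segment `x`. The seller posts a revenue-maximizing price and
breaks ties in favour of welfare, that is, posts the lowest such price `v k`; so the types
served are those lying above some best price. -/
noncomputable def servedWelfare {n : ℕ} (v x : Fin n → ℝ) : ℝ :=
  ∑ i with ∃ k ≤ i, IsBestPrice v x k, v i * x i

/-- If `k` is the lowest best price, the served welfare is `∑ i ≥ k, v i * x i`. -/
theorem servedWelfare_eq {n : ℕ} {v x : Fin n → ℝ} {k : Fin n}
    (hk : IsLeast {k | IsBestPrice v x k} k) :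
    servedWelfare v x = ∑ i ∈ Finset.Ici k, v i * x i := by
  classical
  unfold servedWelfare
  apply Finset.sum_congr _ (fun _ _ => rfl)
  ext i
  simp only [Finset.mem_filter, Finset.mem_univ, true_and, Finset.mem_Ici]
  exact ⟨fun ⟨_, h1, h2⟩ => (hk.2 h2).trans h1, fun h => ⟨k, h, hk.1⟩⟩

/-- Social welfare of a signaling scheme. -/
noncomputable def welfare {n m : ℕ} (v : Fin n → ℝ) (X : Fin n → Fin m → ℝ) : ℝ :=
  ∑ σ, servedWelfare v (fun i => X i σ)

/-- `X` (with `m` signals) is an `α`-approximation to the welfare-maximizing signaling scheme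
with at most `M` signals: it is itself such a scheme, and its welfare is at least `α` times
the welfare of every scheme with at most `M` signals. -/
def IsApproxScheme {n m : ℕ} (v p : Fin n → ℝ) (M : ℕ) (α : ℝ) (X : Fin n → Fin m → ℝ) : Prop :=
  m ≤ M ∧ IsScheme p X ∧
    ∀ (m' : ℕ) (Y : Fin n → Fin m' → ℝ), m' ≤ M → IsScheme p Y →
      α * welfare v Y ≤ welfare v X

/-! ## Programs and their running time

A first-order programming language over rationals, booleans, pairs and lists, whose only loop
runs through a list. Every step is charged the bit length of all data it reads, copies and
produces (logarithmic cost). Each primitive is computable by a Turing machine in time polynomial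
in its charge, so a program whose cost is polynomially bounded is a polynomial-time algorithm in
the usual (bit complexity) sense. -/

/-- Data types. -/
inductive Ty : Type
  | rat : Ty
  | bool : Ty
  | prod : Ty → Ty → Ty
  | list : Ty → Ty

/-- The values of a data type. -/
abbrev Ty.Val : Ty → Type
  | .rat => ℚ
  | .bool => Bool
  | .prod a b => a.Val × b.Val
  | .list a => List a.Val

/-- Bit length of a rational: reduced fraction, numerator and denominator in binary. -/
def ratSize (q : ℚ) : ℕ := 1 + Nat.size q.num.natAbs + Nat.size q.den

/-- Bit length of a value. -/
def Ty.size : (t : Ty) → t.Val → ℕ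
  | .rat, q => ratSize q
  | .bool, _ => 1
  | .prod a b, x => 1 + a.size x.1 + b.size x.2
  | .list a, l => 1 + (l.map (fun x => 1 + a.size x)).sum

/-- Primitive operations. -/
inductive Op : Ty → Ty → Type
  /-- a constant -/
  | const {a : Ty} (q : ℚ) : Op a .rat
  | add : Op (.prod .rat .rat) .rat
  | sub : Op (.prod .rat .rat) .rat
  | mul : Op (.prod .rat .rat) .rat
  /-- division, with `x / 0 = 0` -/
  | div : Op (.prod .rat .rat) .rat
  /-- the test `x ≤ y` -/
  | le : Op (.prod .rat .rat) .bool
  /-- numerator of the reduced fraction -/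
  | num : Op .rat .rat
  /-- denominator of the reduced fraction -/
  | den : Op .rat .rat
  /-- binary digits of the absolute value of the numerator, least significant first -/
  | bits : Op .rat (.list .bool)
  | fst {a b : Ty} : Op (.prod a b) a
  | snd {a b : Ty} : Op (.prod a b) b
  | nil {a b : Ty} : Op a (.list b)
  | cons {a : Ty} : Op (.prod a (.list a)) (.list a)
  | id {a : Ty} : Op a a

/-- Result of a primitive operation. -/
def Op.eval : {a b : Ty} → Op a b → a.Val → b.Val
  | _, _, .const q, _ => q
  | _, _, .add, x => x.1 + x.2
  | _, _, .sub, x => x.1 - x.2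
  | _, _, .mul, x => x.1 * x.2
  | _, _, .div, x => x.1 / x.2
  | _, _, .le, x => decide (x.1 ≤ x.2)
  | _, _, .num, x => (x.num : ℚ)
  | _, _, .den, x => (x.den : ℚ)
  | _, _, .bits, x => Nat.bits x.num.natAbs
  | _, _, .fst, x => x.1
  | _, _, .snd, x => x.2
  | _, _, .nil, _ => []
  | _, _, .cons, x => x.1 :: x.2
  | _, _, .id, x => x

/-- Programs with input type `a` and output type `b`. A program is a finite object. -/
inductive Prog : Ty → Ty → Type
  /-- a primitive operation -/
  | op {a b : Ty} (o : Op a b) : Prog a b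
  /-- run `f`, then `g` on its result -/
  | comp {a b c : Ty} (g : Prog b c) (f : Prog a b) : Prog a c
  /-- run `f` and `g` on two copies of the input -/
  | pair {a b c : Ty} (f : Prog a b) (g : Prog a c) : Prog a (.prod b c)
  /-- branch on the result of `c` -/
  | ite {a b : Ty} (c : Prog a .bool) (f g : Prog a b) : Prog a b
  /-- case distinction on whether a list is empty -/
  | listCase {a b c : Ty} (f : Prog a c) (g : Prog (.prod a (.prod b (.list b))) c) :
      Prog (.prod a (.list b)) c
  /-- run the body `f` on the entries of a list, in order, updating a state -/
  | fold {s a : Ty} (f : Prog (.prod s a) s) : Prog (.prod s (.list a)) s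

/-- Result of a program. -/
def Prog.eval : {a b : Ty} → Prog a b → a.Val → b.Val
  | _, _, .op o, x => o.eval x
  | _, _, .comp g f, x => g.eval (f.eval x)
  | _, _, .pair f g, x => (f.eval x, g.eval x)
  | _, _, .ite c f g, x => if c.eval x = true then f.eval x else g.eval x
  | _, _, .listCase f g, x =>
    match x.2 with
    | [] => f.eval x.1
    | y :: l => g.eval (x.1, (y, l))
  | _, _, .fold f, x => x.2.foldl (fun s y => f.eval (s, y)) x.1

/-- Cost of a loop through a list: every pass is charged the cost `c` of the body and the
length `sz` of the data it works on. -/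
def foldCost {S A : Type} (f : S × A → S) (c sz : S × A → ℕ) : S → List A → ℕ
  | _, [] => 0
  | s, y :: l => 1 + sz (s, y) + c (s, y) + foldCost f c sz (f (s, y)) l

/-- Running time of a program on an input. -/
def Prog.cost : {a b : Ty} → Prog a b → a.Val → ℕ
  | a, b, .op o, x => 1 + a.size x + b.size (o.eval x)
  | _, _, .comp g f, x => 1 + f.cost x + g.cost (f.eval x)
  | a, _, .pair f g, x => 1 + a.size x + f.cost x + g.cost x
  | a, _, .ite c f g, x =>
    1 + a.size x + c.cost x + (if c.eval x = true then f.cost x else g.cost x)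
  | .prod a (.list b), _, .listCase f g, x =>
    1 + (Ty.prod a (.list b)).size x +
      (match x.2 with
      | [] => f.cost x.1
      | y :: l => g.cost (x.1, (y, l)))
  | .prod s (.list a), _, .fold f, x =>
    1 + (Ty.prod s (.list a)).size x +
      foldCost f.eval f.cost (Ty.prod s a).size x.1 x.2

/-- The program runs in polynomial time on the inputs in `I`: its cost is bounded by a fixed
polynomial in the bit length of the input. -/
def Prog.PolyTimeOn {a b : Ty} (A : Prog a b) (I : Set a.Val) : Prop :=
  ∃ q : Polynomial ℕ, ∀ x ∈ I, A.cost x ≤ q.eval (a.size x)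

/-! ## The computational problem -/

/-- Input type: the bound on the number of signals, and the list of pairs (value, probability). -/
abbrev inputTy : Ty := .prod .rat (.list (.prod .rat .rat))

/-- Output type: the list of signals, each given by the list of its entries. -/
abbrev outputTy : Ty := .list (.list .rat)

/-- The input for the bound `M` (in binary) and the market `v`, `p`. -/
def encodeInput {n : ℕ} (M : ℕ) (v p : Fin n → ℚ) : inputTy.Val :=
  ((M : ℚ), List.ofFn fun i => (v i, p i))

/-- The output that represents the matrix `X`. -/
def encodeScheme {n m : ℕ} (X : Fin n → Fin m → ℚ) : outputTy.Val :=
  List.ofFn fun σ => List.ofFn fun i => X i σ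

/-- The admissible inputs. -/
def validInputs : Set inputTy.Val :=
  {x | ∃ (n M : ℕ) (v p : Fin n → ℚ), 1 < M ∧ IsMarket v p ∧ x = encodeInput M v p}

end LimitedSignaling

/-!
Number the types by decreasing value and put `u j = 1 / v j`, `u 0 = 0`. If a segment has the best
price `v k` and revenue `R`, then its `l` highest types have mass at most `R * u l`, with equality
for `l = k`. For a set `K` of prices, the *greedy scheme* goes through the types from the highest
to the lowest and, at each type in `K`, splits off from what is left of the market a segment with
this price and the largest possible revenue `R`, which takes as much of the `l` highest types as the
bound `R * u l` allows, for every `l`. The proof rests on three properties of the value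
`greedyWelfare … K` that the scheme serves.

* It is an upper bound for all segments with prices in `K` (`segments_welfare_le`). Any such
  segments form a `Schedule` of revenues, and the greedy schedule leaves the least mass unserved
  among the highest `l` types, for every `l` at once (`Schedule.unserved_le`).
* It is monotone and submodular in `K` (`greedyWelfare_submodular`), because the unserved mass is
  supermodular (`GreedySchedule.unserved_add_le`). The unserved mass is a running maximum of
  functions `c x - u x * S`, and running maxima preserve supermodularity under a condition on their
  records (`partialSups_add_le`) that holds since the extra revenue due to an additional price
  decreases along the later types (`GreedySchedule.sub_antitone`).
* It can be evaluated in polynomial time.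

A scheme with `M` signals loses at most the fraction `1 / M` of its welfare when the least useful
signal is dropped, and the others use at most `M - 1` prices (`IsMarket.welfare_le`). The algorithm
adds `M - 1` prices greedily, which reaches the fraction `1 - 1 / e` of the best set of `M - 1`
prices (`greedy_bound`), and outputs the segments of the greedy scheme together with one more signal
for the residual market.

For the running time, the bit length of a loop's state has to be bounded. The bit length of
rationals is subadditive under arithmetic (`heightSize`), which suffices for sums and for loops that
do arithmetic on their input only. The loop through the types in the greedy segmentation `Prog.sim`
iterates arithmetic on its own results; there, all masses lie in `[0, 1]` and have a common
denominator that grows by a bounded factor with each segment (`exists_isMultiple_residualTail`).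
-/

namespace LimitedSignaling

/-! ### Schedules -/

section Schedules

set_option linter.unusedSectionVars false

variable {𝕜 : Type*} [Field 𝕜] [LinearOrder 𝕜] [IsStrictOrderedRing 𝕜]

/-- The revenues of a scheme whose segments have prices in `K`. Types are numbered `1, 2, …` by
decreasing value; `p i` is the mass of type `i` and `u i` the reciprocal of its value. `S i` is the
total revenue of the segments whose price is among the first `i` values. Such a segment, with
revenue `R` and price `1 / u k`, is thought of as being continued below its price, with mass
`R * u l` of the types up to `l`; then `c i - u i * S i` is the mass of the first `i` types that is
left over, where `c i = ∑ j ≤ i, p j + ∑ σ, R σ * (u i - u (k σ))` collects the masses and corrects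
for the continuation. The inequality `S_le` says that the segments do not use more mass of the types
`l + 1, …, k` than there is. -/
structure Schedule (u p : ℕ → 𝕜) (K : Finset ℕ) (c S : ℕ → 𝕜) : Prop where
  c_zero : c 0 = 0
  S_zero : S 0 = 0
  c_succ : ∀ i, c (i + 1) = c i + p (i + 1) + (u (i + 1) - u i) * S i
  S_skip : ∀ i, i + 1 ∉ K → S (i + 1) = S i
  S_le : ∀ k ∈ K, ∀ l < k, S k * (u k - u l) ≤ c k - c l

/-- At each price in `K` the revenue is as large as the constraints allow. -/
structure GreedySchedule (u p : ℕ → 𝕜) (K : Finset ℕ) (c S : ℕ → 𝕜) : Prop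
    extends Schedule u p K c S where
  S_eq : ∀ k ∈ K, 0 < k → ∃ l < k, c k - c l = S k * (u k - u l)

variable {u p : ℕ → 𝕜} {K K' : Finset ℕ} {c S c' S' : ℕ → 𝕜} {a : ℕ}

/-- Between `l` and `i`, the gap of the intercepts grows at most at the largest rate at which the
revenues differ. -/
theorem Schedule.diff_le (h : Schedule u p K c S) (h' : Schedule u p K' c' S')
    (hu : StrictMono u) {D : 𝕜} {l i : ℕ} (hli : l ≤ i)
    (hD : ∀ q, l ≤ q → q < i → S' q - S q ≤ D) :
    (c' i - c i) - (c' l - c l) ≤ D * (u i - u l) := by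
  induction i, hli using Nat.le_induction with
  | base => simp
  | succ i hi ih =>
    have h1 := ih fun q hq hq' => hD q hq (hq'.trans (Nat.lt_succ_self i))
    have h2 := hD i hi (Nat.lt_succ_self i)
    have h3 : 0 < u (i + 1) - u i := sub_pos.2 (hu (Nat.lt_succ_self i))
    have h4 := mul_le_mul_of_nonneg_right h2 h3.le
    rw [h.c_succ, h'.c_succ]
    linarith

theorem Schedule.le_diff (h : Schedule u p K c S) (h' : Schedule u p K' c' S')
    (hu : StrictMono u) {D : 𝕜} {l i : ℕ} (hli : l ≤ i)
    (hD : ∀ q, l ≤ q → q < i → D ≤ S' q - S q) :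
    D * (u i - u l) ≤ (c' i - c i) - (c' l - c l) := by
  have := h'.diff_le h hu (D := -D) hli fun q h1 h2 => by linarith [hD q h1 h2]
  linarith

/-- The constraint at the prices persists at all later types, because revenues change only at
prices. -/
theorem Schedule.le_sub (h : Schedule u p K c S) (hp : ∀ i, 0 ≤ p i)
    {i l : ℕ} (hl : l ≤ i) : S i * (u i - u l) ≤ c i - c l := by
  induction i, hl using Nat.le_induction with
  | base => simp
  | succ i hi ih =>
    by_cases hk : i + 1 ∈ K
    · exact h.S_le _ hk l (by omega)
    · rw [h.S_skip i hk, h.c_succ]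
      linarith [hp (i + 1)]

theorem GreedySchedule.le_succ (h : GreedySchedule u p K c S) (hu : StrictMono u)
    (hp : ∀ i, 0 ≤ p i) (i : ℕ) : S i ≤ S (i + 1) := by
  by_cases hk : i + 1 ∈ K
  · obtain ⟨l, hl, he⟩ := h.S_eq _ hk (Nat.succ_pos i)
    have h1 := h.le_sub hp (show l ≤ i by omega)
    have h2 : 0 < u (i + 1) - u l := sub_pos.2 (hu hl)
    refine le_of_mul_le_mul_right ?_ h2
    rw [← he, h.c_succ]
    linarith [hp (i + 1)]
  · exact (h.S_skip i hk).ge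

theorem GreedySchedule.monotone (h : GreedySchedule u p K c S) (hu : StrictMono u)
    (hp : ∀ i, 0 ≤ p i) : Monotone S :=
  monotone_nat_of_le_succ (h.le_succ hu hp)

/-- The binding constraint can be chosen so that all earlier ones are slack. -/
theorem GreedySchedule.exists_first (h : GreedySchedule u p K c S) {k : ℕ} (hk : k ∈ K)
    (hk0 : 0 < k) : ∃ l < k, c k - c l = S k * (u k - u l) ∧
      ∀ x < l, S k * (u k - u x) < c k - c x := by
  classical
  have he := h.S_eq k hk hk0
  refine ⟨Nat.find he, (Nat.find_spec he).1, (Nat.find_spec he).2, fun x hx => ?_⟩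
  have hxk := hx.trans (Nat.find_spec he).1
  refine lt_of_le_of_ne (h.S_le k hk x hxk) fun h' => Nat.find_min he hx ⟨hxk, h'.symm⟩

/-- The greedy revenues dominate those of every schedule with fewer prices. -/
theorem Schedule.le_greedy (h : Schedule u p K c S) (h' : GreedySchedule u p K' c' S')
    (hu : StrictMono u) (hp : ∀ i, 0 ≤ p i) {N : ℕ}
    (hK : ∀ i ≤ N, i ∈ K → i ∈ K') : ∀ i ≤ N, S i ≤ S' i := by
  intro i
  induction i using Nat.strong_induction_on with
  | _ i ih =>
    intro hi
    rcases i with _ | i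
    · rw [h.S_zero, h'.S_zero]
    · by_cases hk : i + 1 ∈ K
      · obtain ⟨l, hl, he⟩ := h'.S_eq _ (hK _ hi hk) (Nat.succ_pos i)
        have h1 := h.S_le _ hk l hl
        have h2 := h.le_diff h'.toSchedule hu (D := 0) hl.le fun q _ hq =>
          sub_nonneg.2 (ih q hq (by omega))
        refine le_of_mul_le_mul_right ?_ (sub_pos.2 (hu hl))
        linarith
      · rw [h.S_skip i hk]
        exact (ih i (Nat.lt_succ_self i) (by omega)).trans (h'.le_succ hu hp i)

theorem Schedule.c_le (h : Schedule u p K c S) (h' : Schedule u p K' c' S') (hu : StrictMono u)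
    {i : ℕ} (hS : ∀ q < i, S q ≤ S' q) : c i ≤ c' i := by
  have := h.le_diff h' hu (D := 0) (Nat.zero_le i) fun q _ hq => sub_nonneg.2 (hS q hq)
  rw [h.c_zero, h'.c_zero] at this
  linarith

theorem GreedySchedule.eq_of_agree (h : GreedySchedule u p K c S)
    (h' : GreedySchedule u p K' c' S') (hu : StrictMono u) (hp : ∀ i, 0 ≤ p i) {N : ℕ}
    (hK : ∀ i ≤ N, i ∈ K ↔ i ∈ K') {i : ℕ} (hi : i ≤ N) : S i = S' i :=
  le_antisymm (h.le_greedy h' hu hp (fun i hi => (hK i hi).1) i hi)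
    (h'.le_greedy h hu hp (fun i hi => (hK i hi).2) i hi)

/-! ### The effect of one more price -/

theorem GreedySchedule.le_insert (h : GreedySchedule u p K c S)
    (h' : GreedySchedule u p (insert a K) c' S') (hu : StrictMono u) (hp : ∀ i, 0 ≤ p i) (i : ℕ) :
    S i ≤ S' i :=
  h.le_greedy h' hu hp (N := i) (fun _ _ => Finset.mem_insert_of_mem) i le_rfl

theorem GreedySchedule.insert_eq (h : GreedySchedule u p K c S)
    (h' : GreedySchedule u p (insert a K) c' S') (hu : StrictMono u) (hp : ∀ i, 0 ≤ p i) {i : ℕ}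
    (hi : i < a) : S' i = S i := by
  refine h'.eq_of_agree h hu hp (N := i) (fun j hj => ?_) le_rfl
  rw [Finset.mem_insert, or_iff_right (by omega)]

theorem GreedySchedule.insert_eq_c (h : GreedySchedule u p K c S)
    (h' : GreedySchedule u p (insert a K) c' S') (hu : StrictMono u) (hp : ∀ i, 0 ≤ p i) {i : ℕ}
    (hi : i ≤ a) : c' i = c i :=
  le_antisymm
    (h'.c_le h.toSchedule hu fun q hq => (h.insert_eq h' hu hp (by omega : q < a)).le)
    (h.c_le h'.toSchedule hu fun q hq => (h.insert_eq h' hu hp (by omega : q < a)).ge)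

/-- Suppose that the extra revenue `S' q - S q` due to the price `a` is antitone up to `i`. Then
each constraint for `K` at `i + 1`, with revenue `y`, is matched by a constraint for `insert a K`
with revenue `y + (S' i - S i)` that is at least as tight. If the extra revenue is constant from
`x` on, the matching constraint is the same one; otherwise it is the one that binds where the
extra revenue last dropped, unless that comes after `x`. -/
theorem GreedySchedule.exists_le_of_antitone (h : GreedySchedule u p K c S)
    (h' : GreedySchedule u p (insert a K) c' S') (hu : StrictMono u) (hp : ∀ i, 0 ≤ p i)
    {i x : ℕ} {y : 𝕜} (hx : x ≤ i) (hy : S i ≤ y)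
    (hanti : ∀ q r, a ≤ q → q ≤ r → r ≤ i → S' r - S r ≤ S' q - S q) :
    ∃ z ≤ i, c' (i + 1) - c' z - (u (i + 1) - u z) * (y + (S' i - S i)) ≤
      c (i + 1) - c x - (u (i + 1) - u x) * y := by
  classical
  set D := S' i - S i with hD
  have hD0 : 0 ≤ D := sub_nonneg.2 (h.le_insert h' hu hp i)
  have hex : ∃ k, k ≤ i ∧ ∀ q, k ≤ q → q ≤ i → S' q - S q = D :=
    ⟨i, le_rfl, fun q h1 h2 => by rw [le_antisymm h2 h1]⟩
  obtain ⟨hki, hk⟩ := Nat.find_spec hex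
  set k := Nat.find hex with hkdef
  have hA := h.diff_le h'.toSchedule hu (D := D) (show k ≤ i + 1 by omega)
    fun q h1 h2 => (hk q h1 (by omega)).le
  have key : c' (i + 1) - c (i + 1) - (c' x - c x) ≤ D * (u (i + 1) - u x) →
      ∃ z ≤ i, c' (i + 1) - c' z - (u (i + 1) - u z) * (y + D) ≤
        c (i + 1) - c x - (u (i + 1) - u x) * y := fun hle => ⟨x, hx, by linarith⟩
  rcases le_or_gt k x with hkx | hxk
  · exact key (h.diff_le h'.toSchedule hu (by omega) fun q h1 h2 => (hk q (by omega) (by omega)).le)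
  · -- the difference of the two schedules changes at `k`
    obtain ⟨k', hk'⟩ : ∃ k', k = k' + 1 := ⟨k - 1, by omega⟩
    have hne : S' k' - S k' ≠ D := by
      intro heq
      refine Nat.find_min hex (m := k') (by omega) ⟨by omega, fun q h1 h2 => ?_⟩
      rcases h1.eq_or_lt with rfl | h1
      · exact heq
      · exact hk q (by omega) h2
    have hkK : k ∈ insert a K := by
      by_contra hnot
      refine hne ?_
      rw [← hk k le_rfl hki, hk', h'.S_skip k' (hk' ▸ hnot),
        h.S_skip k' (fun hm => hnot (hk' ▸ Finset.mem_insert_of_mem hm))]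
    obtain ⟨z, hz, hze⟩ := h'.S_eq k hkK (by omega)
    have hSk : S' k = S k + D := by linarith [hk k le_rfl hki]
    rw [hSk] at hze
    have hmono := h.monotone hu hp hki
    rcases le_or_gt z x with hzx | hxz
    · refine ⟨z, by omega, ?_⟩
      have h1 := h.le_sub hp hxk.le
      have h2 : 0 ≤ u x - u z := sub_nonneg.2 (hu.monotone hzx)
      have h3 : S k * (u x - u z) ≤ y * (u x - u z) :=
        mul_le_mul_of_nonneg_right (hmono.trans hy) h2
      linarith
    · refine key ?_
      have h1 := h.le_sub hp hz.le
      have h2 : (c' z - c z) - (c' x - c x) ≤ D * (u z - u x) := by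
        rcases le_or_gt z a with hza | haz
        · refine h.diff_le h'.toSchedule hu hxz.le fun q _ h2 => ?_
          rw [h.insert_eq h' hu hp (by omega), sub_self]
          exact hD0
        · exfalso
          have h3 : D < S' k' - S k' :=
            lt_of_le_of_ne (hk k le_rfl hki ▸ hanti k' k (by omega) (by omega) hki) hne.symm
          have h4 := h.le_diff h'.toSchedule hu (D := S' k' - S k') hz.le fun q h5 h6 =>
            hanti q k' (by omega) (by omega) (by omega)
          have h5 := mul_lt_mul_of_pos_right h3 (sub_pos.2 (hu hz))
          linarith
      linarith

/-- The extra revenue due to an additional price decreases along the later types. -/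
theorem GreedySchedule.sub_antitone (h : GreedySchedule u p K c S)
    (h' : GreedySchedule u p (insert a K) c' S') (hu : StrictMono u) (hp : ∀ i, 0 ≤ p i)
    {q r : ℕ} (haq : a ≤ q) (hqr : q ≤ r) : S' r - S r ≤ S' q - S q := by
  suffices H : ∀ n q r, a ≤ q → q ≤ r → r ≤ n → S' r - S r ≤ S' q - S q from
    H r q r haq hqr le_rfl
  intro n
  induction n with
  | zero => intro q r _ h1 h2; rw [show q = r by omega]
  | succ i ih =>
    intro q r h1 h2 h3
    rcases Nat.lt_or_ge r (i + 1) with hr | hr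
    · exact ih q r h1 h2 (by omega)
    obtain rfl : r = i + 1 := by omega
    rcases h2.eq_or_lt with rfl | hq
    · exact le_rfl
    refine le_trans ?_ (ih q i h1 (by omega) le_rfl)
    have hia : i + 1 ≠ a := by omega
    by_cases hk : i + 1 ∈ K
    · obtain ⟨x, hx, hxe⟩ := h.S_eq _ hk (Nat.succ_pos i)
      obtain ⟨z, hz, hze⟩ := h.exists_le_of_antitone h' hu hp (show x ≤ i by omega)
        (h.le_succ hu hp i) ih
      have h4 := h'.S_le (i + 1) (Finset.mem_insert_of_mem hk) z (by omega)
      have h5 : S' (i + 1) ≤ S (i + 1) + (S' i - S i) := by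
        refine le_of_mul_le_mul_right ?_ (sub_pos.2 (hu (show z < i + 1 by omega)))
        linarith
      linarith
    · rw [h.S_skip i hk, h'.S_skip i (by simp [hia, hk])]

/-- If the tail of the market with the price `a` increases from `l` to `l + 1`, the tail of the
market without it increases at least as much: no later constraint of the former reaches below `l +
1`, so the extra revenue is the same at `l` and at `i`. -/
theorem GreedySchedule.exists_le_of_record (h : GreedySchedule u p K c S)
    (h' : GreedySchedule u p (insert a K) c' S') (hu : StrictMono u) (hp : ∀ i, 0 ≤ p i)
    {i l x : ℕ} (hli : l + 1 ≤ i) (hx : x ≤ l)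
    (hrec : ∀ z ≤ l, (u (l + 1) - u z) * S' i < c' (l + 1) - c' z) :
    ∃ z ≤ l, c' (l + 1) - c' z - (u (l + 1) - u z) * S' i ≤
      c (l + 1) - c x - (u (l + 1) - u x) * S i := by
  rcases Nat.lt_or_ge l a with hla | hla
  · refine ⟨x, hx, ?_⟩
    rw [h.insert_eq_c h' hu hp (show l + 1 ≤ a by omega),
      h.insert_eq_c h' hu hp (show x ≤ a by omega)]
    have := mul_le_mul_of_nonneg_left (h.le_insert h' hu hp i)
      (sub_nonneg.2 (hu.monotone (show x ≤ l + 1 by omega)))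
    linarith
  · have hconst : ∀ q, l + 1 ≤ q → q ≤ i → S' (l + 1) - S (l + 1) ≤ S' q - S q := by
      intro q hq
      induction q, hq using Nat.le_induction with
      | base => exact fun _ => le_rfl
      | succ k hk ih =>
        intro hki
        refine (ih (by omega)).trans ?_
        by_cases hkK : k + 1 ∈ K
        · obtain ⟨z, hz, hze⟩ := h'.S_eq (k + 1) (Finset.mem_insert_of_mem hkK) (Nat.succ_pos k)
          have hzl : l + 1 ≤ z := by
            by_contra hcon
            have h1 := hrec z (by omega)
            have h2 := h'.S_le (k + 1) (Finset.mem_insert_of_mem hkK) (l + 1) (by omega)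
            have h3 := mul_le_mul_of_nonneg_left (h'.monotone hu hp hki)
              (sub_nonneg.2 (hu.monotone (show z ≤ l + 1 by omega)))
            linarith
          have h1 := h.S_le (k + 1) hkK z hz
          have h2 := h.le_diff h'.toSchedule hu (D := S' k - S k) hz.le fun q h3 h4 =>
            h.sub_antitone h' hu hp (show a ≤ q by omega) (show q ≤ k by omega)
          have h3 : S (k + 1) + (S' k - S k) ≤ S' (k + 1) := by
            refine le_of_mul_le_mul_right ?_ (sub_pos.2 (hu hz))
            linarith
          linarith
        · rw [h.S_skip k hkK, h'.S_skip k (by simp [show k + 1 ≠ a by omega, hkK])]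
    have hl : l + 1 ∉ insert a K := by
      intro hmem
      obtain ⟨z, hz, hze⟩ := h'.S_eq (l + 1) hmem (Nat.succ_pos l)
      have h1 := hrec z (by omega)
      have h3 := mul_le_mul_of_nonneg_left (h'.monotone hu hp hli)
        (sub_nonneg.2 (hu.monotone hz.le))
      linarith
    have hlK : l + 1 ∉ K := fun hm => hl (Finset.mem_insert_of_mem hm)
    have heq : S' l - S l = S' i - S i := by
      refine le_antisymm ?_ (h.sub_antitone h' hu hp hla (by omega))
      rw [← h.S_skip l hlK, ← h'.S_skip l hl]
      exact hconst i hli le_rfl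
    obtain ⟨z, hz, hze⟩ := h.exists_le_of_antitone h' hu hp hx
      (h.monotone hu hp (show l ≤ i by omega))
      fun q r h1 h2 _ => h.sub_antitone h' hu hp h1 h2
    refine ⟨z, hz, ?_⟩
    rw [heq, show S i + (S' i - S i) = S' i by ring] at hze
    exact hze

/-! ### Running maxima and unserved mass -/

/-- The mass of the first `l` types that is not served by the schedule, when the prices among the
first `n` types are used. Mass that lies between two records of `c x - u x * S n` is absorbed by the
segments, which is why the running maximum appears. -/
def unserved (u c S : ℕ → 𝕜) (n : ℕ) : ℕ →o 𝕜 :=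
  partialSups fun x => c x - u x * S n

theorem partialSups_nat_succ {α : Type*} [SemilatticeSup α] (f : ℕ → α) (n : ℕ) :
    partialSups f (n + 1) = partialSups f n ⊔ f (n + 1) :=
  partialSups_succ f n

/-- A running maximum is attained at a record. -/
theorem exists_partialSups_eq {α : Type*} [LinearOrder α] (f : ℕ → α) (n : ℕ) :
    ∃ x ≤ n, partialSups f n = f x ∧ ∀ y < x, f y < f x := by
  induction n with
  | zero => exact ⟨0, le_rfl, partialSups_zero f, fun y hy => absurd hy (Nat.not_lt_zero y)⟩
  | succ n ih =>
    obtain ⟨x, hx, he, hy⟩ := ih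
    rw [partialSups_nat_succ]
    rcases le_or_gt (f (n + 1)) (partialSups f n) with h | h
    · exact ⟨x, by omega, by rw [sup_eq_left.2 h, he], hy⟩
    · refine ⟨n + 1, le_rfl, sup_eq_right.2 h.le, fun y hy => ?_⟩
      exact (le_partialSups_of_le f (by omega)).trans_lt h

/-- Running maxima preserve the inequality `g₁ + g₂ ≤ f + h` if, whenever `g₁` or `g₂` reaches a new
record, `f` exceeds its own record at least as much. -/
theorem partialSups_add_le {f g₁ g₂ h : ℕ → 𝕜} {n : ℕ}
    (hsum : ∀ l ≤ n, g₁ l + g₂ l ≤ f l + h l)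
    (h₁ : ∀ l < n, partialSups g₁ l < g₁ (l + 1) →
      g₁ (l + 1) - partialSups g₁ l ≤ f (l + 1) - partialSups f l)
    (h₂ : ∀ l < n, partialSups g₂ l < g₂ (l + 1) →
      g₂ (l + 1) - partialSups g₂ l ≤ f (l + 1) - partialSups f l) :
    partialSups g₁ n + partialSups g₂ n ≤ partialSups f n + partialSups h n := by
  induction n with
  | zero => simpa using hsum 0 le_rfl
  | succ n ih =>
    have ih := ih (fun l hl => hsum l (by omega)) (fun l hl => h₁ l (by omega))
      (fun l hl => h₂ l (by omega))
    have e := hsum (n + 1) le_rfl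
    have e₁ := h₁ n (by omega)
    have e₂ := h₂ n (by omega)
    have hf := le_sup_left (a := partialSups f n) (b := f (n + 1))
    have hf' := le_sup_right (a := partialSups f n) (b := f (n + 1))
    have hh := le_sup_left (a := partialSups h n) (b := h (n + 1))
    have hh' := le_sup_right (a := partialSups h n) (b := h (n + 1))
    simp only [partialSups_nat_succ]
    rcases le_or_gt (g₁ (n + 1)) (partialSups g₁ n) with c₁ | c₁ <;>
    rcases le_or_gt (g₂ (n + 1)) (partialSups g₂ n) with c₂ | c₂
    · rw [sup_eq_left.2 c₁, sup_eq_left.2 c₂]; linarith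
    · rw [sup_eq_left.2 c₁, sup_eq_right.2 c₂.le]; linarith [e₂ c₂]
    · rw [sup_eq_right.2 c₁.le, sup_eq_left.2 c₂]; linarith [e₁ c₁]
    · rw [sup_eq_right.2 c₁.le, sup_eq_right.2 c₂.le]; linarith

/-- A record of the market with the price `a` is also one, by at least the same margin, without this
price. -/
theorem GreedySchedule.record_le (h : GreedySchedule u p K c S)
    (h' : GreedySchedule u p (insert a K) c' S') (hu : StrictMono u) (hp : ∀ i, 0 ≤ p i)
    {i l : ℕ} (hli : l + 1 ≤ i) {y : 𝕜} (hy : y ≤ S i)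
    (hrec : partialSups (fun x => c' x - u x * S' i) l < c' (l + 1) - u (l + 1) * S' i) :
    c' (l + 1) - u (l + 1) * S' i - partialSups (fun x => c' x - u x * S' i) l ≤
      c (l + 1) - u (l + 1) * y - partialSups (fun x => c x - u x * y) l := by
  obtain ⟨x, hx, hxe, -⟩ := exists_partialSups_eq (fun x => c x - u x * y) l
  obtain ⟨z, hz, hze⟩ := h.exists_le_of_record h' hu hp hli hx fun z hz => by
    have := (le_partialSups_of_le (fun x => c' x - u x * S' i) hz).trans_lt hrec
    linarith
  have h1 := le_partialSups_of_le (fun x => c' x - u x * S' i) hz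
  have h2 := mul_le_mul_of_nonneg_left hy
    (sub_nonneg.2 (hu.monotone (show x ≤ l + 1 by omega)))
  rw [hxe]
  linarith

/-- Here `e` is the slope of `d` as a function of `u`. If the slope is always at least the mean
slope from `0`, the mean slope `d / u` is monotone. -/
theorem ratio_le (hu : StrictMono u) (hu0 : u 0 = 0) {d e : ℕ → 𝕜} (hd0 : d 0 = 0)
    (hd : ∀ i, d (i + 1) = d i + (u (i + 1) - u i) * e i) {N : ℕ}
    (hde : ∀ i < N, d i ≤ u i * e i) {l n : ℕ} (hl : l ≤ n) (hn : n ≤ N) :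
    u n * d l ≤ u l * d n := by
  induction n, hl using Nat.le_induction with
  | base => exact le_rfl
  | succ n hl ih =>
    have e1 := ih (by omega)
    have e2 := hde n (by omega)
    rcases Nat.eq_zero_or_pos n with rfl | hn0
    · obtain rfl : l = 0 := by omega
      simp [hu0, hd0]
    have hun : 0 < u n := hu0 ▸ hu hn0
    have hun' : 0 < u (n + 1) := hu0 ▸ hu (Nat.succ_pos n)
    have hul : 0 ≤ u l := hu0 ▸ hu.monotone (Nat.zero_le l)
    have h0 : 0 ≤ u (n + 1) - u n := sub_nonneg.2 (hu.monotone (Nat.le_succ n))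
    rw [hd]
    have e3 := mul_le_mul_of_nonneg_left e2 (mul_nonneg hul h0)
    have e4 := mul_le_mul_of_nonneg_left e1 hun'.le
    refine le_of_mul_le_mul_left ?_ hun
    linarith

variable {c₀ S₀ c₁ S₁ c₂ S₂ c₃ S₃ : ℕ → 𝕜} {b : ℕ}

/-- The core of submodularity: the second difference of the intercepts is at most `u i` times that
of the revenues. If this fails at a price in `K`, let `y` be the value of `S₀` that would give
equality. Then `y < S₀`, so with `y` the constraint at this price is slack, while it binds in the
other three schedules. This contradicts the supermodularity of the running maxima. -/
theorem GreedySchedule.mul_sub_le_of_lt (h₀ : GreedySchedule u p K c₀ S₀)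
    (h₁ : GreedySchedule u p (insert a K) c₁ S₁) (h₂ : GreedySchedule u p (insert b K) c₂ S₂)
    (h₃ : GreedySchedule u p (insert b (insert a K)) c₃ S₃) (hu : StrictMono u) (hu0 : u 0 = 0)
    (hp : ∀ i, 0 ≤ p i) (haK : a ∉ K) (hba : b < a) (i : ℕ) :
    c₁ i + c₂ i - c₃ i - c₀ i ≤ u i * (S₁ i + S₂ i - S₃ i - S₀ i) := by
  have h₃' : GreedySchedule u p (insert a (insert b K)) c₃ S₃ := by
    rwa [Finset.insert_comm] at h₃
  induction i using Nat.strong_induction_on with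
  | _ i ih =>
    rcases lt_trichotomy i a with hia | rfl | hia
    · rw [h₀.insert_eq h₁ hu hp hia, h₂.insert_eq h₃' hu hp hia, h₀.insert_eq_c h₁ hu hp hia.le,
        h₂.insert_eq_c h₃' hu hp hia.le]
      apply le_of_eq; ring
    · rw [h₀.insert_eq_c h₁ hu hp le_rfl, h₂.insert_eq_c h₃' hu hp le_rfl]
      have hui : 0 ≤ u i := hu0 ▸ hu.monotone (Nat.zero_le i)
      have e1 := h₁.sub_antitone h₃ hu hp (show b ≤ i by omega) le_rfl
      obtain ⟨j, rfl⟩ : ∃ j, i = j + 1 := ⟨i - 1, by omega⟩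
      have e1 := h₁.sub_antitone h₃ hu hp (show b ≤ j by omega) (Nat.le_succ j)
      rw [h₀.insert_eq h₁ hu hp (Nat.lt_succ_self j),
        h₂.insert_eq h₃' hu hp (Nat.lt_succ_self j)] at e1
      have e2 := h₀.S_skip j haK
      have e3 := h₂.S_skip j (by simp [haK, hba.ne'])
      have := mul_nonneg hui (show
        0 ≤ S₁ (j + 1) + S₂ (j + 1) - S₃ (j + 1) - S₀ (j + 1) by linarith)
      linarith
    · obtain ⟨j, rfl⟩ : ∃ j, i = j + 1 := ⟨i - 1, by omega⟩
      have hstep : ∀ l, c₁ (l + 1) + c₂ (l + 1) - c₃ (l + 1) - c₀ (l + 1) =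
          c₁ l + c₂ l - c₃ l - c₀ l + (u (l + 1) - u l) * (S₁ l + S₂ l - S₃ l - S₀ l) := by
        intro l
        rw [h₀.c_succ, h₁.c_succ, h₂.c_succ, h₃.c_succ]
        ring
      have hupos : ∀ l, 0 < u (l + 1) := fun l => hu0 ▸ hu (Nat.succ_pos l)
      by_cases hK : j + 1 ∈ K
      · by_contra hcon
        push Not at hcon
        set w := u (j + 1) with hw
        have hwpos : 0 < w := hupos j
        set d := c₁ (j + 1) + c₂ (j + 1) - c₃ (j + 1) - c₀ (j + 1) with hd
        set y := S₁ (j + 1) + S₂ (j + 1) - S₃ (j + 1) - d / w with hy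
        have hdw : w * (d / w) = d := mul_div_cancel₀ _ hwpos.ne'
        have hylt : y < S₀ (j + 1) := by
          have : S₁ (j + 1) + S₂ (j + 1) - S₃ (j + 1) - S₀ (j + 1) < d / w := by
            rw [lt_div_iff₀ hwpos, mul_comm]; exact hcon
          linarith
        have hmain := partialSups_add_le (n := j) (f := fun x => c₀ x - u x * y)
          (g₁ := fun x => c₁ x - u x * S₁ (j + 1)) (g₂ := fun x => c₂ x - u x * S₂ (j + 1))
          (h := fun x => c₃ x - u x * S₃ (j + 1)) (fun l hl => ?_)
          (fun l hl => h₀.record_le h₁ hu hp (by omega) hylt.le)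
          (fun l hl => h₀.record_le h₂ hu hp (by omega) hylt.le)
        · -- a constraint binds at `j + 1`, so the running maximum up to `j` equals the next term
          have htop : ∀ {K' : Finset ℕ} {c S : ℕ → 𝕜}, GreedySchedule u p K' c S → j + 1 ∈ K' →
              partialSups (fun x => c x - u x * S (j + 1)) j =
                c (j + 1) - w * S (j + 1) := by
            intro K' c S h hmem
            obtain ⟨x, hx, hxe⟩ := h.S_eq _ hmem (Nat.succ_pos j)
            refine le_antisymm (partialSups_le _ _ _ fun l hl => ?_) ?_
            · have := h.S_le _ hmem l (by omega)
              linarith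
            · have := le_partialSups_of_le (fun x => c x - u x * S (j + 1)) (show x ≤ j by omega)
              linarith
          have hlt : partialSups (fun x => c₀ x - u x * y) j < c₀ (j + 1) - w * y := by
            obtain ⟨x, hx, hxe, -⟩ := exists_partialSups_eq (fun x => c₀ x - u x * y) j
            rw [hxe]
            have e1 := h₀.S_le _ hK x (by omega)
            have e2 := mul_lt_mul_of_pos_right hylt (sub_pos.2 (hu (show x < j + 1 by omega)))
            linarith
          rw [htop h₁ (by simp [hK]), htop h₂ (by simp [hK]), htop h₃ (by simp [hK])] at hmain
          have : w * y = w * S₁ (j + 1) + w * S₂ (j + 1) - w * S₃ (j + 1) - d := by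
            rw [hy, mul_sub, hdw]; ring
          linarith
        · have e1 := ratio_le hu hu0 (d := fun i => c₁ i + c₂ i - c₃ i - c₀ i)
            (e := fun i => S₁ i + S₂ i - S₃ i - S₀ i)
            (by simp [h₀.c_zero, h₁.c_zero, h₂.c_zero, h₃.c_zero]) hstep (N := j + 1)
            (fun n hn => ih n (by omega)) (show l ≤ j + 1 by omega) le_rfl
          have e2 : c₁ l + c₂ l - c₃ l - c₀ l ≤ u l * (d / w) := by
            rw [mul_div_assoc', le_div_iff₀ hwpos]
            linarith
          have : u l * y = u l * S₁ (j + 1) + u l * S₂ (j + 1) - u l * S₃ (j + 1) -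
            u l * (d / w) := by rw [hy]; ring
          linarith
      · have hne : j + 1 ≠ a := by omega
        have hne' : j + 1 ≠ b := by omega
        rw [h₀.S_skip j hK, h₁.S_skip j (by simp [hK, hne]), h₂.S_skip j (by simp [hK, hne']),
          h₃.S_skip j (by simp [hK, hne, hne']), hstep]
        have := ih j (Nat.lt_succ_self j)
        linarith

theorem GreedySchedule.unserved_add_le_of_lt (h₀ : GreedySchedule u p K c₀ S₀)
    (h₁ : GreedySchedule u p (insert a K) c₁ S₁) (h₂ : GreedySchedule u p (insert b K) c₂ S₂)
    (h₃ : GreedySchedule u p (insert b (insert a K)) c₃ S₃) (hu : StrictMono u) (hu0 : u 0 = 0)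
    (hp : ∀ i, 0 ≤ p i) (haK : a ∉ K) (hba : b < a) {n l : ℕ} (hl : l ≤ n) :
    unserved u c₁ S₁ n l + unserved u c₂ S₂ n l ≤
      unserved u c₀ S₀ n l + unserved u c₃ S₃ n l := by
  refine partialSups_add_le (fun x hx => ?_)
    (fun x hx => h₀.record_le h₁ hu hp (by omega) le_rfl)
    (fun x hx => h₀.record_le h₂ hu hp (by omega) le_rfl)
  rcases Nat.eq_zero_or_pos n with rfl | hn
  · obtain rfl : x = 0 := by omega
    simp [hu0, h₀.c_zero, h₁.c_zero, h₂.c_zero, h₃.c_zero]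
  have hun : 0 < u n := hu0 ▸ hu hn
  have hux : 0 ≤ u x := hu0 ▸ hu.monotone (Nat.zero_le x)
  have key := fun i => h₀.mul_sub_le_of_lt h₁ h₂ h₃ hu hu0 hp haK hba i
  have e1 := ratio_le hu hu0 (d := fun i => c₁ i + c₂ i - c₃ i - c₀ i)
    (e := fun i => S₁ i + S₂ i - S₃ i - S₀ i) (N := n)
    (by simp [h₀.c_zero, h₁.c_zero, h₂.c_zero, h₃.c_zero])
    (fun l => by rw [h₀.c_succ, h₁.c_succ, h₂.c_succ, h₃.c_succ]; ring)
    (fun i _ => key i) (hx.trans hl) le_rfl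
  have e2 := mul_le_mul_of_nonneg_left (key n) hux
  have e3 : c₁ x + c₂ x - c₃ x - c₀ x ≤ u x * (S₁ n + S₂ n - S₃ n - S₀ n) := by
    refine le_of_mul_le_mul_left ?_ hun
    linarith
  linarith

/-- The unserved mass is supermodular in the set of prices. -/
theorem GreedySchedule.unserved_add_le (h₀ : GreedySchedule u p K c₀ S₀)
    (h₁ : GreedySchedule u p (insert a K) c₁ S₁) (h₂ : GreedySchedule u p (insert b K) c₂ S₂)
    (h₃ : GreedySchedule u p (insert b (insert a K)) c₃ S₃) (hu : StrictMono u) (hu0 : u 0 = 0)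
    (hp : ∀ i, 0 ≤ p i) (haK : a ∉ K) (hbK : b ∉ K) (hab : a ≠ b) {n l : ℕ} (hl : l ≤ n) :
    unserved u c₁ S₁ n l + unserved u c₂ S₂ n l ≤
      unserved u c₀ S₀ n l + unserved u c₃ S₃ n l := by
  rcases hab.lt_or_gt with h | h
  · rw [add_comm (unserved u c₁ S₁ n l)]
    rw [Finset.insert_comm] at h₃
    exact h₀.unserved_add_le_of_lt h₂ h₁ h₃ hu hu0 hp hbK h hl
  · exact h₀.unserved_add_le_of_lt h₁ h₂ h₃ hu hu0 hp haK h hl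

/-! ### Optimality of the greedy schedule -/

/-- After a record `l` of its tail, the greedy schedule never loses its lead over another schedule,
because none of its binding constraints reaches below `l`. -/
theorem Schedule.sub_le_sub_of_record (h : Schedule u p K c S) (h' : GreedySchedule u p K' c' S')
    (hu : StrictMono u) (hp : ∀ i, 0 ≤ p i) (hK : K ⊆ K') {i l : ℕ}
    (hrec : ∀ z < l, (u l - u z) * S' i < c' l - c' z) {q : ℕ} (hlq : l ≤ q) (hqi : q ≤ i) :
    S' l - S l ≤ S' q - S q := by
  induction q using Nat.strong_induction_on with
  | _ q ih =>
    rcases hlq.eq_or_lt with rfl | hlq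
    · exact le_rfl
    obtain ⟨k, rfl⟩ : ∃ k, q = k + 1 := ⟨q - 1, by omega⟩
    by_cases hk : k + 1 ∈ K
    · obtain ⟨z, hz, hze⟩ := h'.S_eq (k + 1) (hK hk) (Nat.succ_pos k)
      have hzl : l ≤ z := by
        by_contra hcon
        have h1 := hrec z (by omega)
        have h2 := h'.S_le (k + 1) (hK hk) l (by omega)
        have h3 := mul_le_mul_of_nonneg_left (h'.monotone hu hp hqi)
          (sub_nonneg.2 (hu.monotone (show z ≤ l by omega)))
        linarith
      have h1 := h.S_le (k + 1) hk z hz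
      have h2 := h.le_diff h'.toSchedule hu (D := S' l - S l) hz.le fun q h3 h4 =>
        ih q h4 (by omega) (by omega)
      refine le_of_mul_le_mul_right ?_ (sub_pos.2 (hu hz))
      linarith
    · rw [h.S_skip k hk]
      exact (ih k (Nat.lt_succ_self k) (by omega) (by omega)).trans
        (sub_le_sub_right (h'.le_succ hu hp k) _)

theorem Schedule.c_sub_le (h : Schedule u p K c S) (h' : GreedySchedule u p K' c' S')
    (hu : StrictMono u) (hu0 : u 0 = 0) (hp : ∀ i, 0 ≤ p i) (hK : K ⊆ K') (l : ℕ) :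
    c' l - c l ≤ (S' l - S l) * u l := by
  induction l using Nat.strong_induction_on with
  | _ l ih =>
    rcases l with _ | l
    · simp [hu0, h.c_zero, h'.c_zero]
    by_cases hl : l + 1 ∈ K'
    · obtain ⟨z, hz, hze, hlt⟩ := h'.exists_first hl (Nat.succ_pos l)
      have h1 := h.sub_le_sub_of_record h' hu hp hK (i := l + 1) (l := z)
        (fun x hx => by linarith [hlt x hx]) hz.le le_rfl
      have h2 := mul_le_mul_of_nonneg_right h1 (hu0 ▸ hu.monotone (Nat.zero_le z) : 0 ≤ u z)
      have h3 := h.le_sub hp hz.le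
      linarith [ih z hz]
    · rw [h.S_skip l fun hm => hl (hK hm), h'.S_skip l hl, h.c_succ, h'.c_succ]
      linarith [ih l (Nat.lt_succ_self l)]

/-- Of all schedules with prices in `K'`, the greedy one leaves the least mass unserved, and this
simultaneously for all initial ranges of types. -/
theorem Schedule.unserved_le (h : Schedule u p K c S) (h' : GreedySchedule u p K' c' S')
    (hu : StrictMono u) (hu0 : u 0 = 0) (hp : ∀ i, 0 ≤ p i) (hK : K ⊆ K') {n l : ℕ}
    (hl : l ≤ n) : unserved u c' S' n l ≤ unserved u c S n l := by
  obtain ⟨x, hx, hxe, hlt⟩ := exists_partialSups_eq (fun x => c' x - u x * S' n) l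
  have h1 := h.sub_le_sub_of_record h' hu hp hK (i := n) (l := x)
    (fun z hz => by linarith [hlt z hz]) (hx.trans hl) le_rfl
  have h2 := mul_le_mul_of_nonneg_right h1 (hu0 ▸ hu.monotone (Nat.zero_le x) : 0 ≤ u x)
  have h3 := le_partialSups_of_le (fun x => c x - u x * S n) hx
  have h4 := h.c_sub_le h' hu hu0 hp hK x
  rw [unserved, hxe]
  refine le_trans ?_ h3
  linarith

end Schedules

/-! ### The residual market of the greedy scheme -/

section Residual

set_option linter.unusedSectionVars false

variable {𝕜 : Type*} [Field 𝕜] [LinearOrder 𝕜] [IsStrictOrderedRing 𝕜]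

/-- The tail `r` of a market with types `1, …, i`, after type `i + 1` has been added. -/
def pushTail (p r : ℕ → 𝕜) (i l : ℕ) : 𝕜 := if l ≤ i then r l else r i + p (i + 1)

/-- The largest revenue of a segment with price `1 / u (i + 1)` that can be split off a market with
tail `t`. -/
def maxRevenue (u t : ℕ → 𝕜) (i : ℕ) : 𝕜 :=
  (Finset.range (i + 1)).inf' Finset.nonempty_range_add_one
    fun l => (t (i + 1) - t l) / (u (i + 1) - u l)

/-- The tail of the residual market after the first `i` types: the value at `l` is the mass of the
types `1, …, l` that remains once the segments with prices in `K ∩ [1, i]` have been split off. -/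
def residualTail (u p : ℕ → 𝕜) (K : Finset ℕ) : ℕ → ℕ → 𝕜
  | 0 => fun _ => 0
  | i + 1 =>
    let t := pushTail p (residualTail u p K i) i
    if i + 1 ∈ K then partialSups fun x => t x - maxRevenue u t i * u x else t

/-- Total revenue of the segments split off up to type `i`. -/
def totalRevenue (u p : ℕ → 𝕜) (K : Finset ℕ) : ℕ → 𝕜
  | 0 => 0
  | i + 1 => totalRevenue u p K i +
    if i + 1 ∈ K then maxRevenue u (pushTail p (residualTail u p K i) i) i else 0

/-- The intercepts of the schedule with revenues `totalRevenue`. -/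
def intercept (u p : ℕ → 𝕜) (K : Finset ℕ) : ℕ → 𝕜
  | 0 => 0
  | i + 1 => intercept u p K i + p (i + 1) + (u (i + 1) - u i) * totalRevenue u p K i

variable {u p t : ℕ → 𝕜} {K : Finset ℕ} {i l : ℕ}

theorem pushTail_of_le {r : ℕ → 𝕜} (h : l ≤ i) : pushTail p r i l = r l := if_pos h

theorem pushTail_succ {r : ℕ → 𝕜} : pushTail p r i (i + 1) = r i + p (i + 1) :=
  if_neg (by omega)

theorem maxRevenue_mul_le (hu : StrictMono u) (hl : l ≤ i) :
    maxRevenue u t i * (u (i + 1) - u l) ≤ t (i + 1) - t l := by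
  rw [← le_div_iff₀ (sub_pos.2 (hu (Nat.lt_succ_of_le hl)))]
  exact Finset.inf'_le (fun l => (t (i + 1) - t l) / (u (i + 1) - u l))
    (Finset.mem_range_succ_iff.2 hl)

theorem exists_maxRevenue_mul_eq (hu : StrictMono u) (t : ℕ → 𝕜) (i : ℕ) :
    ∃ l ≤ i, maxRevenue u t i * (u (i + 1) - u l) = t (i + 1) - t l := by
  obtain ⟨l, hl, he⟩ := Finset.exists_mem_eq_inf' (s := Finset.range (i + 1))
    Finset.nonempty_range_add_one fun l => (t (i + 1) - t l) / (u (i + 1) - u l)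
  have hl' := Finset.mem_range_succ_iff.1 hl
  refine ⟨l, hl', ?_⟩
  rw [maxRevenue, he, div_mul_cancel₀]
  exact (sub_pos.2 (hu (Nat.lt_succ_of_le hl'))).ne'

theorem maxRevenue_nonneg (hu : StrictMono u) (ht : ∀ l ≤ i, t l ≤ t (i + 1)) :
    0 ≤ maxRevenue u t i := by
  refine (Finset.le_inf'_iff _ _).2 fun l hl => ?_
  have hl' := Finset.mem_range_succ_iff.1 hl
  exact div_nonneg (sub_nonneg.2 (ht l hl')) (sub_pos.2 (hu (Nat.lt_succ_of_le hl'))).le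

/-- Two splits in succession act on the tail like one split with the sum of the revenues. -/
theorem partialSups_sub_mul (hu : Monotone u) {g : ℕ → 𝕜} {R : 𝕜} (hR : 0 ≤ R) {N : ℕ}
    (ht : ∀ l ≤ N, t l = partialSups g l) (hl : l ≤ N) :
    partialSups (fun x => t x - R * u x) l = partialSups (fun x => g x - R * u x) l := by
  refine le_antisymm (partialSups_le _ _ _ fun x hx => ?_) (partialSups_le _ _ _ fun x hx => ?_)
  · obtain ⟨z, hz, hze, -⟩ := exists_partialSups_eq g x
    have h1 := le_partialSups_of_le (fun x => g x - R * u x) (hz.trans hx)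
    have h2 := mul_le_mul_of_nonneg_left (hu hz) hR
    rw [ht x (hx.trans hl), hze]
    linarith
  · have h1 := le_partialSups_of_le (fun x => t x - R * u x) hx
    have h2 := le_partialSups g x
    have h3 := ht x (hx.trans hl)
    refine le_trans ?_ h1
    linarith

theorem partialSups_succ_sub_le (hu : Monotone u) {R : 𝕜} (hR : 0 ≤ R)
    (ht : t l ≤ t (l + 1)) :
    partialSups (fun x => t x - R * u x) (l + 1) - partialSups (fun x => t x - R * u x) l ≤
      t (l + 1) - t l := by
  rw [partialSups_nat_succ, sub_le_iff_le_add]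
  have h1 := le_partialSups (fun x => t x - R * u x) l
  have h2 := mul_le_mul_of_nonneg_left (hu (Nat.le_succ l)) hR
  simp only at h1
  refine sup_le ?_ ?_ <;> linarith

/-- The residual tail computed step by step agrees with the unserved mass of the schedule. -/
structure ResidualSpec (u p : ℕ → 𝕜) (K : Finset ℕ) (i : ℕ) : Prop where
  eq_sups : ∀ l ≤ i, residualTail u p K i l =
    partialSups (fun x => intercept u p K x - u x * totalRevenue u p K i) l
  eq_last : residualTail u p K i i = intercept u p K i - u i * totalRevenue u p K i

theorem ResidualSpec.push (h : ResidualSpec u p K i) (hp : ∀ i, 0 ≤ p i) (hl : l ≤ i + 1) :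
    pushTail p (residualTail u p K i) i l =
      partialSups (fun x => intercept u p K x - u x * totalRevenue u p K i) l := by
  rcases hl.eq_or_lt with rfl | hl
  · rw [pushTail_succ, partialSups_nat_succ, ← h.eq_sups i le_rfl, h.eq_last, intercept,
      sup_eq_right.2]
    · ring
    · linarith [hp (i + 1)]
  · rw [pushTail_of_le (by omega), h.eq_sups l (by omega)]

theorem ResidualSpec.push_last (h : ResidualSpec u p K i) :
    pushTail p (residualTail u p K i) i (i + 1) =
      intercept u p K (i + 1) - u (i + 1) * totalRevenue u p K i := by
  rw [pushTail_succ, h.eq_last, intercept]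
  ring

theorem residualSpec (hu : StrictMono u) (hu0 : u 0 = 0) (hp : ∀ i, 0 ≤ p i) (i : ℕ) :
    ResidualSpec u p K i := by
  induction i with
  | zero =>
    constructor
    · intro l hl
      obtain rfl : l = 0 := by omega
      simp [residualTail, hu0, intercept]
    · simp [residualTail, hu0, intercept]
  | succ i ih =>
    by_cases hk : i + 1 ∈ K
    · have hmono : ∀ l ≤ i, pushTail p (residualTail u p K i) i l ≤
          pushTail p (residualTail u p K i) i (i + 1) := fun l hl => by
        rw [ih.push hp (by omega), ih.push hp le_rfl]
        exact partialSups_monotone _ (by omega)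
      have hR := maxRevenue_nonneg hu hmono
      set t := pushTail p (residualTail u p K i) i with ht
      have hS : totalRevenue u p K (i + 1) = totalRevenue u p K i + maxRevenue u t i := by
        rw [totalRevenue, if_pos hk]
      have hr : residualTail u p K (i + 1) =
          partialSups fun x => t x - maxRevenue u t i * u x := by
        rw [residualTail]
        simp only [if_pos hk]
        rfl
      refine ⟨fun l hl => ?_, ?_⟩
      · rw [hr, partialSups_sub_mul hu.monotone hR (fun l hl => ih.push hp hl) hl, hS]
        congr 2
        funext x
        ring
      · have hlast : t (i + 1) = _ := ih.push_last
        rw [hr, partialSups_nat_succ, sup_eq_right.2, hS]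
        · linarith
        · refine partialSups_le _ _ _ fun l hl => ?_
          have := maxRevenue_mul_le (t := t) hu hl
          linarith
    · have hS : totalRevenue u p K (i + 1) = totalRevenue u p K i := by
        rw [totalRevenue, if_neg hk, add_zero]
      have hr : residualTail u p K (i + 1) = pushTail p (residualTail u p K i) i := by
        rw [residualTail]
        simp only [if_neg hk]
      refine ⟨fun l hl => ?_, ?_⟩
      · rw [hr, hS, ih.push hp hl]
      · rw [hr, hS, ih.push_last]

theorem greedySchedule (hu : StrictMono u) (hu0 : u 0 = 0) (hp : ∀ i, 0 ≤ p i) :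
    GreedySchedule u p K (intercept u p K) (totalRevenue u p K) where
  c_zero := rfl
  S_zero := rfl
  c_succ _ := rfl
  S_skip i hi := by rw [totalRevenue, if_neg hi, add_zero]
  S_le k hk l hl := by
    obtain ⟨i, rfl⟩ : ∃ i, k = i + 1 := ⟨k - 1, by omega⟩
    have h := residualSpec (K := K) hu hu0 hp i
    have h1 := maxRevenue_mul_le (t := pushTail p (residualTail u p K i) i) hu
      (show l ≤ i by omega)
    have h2 := le_partialSups
      (fun x => intercept u p K x - u x * totalRevenue u p K i) l
    rw [h.push_last, h.push hp (show l ≤ i + 1 by omega)] at h1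
    rw [totalRevenue, if_pos hk]
    simp only at h2
    linarith
  S_eq k hk hk0 := by
    obtain ⟨i, rfl⟩ : ∃ i, k = i + 1 := ⟨k - 1, by omega⟩
    have h := residualSpec (K := K) hu hu0 hp i
    obtain ⟨l, hl, he⟩ := exists_maxRevenue_mul_eq hu (pushTail p (residualTail u p K i) i) i
    obtain ⟨z, hz, hze, -⟩ := exists_partialSups_eq
      (fun x => intercept u p K x - u x * totalRevenue u p K i) l
    have h1 := maxRevenue_mul_le (t := pushTail p (residualTail u p K i) i) hu (hz.trans hl)
    have h2 := le_partialSups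
      (fun x => intercept u p K x - u x * totalRevenue u p K i) z
    have hR : 0 ≤ maxRevenue u (pushTail p (residualTail u p K i) i) i :=
      maxRevenue_nonneg hu fun l hl => by
        rw [h.push hp (by omega), h.push hp le_rfl]
        exact partialSups_monotone _ (by omega)
    have h3 := mul_le_mul_of_nonneg_left (hu.monotone hz) hR
    rw [h.push_last, h.push hp (show l ≤ i + 1 by omega), hze] at he
    rw [h.push_last, h.push hp (show z ≤ i + 1 by omega)] at h1
    refine ⟨z, by omega, ?_⟩
    rw [totalRevenue, if_pos hk]
    simp only at h2
    linarith

theorem residualTail_eq_unserved (hu : StrictMono u) (hu0 : u 0 = 0) (hp : ∀ i, 0 ≤ p i)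
    (hl : l ≤ i) : residualTail u p K i l =
      unserved u (intercept u p K) (totalRevenue u p K) i l :=
  (residualSpec hu hu0 hp i).eq_sups l hl

end Residual


/-! ### Welfare of the greedy scheme -/

section Welfare

set_option linter.unusedSectionVars false

variable {𝕜 : Type*} [Field 𝕜] [LinearOrder 𝕜] [IsStrictOrderedRing 𝕜]

/-- Summation by parts: for decreasing nonnegative values, less mass in every initial range means
less value. -/
theorem sum_mul_sub_nonneg {v g : ℕ → 𝕜} (hv : ∀ j, v (j + 2) ≤ v (j + 1))
    (hv0 : ∀ j, 0 ≤ v (j + 1)) (hg : g 0 = 0) {n : ℕ} (hgn : ∀ l ≤ n, 0 ≤ g l) :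
    0 ≤ ∑ j ∈ Finset.range n, v (j + 1) * (g (j + 1) - g j) := by
  have key : ∀ n, ∑ j ∈ Finset.range n, v (j + 1) * (g (j + 1) - g j) =
      v (n + 1) * g n + ∑ j ∈ Finset.range n, (v (j + 1) - v (j + 2)) * g (j + 1) := by
    intro n
    induction n with
    | zero => simp [hg]
    | succ n ih => rw [Finset.sum_range_succ, ih, Finset.sum_range_succ]; ring
  rw [key]
  refine add_nonneg (mul_nonneg (hv0 n) (hgn n le_rfl)) (Finset.sum_nonneg fun j hj => ?_)
  exact mul_nonneg (sub_nonneg.2 (hv j)) (hgn _ (Finset.mem_range.1 hj))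

/-- Value served by the greedy scheme with price set `K`, for the types `1, …, n`. -/
def greedyWelfare (v u p : ℕ → 𝕜) (n : ℕ) (K : Finset ℕ) : 𝕜 :=
  ∑ j ∈ Finset.range n, v (j + 1) *
    (p (j + 1) - (residualTail u p K n (j + 1) - residualTail u p K n j))

variable {v u p : ℕ → 𝕜} {n : ℕ} {K K' : Finset ℕ}

theorem residualTail_zero_right (hu : StrictMono u) (hu0 : u 0 = 0) (hp : ∀ i, 0 ≤ p i) :
    residualTail u p K n 0 = 0 := by
  rw [residualTail_eq_unserved hu hu0 hp (Nat.zero_le n), unserved, partialSups_zero, hu0]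
  simp [intercept]

theorem greedyWelfare_mono (hv : ∀ j, v (j + 2) ≤ v (j + 1)) (hv0 : ∀ j, 0 ≤ v (j + 1))
    (hu : StrictMono u) (hu0 : u 0 = 0) (hp : ∀ i, 0 ≤ p i) (hK : K ⊆ K') :
    greedyWelfare v u p n K ≤ greedyWelfare v u p n K' := by
  have h := sum_mul_sub_nonneg hv hv0 (n := n)
    (g := fun l => residualTail u p K n l - residualTail u p K' n l)
    (by simp [residualTail_zero_right hu hu0 hp]) fun l hl => by
      rw [residualTail_eq_unserved hu hu0 hp hl, residualTail_eq_unserved hu hu0 hp hl]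
      exact sub_nonneg.2 ((greedySchedule hu hu0 hp).unserved_le (greedySchedule hu hu0 hp)
        hu hu0 hp hK hl)
  rw [← sub_nonneg, greedyWelfare, greedyWelfare, ← Finset.sum_sub_distrib]
  refine h.trans (le_of_eq (Finset.sum_congr rfl fun j _ => ?_))
  ring

theorem greedyWelfare_submodular (hv : ∀ j, v (j + 2) ≤ v (j + 1)) (hv0 : ∀ j, 0 ≤ v (j + 1))
    (hu : StrictMono u) (hu0 : u 0 = 0) (hp : ∀ i, 0 ≤ p i) {a b : ℕ} (ha : a ∉ K)
    (hb : b ∉ K) (hab : a ≠ b) :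
    greedyWelfare v u p n K + greedyWelfare v u p n (insert b (insert a K)) ≤
      greedyWelfare v u p n (insert a K) + greedyWelfare v u p n (insert b K) := by
  have h := sum_mul_sub_nonneg hv hv0 (n := n)
    (g := fun l => residualTail u p K n l + residualTail u p (insert b (insert a K)) n l -
      residualTail u p (insert a K) n l - residualTail u p (insert b K) n l)
    (by simp [residualTail_zero_right hu hu0 hp]) fun l hl => by
      simp only [residualTail_eq_unserved hu hu0 hp hl]
      have := (greedySchedule (K := K) hu hu0 hp).unserved_add_le
        (greedySchedule (K := insert a K) hu hu0 hp) (greedySchedule (K := insert b K) hu hu0 hp)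
        (greedySchedule (K := insert b (insert a K)) hu hu0 hp) hu hu0 hp ha hb hab hl
      linarith
  rw [← sub_nonneg]
  simp only [greedyWelfare, ← Finset.sum_sub_distrib, ← Finset.sum_add_distrib]
  refine h.trans (le_of_eq (Finset.sum_congr rfl fun j _ => ?_))
  ring

theorem greedyWelfare_nonneg (hv : ∀ j, v (j + 2) ≤ v (j + 1)) (hv0 : ∀ j, 0 ≤ v (j + 1))
    (hu : StrictMono u) (hu0 : u 0 = 0) (hp : ∀ i, 0 ≤ p i) :
    0 ≤ greedyWelfare v u p n K := by
  refine le_trans (le_of_eq ?_) (greedyWelfare_mono hv hv0 hu hu0 hp (Finset.empty_subset K))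
  refine (Finset.sum_eq_zero fun j hj => ?_).symm
  have hS : ∀ i, totalRevenue u p ∅ i = 0 := by
    intro i
    induction i with
    | zero => rfl
    | succ i ih => rw [totalRevenue, ih]; simp
  have h : ∀ l ≤ n, residualTail u p ∅ n l = intercept u p ∅ l := by
    intro l hl
    rw [residualTail_eq_unserved hu hu0 hp hl, unserved]
    simp only [hS, mul_zero, sub_zero]
    have hm : Monotone (intercept u p ∅) := monotone_nat_of_le_succ fun i => by
      rw [intercept, hS]; linarith [hp (i + 1)]
    rw [hm.partialSups_eq]
  have hj' := Finset.mem_range.1 hj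
  rw [h _ (by omega), h _ hj'.le, intercept, hS]
  ring

end Welfare

/-! ### Greedy maximization of submodular functions -/

section SetFunction

variable {α : Type*} [DecidableEq α]

theorem submodular_union_le {f : Finset α → ℚ}
    (hsub : ∀ K a b, a ∉ K → b ∉ K → a ≠ b →
      f K + f (insert b (insert a K)) ≤ f (insert a K) + f (insert b K))
    (K O : Finset α) : f (K ∪ O) - f K ≤ ∑ o ∈ O, (f (insert o K) - f K) := by
  have key : ∀ (O : Finset α) (a : α), a ∉ K ∪ O →
      f (insert a (K ∪ O)) - f (K ∪ O) ≤ f (insert a K) - f K := by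
    intro O a
    induction O using Finset.induction_on with
    | empty => simp
    | insert b O hb ih =>
      intro ha
      rw [Finset.union_insert] at ha ⊢
      rw [Finset.mem_insert, not_or] at ha
      by_cases hbK : b ∈ K ∪ O
      · rw [Finset.insert_eq_of_mem hbK]
        exact ih ha.2
      · have h1 := hsub (K ∪ O) b a hbK ha.2 (Ne.symm ha.1)
        linarith [ih ha.2]
  induction O using Finset.induction_on with
  | empty => simp
  | insert b O hb ih =>
    rw [Finset.sum_insert hb, Finset.union_insert]
    by_cases hbK : b ∈ K ∪ O
    · rw [Finset.insert_eq_of_mem hbK]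
      rcases Finset.mem_union.1 hbK with h | h
      · rw [Finset.insert_eq_of_mem h]; linarith
      · exact absurd h hb
    · linarith [key O b hbK]

/-- A greedy step closes at least the fraction `1 / |O|` of the gap to `f O`. -/
theorem greedy_step {f : Finset α → ℚ} (hmono : ∀ K K', K ⊆ K' → f K ≤ f K')
    (hsub : ∀ K a b, a ∉ K → b ∉ K → a ≠ b →
      f K + f (insert b (insert a K)) ≤ f (insert a K) + f (insert b K))
    {K K' O : Finset α} (hO : O.Nonempty) (hbest : ∀ o ∈ O, f (insert o K) ≤ f K') :
    f O - f K' ≤ (1 - 1 / (O.card : ℚ)) * (f O - f K) := by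
  have h1 := submodular_union_le hsub K O
  have h2 := hmono O (K ∪ O) Finset.subset_union_right
  have h3 : ∑ o ∈ O, (f (insert o K) - f K) ≤ O.card * (f K' - f K) := by
    rw [← nsmul_eq_mul]
    exact Finset.sum_le_card_nsmul _ _ _ fun o ho => sub_le_sub_right (hbest o ho) _
  have hc : (0 : ℚ) < O.card := by exact_mod_cast hO.card_pos
  have h4 : (f O - f K) / O.card ≤ f K' - f K := by
    rw [div_le_iff₀ hc]; linarith
  have h5 : (1 - 1 / (O.card : ℚ)) * (f O - f K) = (f O - f K) - (f O - f K) / O.card := by ring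
  linarith

/-- After `|O|` greedy steps the value is at least `(1 - 1 / e) * f O`. -/
theorem greedy_bound {f : Finset α → ℚ} (hmono : ∀ K K', K ⊆ K' → f K ≤ f K')
    (hsub : ∀ K a b, a ∉ K → b ∉ K → a ≠ b →
      f K + f (insert b (insert a K)) ≤ f (insert a K) + f (insert b K))
    (h0 : 0 ≤ f ∅) {O : Finset α} {G : ℕ → Finset α} {N : ℕ}
    (hbest : ∀ s < N, ∀ o ∈ O, f (insert o (G s)) ≤ f (G (s + 1))) (hN : O.card ≤ N) :
    (1 - 1 / Real.exp 1) * (f O : ℝ) ≤ f (G N) := by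
  have hnn : ∀ K, 0 ≤ f K := fun K => h0.trans (hmono _ _ (Finset.empty_subset K))
  rcases O.eq_empty_or_nonempty with rfl | hO
  · have h1 : (f ∅ : ℝ) ≤ f (G N) := by exact_mod_cast hmono _ _ (Finset.empty_subset _)
    have h2 : (0 : ℝ) ≤ f ∅ := by exact_mod_cast h0
    have h3 : 0 ≤ 1 / Real.exp 1 := by positivity
    nlinarith
  have hc : (1 : ℚ) ≤ O.card := by exact_mod_cast hO.card_pos
  have hc0 : (0 : ℚ) ≤ 1 - 1 / (O.card : ℚ) := by
    rw [sub_nonneg, div_le_one (by linarith)]; exact hc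
  have hiter : ∀ s ≤ N, f O - f (G s) ≤ (1 - 1 / (O.card : ℚ)) ^ s * f O := by
    intro s
    induction s with
    | zero => intro _; simpa using hnn (G 0)
    | succ s ih =>
      intro hs
      refine (greedy_step hmono hsub hO (hbest s (by omega))).trans ?_
      rw [pow_succ', mul_assoc]
      exact mul_le_mul_of_nonneg_left (ih (by omega)) hc0
  have h1 := hiter N le_rfl
  have h2 : (1 - 1 / (O.card : ℚ)) ^ N ≤ (1 - 1 / (O.card : ℚ)) ^ O.card :=
    pow_le_pow_of_le_one hc0 (by simp) hN
  have h3 : f O - f (G N) ≤ (1 - 1 / (O.card : ℚ)) ^ O.card * f O :=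
    h1.trans (mul_le_mul_of_nonneg_right h2 (hnn O))
  have h4 : (1 - 1 / (O.card : ℝ)) ^ O.card ≤ 1 / Real.exp 1 := by
    have := Real.one_sub_div_pow_le_exp_neg (n := O.card) (t := 1) (by exact_mod_cast hO.card_pos)
    rwa [Real.exp_neg, ← one_div] at this
  have h5 : (f O : ℝ) - f (G N) ≤ (1 - 1 / (O.card : ℝ)) ^ O.card * f O := by
    have := (Rat.cast_le (K := ℝ)).2 h3
    push_cast at this
    exact this
  have h6 : (0 : ℝ) ≤ f O := by exact_mod_cast hnn O
  have h7 := mul_le_mul_of_nonneg_right h4 h6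
  linarith

end SetFunction


/-! ### Schedules of arbitrary segments -/

section Upper

set_option linter.unusedSectionVars false

variable {𝕜 : Type*} [Field 𝕜] [LinearOrder 𝕜] [IsStrictOrderedRing 𝕜]
variable {u p v : ℕ → 𝕜} {ι : Type*} {s : Finset ι} {y : ι → ℕ → 𝕜} {κ : ι → ℕ}

/-- Mass of the `l` highest types. -/
def headMass (x : ℕ → 𝕜) (l : ℕ) : 𝕜 := ∑ j ∈ Finset.range l, x (j + 1)

theorem headMass_zero (x : ℕ → 𝕜) : headMass x 0 = 0 := by simp [headMass]

theorem headMass_succ (x : ℕ → 𝕜) (l : ℕ) : headMass x (l + 1) = headMass x l + x (l + 1) := by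
  simp [headMass, Finset.sum_range_succ]

theorem headMass_mono {x : ℕ → 𝕜} (hx : ∀ j, 0 ≤ x j) : Monotone (headMass x) :=
  monotone_nat_of_le_succ fun l => by rw [headMass_succ]; linarith [hx (l + 1)]

theorem sum_headMass_sub_le (hsum : ∀ j, ∑ σ ∈ s, y σ j ≤ p j) {l k : ℕ} (h : l ≤ k) :
    ∑ σ ∈ s, (headMass (y σ) k - headMass (y σ) l) ≤ headMass p k - headMass p l := by
  induction k, h using Nat.le_induction with
  | base => simp
  | succ k hk ih =>
    have h1 := hsum (k + 1)
    have h2 : ∑ σ ∈ s, (headMass (y σ) (k + 1) - headMass (y σ) l) =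
        ∑ σ ∈ s, (headMass (y σ) k - headMass (y σ) l) + ∑ σ ∈ s, y σ (k + 1) := by
      rw [← Finset.sum_add_distrib]
      exact Finset.sum_congr rfl fun σ _ => by rw [headMass_succ]; ring
    rw [h2, headMass_succ]
    linarith

/-- Any segments with best prices `κ σ` form a schedule: the best-response inequality `hbest` bounds
the mass of the `l` highest types by the revenue times `u l`, as the continuation below the price
does. -/
theorem schedule_of_segments [DecidableEq ι] (hu : StrictMono u) (hu0 : u 0 = 0)
    (hy : ∀ σ ∈ s, ∀ j, 0 ≤ y σ j) (hsum : ∀ j, ∑ σ ∈ s, y σ j ≤ p j)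
    (hκ : ∀ σ ∈ s, 0 < κ σ)
    (hbest : ∀ σ ∈ s, ∀ l ≤ κ σ, headMass (y σ) l * u (κ σ) ≤ headMass (y σ) (κ σ) * u l) :
    Schedule u p (s.image κ)
      (fun i => headMass p i + ∑ σ ∈ s,
        if κ σ ≤ i then headMass (y σ) (κ σ) / u (κ σ) * (u i - u (κ σ)) else 0)
      (fun i => ∑ σ ∈ s, if κ σ ≤ i then headMass (y σ) (κ σ) / u (κ σ) else 0) where
  c_zero := by
    rw [headMass_zero, zero_add]
    exact Finset.sum_eq_zero fun σ hσ => if_neg (by have := hκ σ hσ; omega)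
  S_zero := Finset.sum_eq_zero fun σ hσ => if_neg (by have := hκ σ hσ; omega)
  c_succ i := by
    rw [headMass_succ, Finset.mul_sum]
    have : ∀ a b c d e : 𝕜, c = d + e → a + b + c = a + d + b + e := fun a b c d e h => by
      rw [h]; ring
    refine this _ _ _ _ _ ?_
    rw [← Finset.sum_add_distrib]
    refine Finset.sum_congr rfl fun σ _ => ?_
    rcases lt_trichotomy (κ σ) (i + 1) with h | h | h
    · rw [if_pos h.le, if_pos (by omega), if_pos (by omega)]; ring
    · rw [if_pos h.le, if_neg (by omega), if_neg (by omega), h]; ring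
    · rw [if_neg (by omega), if_neg (by omega), if_neg (by omega)]; ring
  S_skip i hi := by
    refine Finset.sum_congr rfl fun σ hσ => ?_
    have : κ σ ≠ i + 1 := fun h => hi (h ▸ Finset.mem_image_of_mem κ hσ)
    by_cases h : κ σ ≤ i
    · rw [if_pos h, if_pos (by omega)]
    · rw [if_neg h, if_neg (by omega)]
  S_le k hk l hl := by
    have h1 := sum_headMass_sub_le hsum hl.le
    have key : ∀ σ ∈ s,
        (if κ σ ≤ k then headMass (y σ) (κ σ) / u (κ σ) else 0) * (u k - u l) ≤
        (headMass (y σ) k - headMass (y σ) l) +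
        ((if κ σ ≤ k then headMass (y σ) (κ σ) / u (κ σ) * (u k - u (κ σ)) else 0) -
        if κ σ ≤ l then headMass (y σ) (κ σ) / u (κ σ) * (u l - u (κ σ)) else 0) := by
      intro σ hσ
      have hm := headMass_mono (hy σ hσ)
      have hpos : 0 < u (κ σ) := hu0 ▸ hu (hκ σ hσ)
      rcases le_or_gt (κ σ) l with h | h
      · rw [if_pos (h.trans hl.le), if_pos (h.trans hl.le), if_pos h]
        have := hm hl.le
        linarith
      · rw [if_neg (by omega : ¬ κ σ ≤ l)]
        rcases le_or_gt (κ σ) k with h' | h'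
        · rw [if_pos h', if_pos h']
          have e1 := hbest σ hσ l h.le
          have e2 : headMass (y σ) l ≤ headMass (y σ) (κ σ) / u (κ σ) * u l := by
            rw [div_mul_eq_mul_div, le_div_iff₀ hpos]; exact e1
          have e3 : headMass (y σ) (κ σ) / u (κ σ) * u (κ σ) = headMass (y σ) (κ σ) :=
            div_mul_cancel₀ _ hpos.ne'
          have e4 := hm h'
          linarith
        · rw [if_neg (by omega), if_neg (by omega)]
          have := hm hl.le
          linarith
    have h2 := Finset.sum_le_sum key
    rw [← Finset.sum_mul, Finset.sum_add_distrib, Finset.sum_sub_distrib (f := fun σ =>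
      if κ σ ≤ k then headMass (y σ) (κ σ) / u (κ σ) * (u k - u (κ σ)) else 0)] at h2
    linarith

/-- Segments with best prices in `K` serve at most the value that the greedy scheme for `K`
serves. -/
theorem segments_welfare_le [DecidableEq ι] (hv : ∀ j, v (j + 2) ≤ v (j + 1))
    (hv0 : ∀ j, 0 ≤ v (j + 1)) (hu : StrictMono u) (hu0 : u 0 = 0) (hp : ∀ i, 0 ≤ p i)
    (hy : ∀ σ ∈ s, ∀ j, 0 ≤ y σ j) (hsum : ∀ j, ∑ σ ∈ s, y σ j ≤ p j)
    (hκ : ∀ σ ∈ s, 0 < κ σ) {n : ℕ} (hκn : ∀ σ ∈ s, κ σ ≤ n)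
    (hbest : ∀ σ ∈ s, ∀ l ≤ κ σ, headMass (y σ) l * u (κ σ) ≤ headMass (y σ) (κ σ) * u l)
    {K : Finset ℕ} (hK : s.image κ ⊆ K) {c S : ℕ → 𝕜} (hG : GreedySchedule u p K c S) :
    ∑ σ ∈ s, ∑ j ∈ Finset.range (κ σ), v (j + 1) * y σ (j + 1) ≤
      ∑ j ∈ Finset.range n,
        v (j + 1) * (p (j + 1) - (unserved u c S n (j + 1) - unserved u c S n j)) := by
  have hsch := schedule_of_segments hu hu0 hy hsum hκ hbest
  have hg : ∀ l ≤ n, 0 ≤ headMass p l - unserved u c S n l -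
      ∑ σ ∈ s, headMass (y σ) (min l (κ σ)) := by
    intro l hl
    have h1 := hsch.unserved_le hG hu hu0 hp hK hl
    refine sub_nonneg.2 (le_sub_comm.1 (h1.trans (partialSups_le _ _ _ fun x hx => ?_)))
    have h2 := sum_headMass_sub_le hsum hx
    have key : ∀ σ ∈ s, (if κ σ ≤ x then headMass (y σ) (κ σ) / u (κ σ) * (u x - u (κ σ)) else 0) -
        u x * (if κ σ ≤ n then headMass (y σ) (κ σ) / u (κ σ) else 0) ≤
        (headMass (y σ) l - headMass (y σ) x) - headMass (y σ) (min l (κ σ)) := by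
      intro σ hσ
      have hm := headMass_mono (hy σ hσ)
      have hpos : 0 < u (κ σ) := hu0 ▸ hu (hκ σ hσ)
      have e3 : headMass (y σ) (κ σ) / u (κ σ) * u (κ σ) = headMass (y σ) (κ σ) :=
        div_mul_cancel₀ _ hpos.ne'
      rw [if_pos (hκn σ hσ)]
      rcases le_or_gt (κ σ) x with h | h
      · rw [if_pos h, min_eq_right (h.trans hx)]
        have := hm hx
        linarith
      · rw [if_neg (by omega)]
        have e1 := hbest σ hσ x h.le
        have e2 : headMass (y σ) x ≤ headMass (y σ) (κ σ) / u (κ σ) * u x := by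
          rw [div_mul_eq_mul_div, le_div_iff₀ hpos]; exact e1
        have := hm (min_le_left l (κ σ))
        linarith
    have h3 := Finset.sum_le_sum key
    rw [Finset.sum_sub_distrib, Finset.sum_sub_distrib (f := fun σ =>
      headMass (y σ) l - headMass (y σ) x), ← Finset.mul_sum] at h3
    linarith
  have h := sum_mul_sub_nonneg hv hv0 (n := n)
    (g := fun l => headMass p l - unserved u c S n l -
      ∑ σ ∈ s, headMass (y σ) (min l (κ σ)))
    (by simp [headMass_zero, unserved, hu0, hG.c_zero]) hg
  have hserved : ∀ σ ∈ s, ∑ j ∈ Finset.range (κ σ), v (j + 1) * y σ (j + 1) =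
      ∑ j ∈ Finset.range n, v (j + 1) *
        (headMass (y σ) (min (j + 1) (κ σ)) - headMass (y σ) (min j (κ σ))) := by
    intro σ hσ
    rw [← Finset.sum_subset (Finset.range_subset_range.2 (hκn σ hσ))]
    · refine Finset.sum_congr rfl fun j hj => ?_
      have := Finset.mem_range.1 hj
      rw [min_eq_left (by omega), min_eq_left (by omega), headMass_succ]
      ring
    · intro j _ hj
      have hj' : κ σ ≤ j := not_lt.1 fun h => hj (Finset.mem_range.2 h)
      rw [min_eq_right (by omega), min_eq_right hj']
      ring
  rw [Finset.sum_congr rfl hserved, Finset.sum_comm, ← sub_nonneg, ← Finset.sum_sub_distrib]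
  refine h.trans (le_of_eq (Finset.sum_congr rfl fun j _ => ?_))
  rw [← Finset.mul_sum, Finset.sum_sub_distrib, headMass_succ]
  ring

end Upper

section Cast

theorem GreedySchedule.cast {u p : ℕ → ℚ} {K : Finset ℕ} {c S : ℕ → ℚ}
    (h : GreedySchedule u p K c S) :
    GreedySchedule (fun i => (u i : ℝ)) (fun i => (p i : ℝ)) K (fun i => (c i : ℝ))
      (fun i => (S i : ℝ)) where
  c_zero := by simp [h.c_zero]
  S_zero := by simp [h.S_zero]
  c_succ i := by simp [h.c_succ]
  S_skip i hi := by simp [h.S_skip i hi]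
  S_le k hk l hl := by exact_mod_cast h.S_le k hk l hl
  S_eq k hk hk0 := by
    obtain ⟨l, hl, he⟩ := h.S_eq k hk hk0
    exact ⟨l, hl, by exact_mod_cast he⟩

theorem unserved_cast (u c S : ℕ → ℚ) (n l : ℕ) :
    unserved (fun i => (u i : ℝ)) (fun i => (c i : ℝ)) (fun i => (S i : ℝ)) n l =
      (unserved u c S n l : ℚ) := by
  unfold unserved
  induction l with
  | zero => simp
  | succ l ih => rw [partialSups_nat_succ, partialSups_nat_succ, ih]; simp

end Cast


/-! ### Types in decreasing order of value -/

section Reindex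

/-- The entry of `g` with the `j`-th largest index, for `1 ≤ j ≤ n`; and `0` for other `j`. -/
def atTime {𝕜 : Type*} [Zero 𝕜] {n : ℕ} (g : Fin n → 𝕜) (j : ℕ) : 𝕜 :=
  if h : 0 < j ∧ j ≤ n then g ⟨n - j, by omega⟩ else 0

variable {n : ℕ}

section

variable {𝕜 : Type*} [Zero 𝕜]

theorem atTime_of_lt (g : Fin n → 𝕜) {j : ℕ} (h : n < j) : atTime g j = 0 := dif_neg (by omega)

theorem atTime_sub (g : Fin n → 𝕜) (i : Fin n) : atTime g (n - i) = g i := by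
  rw [atTime, dif_pos (by omega)]
  exact congrArg g (Fin.ext (by simp only; omega))

theorem exists_sub_eq {j : ℕ} (h0 : 0 < j) (hn : j ≤ n) : ∃ i : Fin n, j = n - i :=
  ⟨⟨n - j, by omega⟩, by simp only; omega⟩

end

theorem atTime_nonneg {𝕜 : Type*} [Zero 𝕜] [Preorder 𝕜] {g : Fin n → 𝕜} (h : ∀ i, 0 ≤ g i)
    (j : ℕ) : 0 ≤ atTime g j := by
  unfold atTime
  split
  · exact h _
  · exact le_rfl

theorem atTime_cast (g : Fin n → ℚ) (j : ℕ) :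
    atTime (fun i => (g i : ℝ)) j = (atTime g j : ℚ) := by
  unfold atTime
  split <;> simp

theorem sum_Ici_eq {𝕜 : Type*} [AddCommMonoid 𝕜] (g : Fin n → 𝕜) (k : Fin n) :
    ∑ i ∈ Finset.Ici k, g i = ∑ j ∈ Finset.range (n - k), atTime g (j + 1) := by
  refine Finset.sum_nbij' (fun i => n - 1 - i)
    (fun j => ⟨n - 1 - j, by have := k.2; omega⟩) ?_ ?_ ?_ ?_ ?_
  · intro i hi
    have := Fin.le_def.1 (Finset.mem_Ici.1 hi)
    have := i.2
    exact Finset.mem_range.2 (by omega)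
  · intro j hj
    have := Finset.mem_range.1 hj
    exact Finset.mem_Ici.2 (Fin.le_def.2 (by simp only; omega))
  · intro i _
    ext
    simp only
    omega
  · intro j hj
    have := Finset.mem_range.1 hj
    simp only
    omega
  · intro i _
    rw [← atTime_sub g i]
    congr 1
    omega

theorem sum_univ_eq {𝕜 : Type*} [AddCommMonoid 𝕜] (g : Fin n → 𝕜) :
    ∑ i, g i = ∑ j ∈ Finset.range n, atTime g (j + 1) := by
  rcases n with _ | n
  · simp
  · have h := sum_Ici_eq g 0
    rwa [Fin.val_zero, Nat.sub_zero, ← bot_eq_zero, Finset.Ici_bot] at h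

/-- The reciprocals `1 / v j` of the prices, with `0` at `0`. Beyond the positive prices the
sequence is continued with steps of `1`, so that it is strictly increasing even if the lowest
value is `0`. -/
def invPrice {𝕜 : Type*} [Field 𝕜] [LinearOrder 𝕜] (v : ℕ → 𝕜) : ℕ → 𝕜
  | 0 => 0
  | j + 1 => if 0 < v (j + 1) then 1 / v (j + 1) else invPrice v j + 1

theorem invPrice_of_pos {𝕜 : Type*} [Field 𝕜] [LinearOrder 𝕜] {v : ℕ → 𝕜} {j : ℕ}
    (hj : 0 < j) (h : 0 < v j) : invPrice v j = 1 / v j := by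
  obtain ⟨j, rfl⟩ : ∃ i, j = i + 1 := ⟨j - 1, by omega⟩
  rw [invPrice, if_pos h]

theorem invPrice_strictMono {𝕜 : Type*} [Field 𝕜] [LinearOrder 𝕜] [IsStrictOrderedRing 𝕜]
    {v : ℕ → 𝕜} (hv : ∀ j, 0 < v (j + 2) → v (j + 2) < v (j + 1)) :
    StrictMono (invPrice v) := by
  refine strictMono_nat_of_lt_succ fun j => ?_
  by_cases h : 0 < v (j + 1)
  · rw [invPrice_of_pos (Nat.succ_pos j) h]
    rcases j with _ | j
    · rw [invPrice]
      positivity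
    · have h1 := hv j h
      rw [invPrice_of_pos (Nat.succ_pos j) (h.trans h1)]
      exact one_div_lt_one_div_of_lt h h1
  · rw [invPrice.eq_2, if_neg h]
    linarith

end Reindex

/-! ### The welfare of an arbitrary scheme -/

section Market

variable {n : ℕ} {v p : Fin n → ℚ}

theorem IsMarket.atTime_nonneg (h : IsMarket v p) (j : ℕ) : 0 ≤ atTime v j :=
  LimitedSignaling.atTime_nonneg h.nonneg j

theorem IsMarket.atTime_mass_nonneg (h : IsMarket v p) (j : ℕ) : 0 ≤ atTime p j :=
  LimitedSignaling.atTime_nonneg (fun i => (h.pos i).le) j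

theorem IsMarket.atTime_lt (h : IsMarket v p) {i j : ℕ} (hi : 0 < i) (hij : i < j) (hj : j ≤ n) :
    atTime v j < atTime v i := by
  obtain ⟨a, rfl⟩ := exists_sub_eq hi (hij.le.trans hj)
  obtain ⟨b, rfl⟩ := exists_sub_eq (hi.trans hij) hj
  rw [atTime_sub, atTime_sub]
  exact h.strictMono (Fin.lt_def.2 (by omega))

theorem IsMarket.atTime_succ_le (h : IsMarket v p) (j : ℕ) :
    atTime v (j + 2) ≤ atTime v (j + 1) := by
  by_cases hj : j + 2 ≤ n
  · exact (h.atTime_lt (Nat.succ_pos j) (by omega) hj).le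
  · rw [atTime_of_lt v (by omega)]
    exact h.atTime_nonneg _

theorem IsMarket.invPrice_strictMono (h : IsMarket v p) : StrictMono (invPrice (atTime v)) := by
  refine LimitedSignaling.invPrice_strictMono fun j hj => ?_
  by_cases hjn : j + 2 ≤ n
  · exact h.atTime_lt (Nat.succ_pos j) (by omega) hjn
  · rw [atTime_of_lt v (by omega)] at hj
    exact absurd hj (lt_irrefl 0)

theorem IsMarket.pos_card (h : IsMarket v p) : 0 < n := by
  rcases Nat.eq_zero_or_pos n with rfl | h0
  · simpa using h.sum_eq_one
  · exact h0

theorem exists_isLeast_bestPrice (hn : 0 < n) (v x : Fin n → ℝ) :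
    ∃ k, IsLeast {k | IsBestPrice v x k} k := by
  have : Nonempty (Fin n) := ⟨⟨0, hn⟩⟩
  obtain ⟨k, hk⟩ := Finite.exists_max (revenue v x)
  have hne : {k | IsBestPrice v x k}.Nonempty := ⟨k, hk⟩
  obtain ⟨l, hl, hmin⟩ := Set.exists_min_image _ id (Set.toFinite {k | IsBestPrice v x k}) hne
  exact ⟨l, hl, hmin⟩

/-- Dropping the signal that contributes least costs at most the fraction `1 / M`. -/
theorem exists_card_le_sum_le {m M : ℕ} (hM : 1 < M) (hm : m ≤ M) {w : Fin m → ℝ}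
    (hw : ∀ σ, 0 ≤ w σ) : ∃ s : Finset (Fin m), s.card ≤ M - 1 ∧
      ((M : ℝ) - 1) / M * ∑ σ, w σ ≤ ∑ σ ∈ s, w σ := by
  have hM0 : (0 : ℝ) < M := by exact_mod_cast (by omega : 0 < M)
  rcases hm.lt_or_eq with h | rfl
  · refine ⟨Finset.univ, by simp; omega, ?_⟩
    refine mul_le_of_le_one_left (Finset.sum_nonneg fun σ _ => hw σ) ?_
    rw [div_le_one hM0]
    linarith
  · have : Nonempty (Fin m) := ⟨⟨0, by omega⟩⟩
    obtain ⟨σ, hσ⟩ := Finite.exists_min w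
    refine ⟨Finset.univ.erase σ, by simp, ?_⟩
    have h1 := Finset.card_nsmul_le_sum Finset.univ w (w σ) fun τ _ => hσ τ
    have h2 := Finset.add_sum_erase Finset.univ w (Finset.mem_univ σ)
    rw [Finset.card_univ, Fintype.card_fin, nsmul_eq_mul] at h1
    rw [div_mul_eq_mul_div, div_le_iff₀ hM0]
    nlinarith

theorem IsBestPrice.headMass_le {v x : Fin n → ℝ} {k : Fin n} (h : IsBestPrice v x k) {l : ℕ}
    (hl : 0 < l) (hln : l ≤ n) :
    atTime v l * headMass (atTime x) l ≤ atTime v (n - k) * headMass (atTime x) (n - k) := by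
  obtain ⟨i, rfl⟩ := exists_sub_eq hl hln
  have := h i
  rwa [revenue, revenue, sum_Ici_eq, sum_Ici_eq, ← atTime_sub v i, ← atTime_sub v k] at this

/-- If `0` is a best price, the segment has no mass at positive values. -/
theorem servedWelfare_nonpos_of_bestPrice_zero {v x : Fin n → ℝ} {k : Fin n}
    (hv : ∀ i, 0 ≤ v i) (hx : ∀ i, 0 ≤ x i) (h : IsBestPrice v x k) (hk : v k ≤ 0) :
    ∑ i ∈ Finset.Ici k, v i * x i ≤ 0 := by
  refine Finset.sum_nonpos fun i _ => ?_
  have h1 := h i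
  rw [revenue, revenue, le_antisymm hk (hv k), zero_mul] at h1
  refine le_trans (mul_le_mul_of_nonneg_left ?_ (hv i)) h1
  exact Finset.single_le_sum (fun j _ => hx j) (Finset.mem_Ici.2 le_rfl)

/-- A scheme with at most `M` signals is, up to the factor `(M - 1) / M`, no better than the greedy
scheme for some set of at most `M - 1` positive prices. Signals with best price `0` carry no welfare
and are dropped as well. -/
theorem IsMarket.welfare_le (h : IsMarket v p) {M m : ℕ} (hM : 1 < M) (hm : m ≤ M)
    {Y : Fin n → Fin m → ℝ} (hY : IsScheme (fun i => (p i : ℝ)) Y) :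
    ∃ O : Finset ℕ, O.card ≤ M - 1 ∧ (∀ o ∈ O, 0 < o ∧ o ≤ n ∧ 0 < atTime v o) ∧
      ((M : ℝ) - 1) / M * welfare (fun i => (v i : ℝ)) Y ≤
        (greedyWelfare (atTime v) (invPrice (atTime v)) (atTime p) n O : ℚ) := by
  classical
  set vR : Fin n → ℝ := fun i => (v i : ℝ) with hvR
  have hv0 : ∀ i, 0 ≤ vR i := fun i => Rat.cast_nonneg.2 (h.nonneg i)
  choose k hk using fun σ => exists_isLeast_bestPrice h.pos_card vR fun i => Y i σ
  have hw : ∀ σ, servedWelfare vR (fun i => Y i σ) = ∑ i ∈ Finset.Ici (k σ), vR i * Y i σ :=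
    fun σ => servedWelfare_eq (hk σ)
  obtain ⟨s, hs, hle⟩ := exists_card_le_sum_le hM hm (w := fun σ =>
    ∑ i ∈ Finset.Ici (k σ), vR i * Y i σ)
    fun σ => Finset.sum_nonneg fun i _ => mul_nonneg (hv0 i) (hY.nonneg i σ)
  set s' := s.filter fun σ => 0 < v (k σ) with hs'
  have hκpos : ∀ σ ∈ s', 0 < atTime v (n - k σ) := fun σ hσ => by
    rw [atTime_sub]
    exact (Finset.mem_filter.1 hσ).2
  have hκ0 : ∀ σ, 0 < n - (k σ : ℕ) := fun σ => by omega
  refine ⟨s'.image fun σ => n - (k σ : ℕ),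
    Finset.card_image_le.trans ((Finset.card_filter_le _ _).trans hs), ?_, ?_⟩
  · intro o ho
    obtain ⟨σ, hσ, rfl⟩ := Finset.mem_image.1 ho
    exact ⟨hκ0 σ, Nat.sub_le _ _, hκpos σ hσ⟩
  have hu := h.invPrice_strictMono
  have hp := h.atTime_mass_nonneg
  have hG := greedySchedule (K := s'.image fun σ => n - (k σ : ℕ)) hu rfl hp
  have hyn : ∀ σ ∈ s', ∀ j, 0 ≤ atTime (fun i => Y i σ) j := fun σ _ j =>
    LimitedSignaling.atTime_nonneg (fun i => hY.nonneg i σ) j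
  have hsum : ∀ j, ∑ σ ∈ s', atTime (fun i => Y i σ) j ≤ ((atTime p j : ℚ) : ℝ) := by
    intro j
    by_cases hj : 0 < j ∧ j ≤ n
    · obtain ⟨i, rfl⟩ := exists_sub_eq hj.1 hj.2
      simp only [atTime_sub]
      rw [← hY.sum_eq i]
      exact Finset.sum_le_sum_of_subset_of_nonneg (Finset.subset_univ _)
        fun σ _ _ => hY.nonneg i σ
    · simp [atTime, dif_neg hj]
  have hbest : ∀ σ ∈ s', ∀ l ≤ n - (k σ : ℕ),
      headMass (atTime fun i => Y i σ) l * ((invPrice (atTime v) (n - k σ) : ℚ) : ℝ) ≤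
        headMass (atTime fun i => Y i σ) (n - k σ) * ((invPrice (atTime v) l : ℚ) : ℝ) := by
    intro σ hσ l hl
    rcases Nat.eq_zero_or_pos l with rfl | hl0
    · simp [headMass_zero, invPrice]
    · have h1 := hκpos σ hσ
      have h2 : 0 < atTime v l := by
        rcases hl.eq_or_lt with rfl | hlt
        · exact h1
        · exact h1.trans (h.atTime_lt hl0 hlt (Nat.sub_le _ _))
      have h3 := (hk σ).1.headMass_le hl0 (hl.trans (Nat.sub_le _ _))
      rw [invPrice_of_pos hl0 h2, invPrice_of_pos (hκ0 σ) h1]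
      rw [hvR, atTime_cast, atTime_cast] at h3
      have h1' : (0 : ℝ) < (atTime v (n - k σ) : ℚ) := Rat.cast_pos.2 h1
      have h2' : (0 : ℝ) < (atTime v l : ℚ) := Rat.cast_pos.2 h2
      push_cast
      rw [mul_one_div, mul_one_div, div_le_div_iff₀ h1' h2']
      linarith
  have key := segments_welfare_le (s := s') (v := fun j => ((atTime v j : ℚ) : ℝ))
    (u := fun j => ((invPrice (atTime v) j : ℚ) : ℝ)) (p := fun j => ((atTime p j : ℚ) : ℝ))
    (y := fun σ => atTime fun i => Y i σ) (κ := fun σ => n - (k σ : ℕ)) (n := n)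
    (fun j => Rat.cast_le.2 (h.atTime_succ_le j)) (fun j => Rat.cast_nonneg.2 (h.atTime_nonneg _))
    (fun a b hab => Rat.cast_lt.2 (hu hab)) (by simp [invPrice])
    (fun i => Rat.cast_nonneg.2 (hp i)) hyn hsum (fun σ _ => hκ0 σ) (fun σ _ => Nat.sub_le _ _)
    hbest subset_rfl hG.cast
  have e1 : welfare vR Y = ∑ σ, ∑ i ∈ Finset.Ici (k σ), vR i * Y i σ :=
    Finset.sum_congr rfl fun σ _ => hw σ
  have e2 : ∑ σ ∈ s, ∑ i ∈ Finset.Ici (k σ), vR i * Y i σ ≤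
      ∑ σ ∈ s', ∑ i ∈ Finset.Ici (k σ), vR i * Y i σ := by
    rw [← Finset.sum_filter_add_sum_filter_not s fun σ => 0 < v (k σ)]
    refine add_le_of_nonpos_right (Finset.sum_nonpos fun σ hσ => ?_)
    refine servedWelfare_nonpos_of_bestPrice_zero hv0 (fun i => hY.nonneg i σ) (hk σ).1 ?_
    exact Rat.cast_nonpos.2 (not_lt.1 (Finset.mem_filter.1 hσ).2)
  have e3 : ∀ σ, ∑ i ∈ Finset.Ici (k σ), vR i * Y i σ = ∑ j ∈ Finset.range (n - (k σ : ℕ)),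
      ((atTime v (j + 1) : ℚ) : ℝ) * atTime (fun i => Y i σ) (j + 1) := by
    intro σ
    rw [sum_Ici_eq]
    refine Finset.sum_congr rfl fun j hj => ?_
    have := Finset.mem_range.1 hj
    obtain ⟨i, hi⟩ := exists_sub_eq (n := n) (Nat.succ_pos j) (by omega)
    rw [← Nat.succ_eq_add_one, hi, atTime_sub, atTime_sub, atTime_sub]
  rw [e1]
  refine hle.trans (e2.trans (le_trans (le_of_eq (Finset.sum_congr rfl fun σ _ => e3 σ))
    (key.trans (le_of_eq ?_))))
  rw [greedyWelfare]
  push_cast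
  refine Finset.sum_congr rfl fun j hj => ?_
  have hj' := Finset.mem_range.1 hj
  rw [residualTail_eq_unserved hu rfl hp (by omega), residualTail_eq_unserved hu rfl hp hj'.le,
    unserved_cast, unserved_cast]

end Market


/-! ### Polynomial bounds -/

section PolyBdd

/-- On the set `I`, the function `g` is bounded by a polynomial in `N`. -/
def PolyBdd {α : Type*} (I : Set α) (N g : α → ℕ) : Prop :=
  ∃ q : Polynomial ℕ, ∀ x ∈ I, g x ≤ q.eval (N x)

theorem polynomial_eval_mono (q : Polynomial ℕ) : Monotone fun x => q.eval x := by
  intro x y h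
  simp only [Polynomial.eval_eq_sum_range]
  gcongr

variable {α β : Type*} {I : Set α} {J : Set β} {N g g' : α → ℕ}

theorem PolyBdd.mono (h : PolyBdd I N g') (hg : ∀ x ∈ I, g x ≤ g' x) : PolyBdd I N g :=
  let ⟨q, hq⟩ := h
  ⟨q, fun x hx => (hg x hx).trans (hq x hx)⟩

theorem PolyBdd.subset {I' : Set α} (h : PolyBdd I N g) (hI : I' ⊆ I) : PolyBdd I' N g :=
  let ⟨q, hq⟩ := h
  ⟨q, fun x hx => hq x (hI hx)⟩

theorem PolyBdd.add (h : PolyBdd I N g) (h' : PolyBdd I N g') :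
    PolyBdd I N fun x => g x + g' x :=
  let ⟨q, hq⟩ := h
  let ⟨q', hq'⟩ := h'
  ⟨q + q', fun x hx => by
    rw [Polynomial.eval_add]; exact Nat.add_le_add (hq x hx) (hq' x hx)⟩

theorem PolyBdd.mul (h : PolyBdd I N g) (h' : PolyBdd I N g') :
    PolyBdd I N fun x => g x * g' x :=
  let ⟨q, hq⟩ := h
  let ⟨q', hq'⟩ := h'
  ⟨q * q', fun x hx => by
    rw [Polynomial.eval_mul]; exact Nat.mul_le_mul (hq x hx) (hq' x hx)⟩

theorem polyBdd_const (c : ℕ) : PolyBdd I N fun _ => c :=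
  ⟨Polynomial.C c, fun x _ => by simp⟩

theorem polyBdd_self : PolyBdd I N N :=
  ⟨Polynomial.X, fun x _ => by simp⟩

theorem PolyBdd.comp {N' h' : β → ℕ} (h : PolyBdd J N' h') {φ : α → β}
    (hφ : ∀ x ∈ I, φ x ∈ J) (hN : PolyBdd I N fun x => N' (φ x)) :
    PolyBdd I N fun x => h' (φ x) :=
  let ⟨q, hq⟩ := h
  let ⟨r, hr⟩ := hN
  ⟨q.comp r, fun x hx => by
    rw [Polynomial.eval_comp]
    exact (hq _ (hφ x hx)).trans (polynomial_eval_mono q (hr x hx))⟩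

end PolyBdd

/-! ### Bit length of rational numbers -/

section RatSize

/-- Bit length of `|num q| + den q`. Up to constant factors this is the bit length of `q`, and
it is subadditive for all arithmetic operations. -/
def heightSize (q : ℚ) : ℕ := Nat.size (q.num.natAbs + q.den)

theorem num_den_le {q : ℚ} {a b : ℤ} (hb : b ≠ 0) (h : q = a / b) :
    q.num.natAbs ≤ a.natAbs ∧ q.den ≤ b.natAbs := by
  rw [← Rat.divInt_eq_div] at h
  subst h
  constructor
  · by_cases ha : a = 0
    · simp [ha]
    · exact Nat.le_of_dvd (Int.natAbs_pos.2 ha) (Int.natAbs_dvd_natAbs.2 (Rat.num_dvd a hb))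
  · have := Int.natAbs_dvd_natAbs.2 (Rat.den_dvd a b)
    rw [Int.natAbs_natCast] at this
    exact Nat.le_of_dvd (Int.natAbs_pos.2 hb) this

theorem size_mul_le (a b : ℕ) : Nat.size (a * b) ≤ Nat.size a + Nat.size b := by
  rw [Nat.size_le, pow_add]
  rcases Nat.eq_zero_or_pos b with rfl | hb
  · simp
  · exact Nat.mul_lt_mul'' (Nat.lt_size_self a) (Nat.lt_size_self b)

theorem heightSize_mul_le_of {q x y : ℚ}
    (h : q.num.natAbs + q.den ≤ (x.num.natAbs + x.den) * (y.num.natAbs + y.den)) :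
    heightSize q ≤ heightSize x + heightSize y :=
  (Nat.size_le_size h).trans (size_mul_le _ _)

theorem heightSize_add_le (x y : ℚ) : heightSize (x + y) ≤ heightSize x + heightSize y := by
  have hx : (x.den : ℤ) ≠ 0 := by exact_mod_cast x.den_nz
  have hy : (y.den : ℤ) ≠ 0 := by exact_mod_cast y.den_nz
  have h := num_den_le (q := x + y) (a := x.num * y.den + y.num * x.den) (b := x.den * y.den)
    (mul_ne_zero hx hy) (by
      have hx' : (x.den : ℚ) ≠ 0 := by exact_mod_cast x.den_nz
      have hy' : (y.den : ℚ) ≠ 0 := by exact_mod_cast y.den_nz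
      push_cast
      rw [eq_div_iff (mul_ne_zero hx' hy')]
      nth_rewrite 1 [← Rat.num_div_den x, ← Rat.num_div_den y]
      field_simp)
  have h1 := Int.natAbs_add_le (x.num * y.den) (y.num * x.den)
  simp only [Int.natAbs_mul, Int.natAbs_natCast] at h h1
  refine heightSize_mul_le_of ?_
  nlinarith [h.1, h.2, Nat.zero_le (x.num.natAbs * y.num.natAbs)]

theorem heightSize_mul_le (x y : ℚ) : heightSize (x * y) ≤ heightSize x + heightSize y := by
  have hx : (x.den : ℤ) ≠ 0 := by exact_mod_cast x.den_nz
  have hy : (y.den : ℤ) ≠ 0 := by exact_mod_cast y.den_nz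
  have h := num_den_le (q := x * y) (a := x.num * y.num) (b := x.den * y.den)
    (mul_ne_zero hx hy) (by
      push_cast
      rw [mul_div_mul_comm, Rat.num_div_den, Rat.num_div_den])
  simp only [Int.natAbs_mul, Int.natAbs_natCast] at h
  refine heightSize_mul_le_of ?_
  nlinarith [h.1, h.2, Nat.zero_le (x.num.natAbs * y.den), Nat.zero_le (x.den * y.num.natAbs)]

theorem heightSize_neg (x : ℚ) : heightSize (-x) = heightSize x := by simp [heightSize]

theorem heightSize_inv_le (x : ℚ) : heightSize x⁻¹ ≤ heightSize x := by
  rcases eq_or_ne x 0 with rfl | hx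
  · simp
  · have h := num_den_le (q := x⁻¹) (a := x.den) (b := x.num) (Rat.num_ne_zero.2 hx) (by
      nth_rewrite 1 [← Rat.num_div_den x]
      rw [inv_div]
      simp)
    rw [Int.natAbs_natCast] at h
    exact Nat.size_le_size (by omega)

theorem heightSize_sub_le (x y : ℚ) : heightSize (x - y) ≤ heightSize x + heightSize y := by
  rw [sub_eq_add_neg, ← heightSize_neg y]
  exact heightSize_add_le x (-y)

theorem heightSize_div_le (x y : ℚ) : heightSize (x / y) ≤ heightSize x + heightSize y := by
  rw [div_eq_mul_inv]
  exact (heightSize_mul_le x y⁻¹).trans (Nat.add_le_add_left (heightSize_inv_le y) _)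

theorem heightSize_le (q : ℚ) : heightSize q ≤ ratSize q := by
  have h1 := Nat.lt_size_self q.num.natAbs
  have h2 := Nat.lt_size_self q.den
  have h3 := Nat.size_pos.2 q.den_pos
  rw [heightSize, ratSize, Nat.size_le]
  have h4 : 2 ^ Nat.size q.num.natAbs ≤ 2 ^ (Nat.size q.num.natAbs + Nat.size q.den) :=
    Nat.pow_le_pow_right (by omega) (by omega)
  have h5 : 2 ^ Nat.size q.den ≤ 2 ^ (Nat.size q.num.natAbs + Nat.size q.den) :=
    Nat.pow_le_pow_right (by omega) (by omega)
  rw [add_assoc, pow_add, pow_one]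
  omega

theorem ratSize_le (q : ℚ) : ratSize q ≤ 1 + 2 * heightSize q := by
  have h1 : Nat.size q.num.natAbs ≤ heightSize q := Nat.size_le_size (by omega)
  have h2 : Nat.size q.den ≤ heightSize q := Nat.size_le_size (by omega)
  rw [ratSize]
  omega

end RatSize

/-! ### Running time of programs -/

section Cost

theorem Ty.size_prod {a b : Ty} (x : (Ty.prod a b).Val) :
    (Ty.prod a b).size x = 1 + a.size x.1 + b.size x.2 := rfl

theorem Ty.size_nil {a : Ty} : (Ty.list a).size ([] : List a.Val) = 1 := rfl

theorem Ty.size_cons {a : Ty} (y : a.Val) (l : List a.Val) :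
    (Ty.list a).size (y :: l) = 1 + a.size y + (Ty.list a).size l := by
  simp only [Ty.size, List.map_cons, List.sum_cons]
  omega

theorem Ty.size_append {a : Ty} (l l' : List a.Val) :
    (Ty.list a).size (l ++ l') + 1 = (Ty.list a).size l + (Ty.list a).size l' := by
  simp only [Ty.size, List.map_append, List.sum_append]
  omega

theorem Ty.size_reverse {a : Ty} (l : List a.Val) :
    (Ty.list a).size l.reverse = (Ty.list a).size l := by
  simp [Ty.size]

theorem Ty.size_le_of_mem {a : Ty} {y : a.Val} {l : List a.Val} (h : y ∈ l) :
    a.size y + 2 ≤ (Ty.list a).size l := by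
  obtain ⟨l₁, l₂, rfl⟩ := List.append_of_mem h
  have h1 := Ty.size_append l₁ (y :: l₂)
  have h2 := Ty.size_cons y l₂
  simp only [Ty.size] at *
  omega

theorem Ty.length_lt_size {a : Ty} (l : List a.Val) : l.length < (Ty.list a).size l := by
  induction l with
  | nil => simp [Ty.size]
  | cons y l ih => rw [Ty.size_cons, List.length_cons]; omega

theorem Ty.size_list_le {a : Ty} {l : List a.Val} {B : ℕ} (h : ∀ y ∈ l, a.size y ≤ B) :
    (Ty.list a).size l ≤ 1 + l.length * (1 + B) := by
  induction l with
  | nil => simp [Ty.size]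
  | cons y l ih =>
    rw [Ty.size_cons, List.length_cons, Nat.succ_mul]
    have h1 := h y (by simp)
    have h2 := ih fun z hz => h z (by simp [hz])
    omega

theorem Op.size_eval_le {a b : Ty} (o : Op a b) :
    ∃ c, ∀ x, b.size (o.eval x) ≤ c + 4 * a.size x := by
  have key : ∀ (x : (Ty.prod .rat .rat).Val) (q : ℚ),
      heightSize q ≤ heightSize x.1 + heightSize x.2 →
      ratSize q ≤ 1 + 4 * (Ty.prod .rat .rat).size x := by
    intro x q hq
    have h1 := heightSize_le x.1
    have h2 := heightSize_le x.2
    have h3 := ratSize_le q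
    have h4 : (Ty.prod .rat .rat).size x = 1 + ratSize x.1 + ratSize x.2 := rfl
    omega
  cases o with
  | const q => exact ⟨ratSize q, fun x => Nat.le_add_right _ _⟩
  | add => exact ⟨1, fun x => key x _ (heightSize_add_le _ _)⟩
  | sub => exact ⟨1, fun x => key x _ (heightSize_sub_le _ _)⟩
  | mul => exact ⟨1, fun x => key x _ (heightSize_mul_le _ _)⟩
  | div => exact ⟨1, fun x => key x _ (heightSize_div_le _ _)⟩
  | le => exact ⟨1, fun x => Nat.le_add_right _ _⟩
  | num =>
    refine ⟨2, fun x => ?_⟩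
    simp only [Ty.size, Op.eval, ratSize, Rat.num_intCast, Rat.den_intCast, Nat.size_one]
    omega
  | den =>
    refine ⟨2, fun x => ?_⟩
    simp only [Ty.size, Op.eval, ratSize, Rat.num_natCast, Rat.den_natCast, Nat.size_one,
      Int.natAbs_natCast]
    omega
  | bits =>
    refine ⟨1, fun x => ?_⟩
    have h : (Nat.bits x.num.natAbs).length = Nat.size x.num.natAbs :=
      (Nat.size_eq_bits_len _)
    have h2 : ratSize x = 1 + Nat.size x.num.natAbs + Nat.size x.den := rfl
    simp only [Ty.size, Op.eval, List.map_const', List.sum_replicate, smul_eq_mul]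
    omega
  | fst =>
    refine ⟨0, fun x => ?_⟩
    rw [Ty.size_prod]
    simp only [Op.eval]
    omega
  | snd =>
    refine ⟨0, fun x => ?_⟩
    rw [Ty.size_prod]
    simp only [Op.eval]
    omega
  | nil => exact ⟨1, fun x => Nat.le_add_right _ _⟩
  | cons =>
    refine ⟨0, fun x => ?_⟩
    rw [Ty.size_prod]
    simp only [Op.eval]
    rw [Ty.size_cons]
    omega
  | id => exact ⟨0, fun x => by simp only [Op.eval]; omega⟩

theorem foldl_size_le {S A : Type} (f : S × A → S) (c sz : S × A → ℕ) (size : S → ℕ)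
    (h : ∀ x, size (f x) ≤ c x) (s : S) (l : List A) :
    size (l.foldl (fun s y => f (s, y)) s) ≤ size s + foldCost f c sz s l := by
  induction l generalizing s with
  | nil => exact Nat.le_add_right _ _
  | cons y l ih =>
    rw [List.foldl_cons, foldCost]
    have h1 := ih (f (s, y))
    have h2 := h (s, y)
    omega

/-- The cost of a program covers the size of its output. -/
theorem Prog.size_eval_le_cost {a b : Ty} (A : Prog a b) (x : a.Val) :
    b.size (A.eval x) ≤ A.cost x := by
  induction A with
  | op o => exact Nat.le_add_left _ _
  | comp g f ihg _ => exact (ihg _).trans (Nat.le_add_left _ _)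
  | @pair a b c f g ihf ihg =>
    have h1 := ihf x
    have h2 := ihg x
    rw [Ty.size_prod, Prog.cost, Prog.eval]
    simp only
    omega
  | ite c f g _ ihf ihg =>
    rw [Prog.cost, Prog.eval]
    have h1 := ihf x
    have h2 := ihg x
    split <;> omega
  | listCase f g ihf ihg =>
    obtain ⟨x, l⟩ := x
    rw [Prog.cost, Prog.eval]
    cases l with
    | nil => exact (ihf x).trans (Nat.le_add_left _ _)
    | cons y l => exact (ihg _).trans (Nat.le_add_left _ _)
  | @fold s a f ih =>
    rw [Prog.cost, Prog.eval]
    refine (foldl_size_le f.eval f.cost (Ty.prod s a).size s.size ih x.1 x.2).trans ?_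
    rw [Ty.size_prod]
    omega

variable {a b c : Ty} {I : Set a.Val}

theorem Prog.PolyTimeOn.bdd {A : Prog a b} (h : A.PolyTimeOn I) : PolyBdd I a.size A.cost := h

theorem Prog.PolyTimeOn.size_bdd {A : Prog a b} (h : A.PolyTimeOn I) :
    PolyBdd I a.size fun x => b.size (A.eval x) :=
  h.bdd.mono fun x _ => A.size_eval_le_cost x

theorem Prog.PolyTimeOn.subset {A : Prog a b} (h : A.PolyTimeOn I) {I' : Set a.Val}
    (hI : I' ⊆ I) : A.PolyTimeOn I' := PolyBdd.subset h hI

theorem Prog.polyTimeOn_op (o : Op a b) : (Prog.op o).PolyTimeOn I := by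
  obtain ⟨c, hc⟩ := o.size_eval_le
  refine PolyBdd.mono (g' := fun x => 1 + a.size x + (c + 4 * a.size x)) ?_ fun x _ => ?_
  · exact ((polyBdd_const 1).add polyBdd_self).add
      ((polyBdd_const c).add ((polyBdd_const 4).mul polyBdd_self))
  · have := hc x
    rw [Prog.cost]
    omega

theorem Prog.PolyTimeOn.comp {g : Prog b c} {f : Prog a b} {J : Set b.Val}
    (hg : g.PolyTimeOn J) (hf : f.PolyTimeOn I) (hJ : ∀ x ∈ I, f.eval x ∈ J) :
    (Prog.comp g f).PolyTimeOn I :=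
  ((polyBdd_const 1).add hf.bdd).add (hg.bdd.comp hJ hf.size_bdd)

theorem Prog.PolyTimeOn.pair {f : Prog a b} {g : Prog a c} (hf : f.PolyTimeOn I)
    (hg : g.PolyTimeOn I) : (Prog.pair f g).PolyTimeOn I :=
  (((polyBdd_const 1).add polyBdd_self).add hf.bdd).add hg.bdd

theorem Prog.PolyTimeOn.ite {t : Prog a .bool} {f g : Prog a b} (ht : t.PolyTimeOn I)
    (hf : f.PolyTimeOn {x ∈ I | t.eval x = true})
    (hg : g.PolyTimeOn {x ∈ I | ¬ t.eval x = true}) : (Prog.ite t f g).PolyTimeOn I := by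
  obtain ⟨q, hq⟩ := hf
  obtain ⟨r, hr⟩ := hg
  refine PolyBdd.mono (((((polyBdd_const 1).add polyBdd_self).add ht.bdd).add
    ⟨q, fun x _ => le_rfl⟩).add ⟨r, fun x _ => le_rfl⟩) fun x hx => ?_
  rw [Prog.cost]
  split
  · have := hq x ⟨hx, by assumption⟩
    omega
  · have := hr x ⟨hx, by assumption⟩
    omega

theorem Prog.PolyTimeOn.ite' {t : Prog a .bool} {f g : Prog a b} (ht : t.PolyTimeOn I)
    (hf : f.PolyTimeOn I) (hg : g.PolyTimeOn I) : (Prog.ite t f g).PolyTimeOn I :=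
  ht.ite (hf.subset fun _ h => h.1) (hg.subset fun _ h => h.1)

theorem foldCost_le {S A : Type} (f : S × A → S) (c sz : S × A → ℕ) (B : ℕ) (s : S) (l : List A)
    (h : ∀ l₁ y l₂, l = l₁ ++ y :: l₂ →
      1 + sz (l₁.foldl (fun s y => f (s, y)) s, y) + c (l₁.foldl (fun s y => f (s, y)) s, y) ≤ B) :
    foldCost f c sz s l ≤ l.length * B := by
  induction l generalizing s with
  | nil => simp [foldCost]
  | cons y l ih =>
    have h1 := h [] y l rfl
    have h2 := ih (f (s, y)) fun l₁ z l₂ hl => h (y :: l₁) z l₂ (by rw [hl]; rfl)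
    rw [foldCost, List.length_cons, Nat.succ_mul]
    simp only [List.foldl_nil] at h1
    omega

/-- A loop runs in polynomial time if its body does on the states that are reached, and these
states have polynomially bounded size. -/
theorem Prog.PolyTimeOn.fold {s a : Ty} {f : Prog (.prod s a) s} {J : Set (Ty.prod s a).Val}
    {I : Set (Ty.prod s (.list a)).Val} (hf : f.PolyTimeOn J)
    {B : (Ty.prod s (.list a)).Val → ℕ} (hB : PolyBdd I (Ty.prod s (.list a)).size B)
    (h : ∀ x ∈ I, ∀ l₁ y l₂, x.2 = l₁ ++ y :: l₂ →
      ((Prog.fold f).eval (x.1, l₁), y) ∈ J ∧ s.size ((Prog.fold f).eval (x.1, l₁)) ≤ B x) :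
    (Prog.fold f).PolyTimeOn I := by
  obtain ⟨q, hq⟩ := hf
  have hN : PolyBdd I (Ty.prod s (.list a)).size
      fun x => 1 + B x + (Ty.prod s (.list a)).size x :=
    ((polyBdd_const 1).add hB).add polyBdd_self
  have hqN : PolyBdd I (Ty.prod s (.list a)).size
      fun x => q.eval (1 + B x + (Ty.prod s (.list a)).size x) :=
    PolyBdd.comp (J := Set.univ) (N' := id) (h' := fun n => q.eval n) ⟨q, fun _ _ => le_rfl⟩
      (fun _ _ => trivial) hN
  refine PolyBdd.mono (((polyBdd_const 1).add polyBdd_self).add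
    (polyBdd_self.mul (((polyBdd_const 1).add hN).add hqN))) fun x hx => ?_
  rw [Prog.cost]
  refine Nat.add_le_add_left ?_ _
  have hlen : x.2.length ≤ (Ty.prod s (.list a)).size x := by
    have := Ty.length_lt_size x.2
    rw [Ty.size_prod]
    omega
  refine (foldCost_le _ _ _ _ _ _ fun l₁ y l₂ hl => ?_).trans (Nat.mul_le_mul_right _ hlen)
  obtain ⟨h1, h2⟩ := h x hx l₁ y l₂ hl
  have h3 : (Ty.prod s a).size ((Prog.fold f).eval (x.1, l₁), y) ≤
      1 + B x + (Ty.prod s (.list a)).size x := by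
    have h4 : a.size y + 2 ≤ (Ty.list a).size x.2 := Ty.size_le_of_mem (by rw [hl]; simp)
    rw [Ty.size_prod, Ty.size_prod]
    simp only
    omega
  exact Nat.add_le_add (Nat.add_le_add_left h3 1)
    ((hq _ h1).trans (polynomial_eval_mono q h3))

/-- The programs without loops. -/
def Prog.loopFree : {a b : Ty} → Prog a b → Bool
  | _, _, .op _ => true
  | _, _, .comp g f => g.loopFree && f.loopFree
  | _, _, .pair f g => f.loopFree && g.loopFree
  | _, _, .ite c f g => c.loopFree && f.loopFree && g.loopFree
  | _, _, .listCase _ _ => false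
  | _, _, .fold _ => false

theorem Prog.polyTimeOn_of_loopFree {a b : Ty} {A : Prog a b} (h : A.loopFree = true)
    (I : Set a.Val) : A.PolyTimeOn I := by
  refine Prog.PolyTimeOn.subset (I := Set.univ) ?_ (Set.subset_univ I)
  clear I
  induction A with
  | op o => exact Prog.polyTimeOn_op o
  | comp g f ihg ihf =>
    rw [Prog.loopFree, Bool.and_eq_true] at h
    exact (ihg h.1).comp (ihf h.2) fun _ _ => trivial
  | pair f g ihf ihg =>
    rw [Prog.loopFree, Bool.and_eq_true] at h
    exact (ihf h.1).pair (ihg h.2)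
  | ite c f g ihc ihf ihg =>
    rw [Prog.loopFree, Bool.and_eq_true, Bool.and_eq_true] at h
    exact (ihc h.1.1).ite' (ihf h.1.2) (ihg h.2)
  | listCase f g => exact absurd h (by simp [Prog.loopFree])
  | fold f => exact absurd h (by simp [Prog.loopFree])

end Cost


/-! ### Elementary list programs -/

section ListFold

/-- An invariant of a loop that may refer to the part of the list that has been processed. -/
theorem foldl_invariant {S A : Type*} {f : S → A → S} {s : S} {l : List A}
    {P : List A → S → Prop} (h0 : P [] s)
    (h : ∀ l₁ y s', l₁ ++ [y] <+: l → P l₁ s' → P (l₁ ++ [y]) (f s' y)) {l₁ : List A}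
    (hl : l₁ <+: l) : P l₁ (l₁.foldl f s) := by
  induction l₁ using List.reverseRecOn with
  | nil => exact h0
  | append_singleton l₁ y ih =>
    rw [List.foldl_append]
    exact h l₁ y _ hl (ih ((List.prefix_append l₁ [y]).trans hl))

theorem foldl_cons_map {A B : Type*} (g : A → B) (l : List A) (s : List B) :
    l.foldl (fun s y => g y :: s) s = (l.map g).reverse ++ s := by
  induction l generalizing s with
  | nil => rfl
  | cons y l ih => simp [ih]

end ListFold

namespace Prog

section Basic

variable {a b c : Ty}

abbrev id : Prog a a := .op .id

abbrev fst : Prog (.prod a b) a := .op .fst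

abbrev snd : Prog (.prod a b) b := .op .snd

abbrev const (q : ℚ) : Prog a .rat := .op (.const q)

abbrev nil : Prog a (.list b) := .op .nil

abbrev cons (f : Prog a b) (g : Prog a (.list b)) : Prog a (.list b) :=
  (Prog.op .cons).comp (f.pair g)

abbrev add (f g : Prog a .rat) : Prog a .rat := (Prog.op .add).comp (f.pair g)

abbrev sub (f g : Prog a .rat) : Prog a .rat := (Prog.op .sub).comp (f.pair g)

abbrev mul (f g : Prog a .rat) : Prog a .rat := (Prog.op .mul).comp (f.pair g)

abbrev div (f g : Prog a .rat) : Prog a .rat := (Prog.op .div).comp (f.pair g)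

abbrev le (f g : Prog a .rat) : Prog a .bool := (Prog.op .le).comp (f.pair g)

abbrev min (f g : Prog a .rat) : Prog a .rat := ite (le f g) f g

abbrev max (f g : Prog a .rat) : Prog a .rat := ite (le f g) g f

theorem eval_min (f g : Prog a .rat) (x : a.Val) :
    (min f g).eval x = Min.min (α := ℚ) (f.eval x) (g.eval x) := by
  have h : (min f g).eval x = if decide ((f.eval x : ℚ) ≤ g.eval x) = true then (f.eval x : ℚ)
    else g.eval x := rfl
  rw [h, min_def]
  simp only [decide_eq_true_eq]

theorem eval_max (f g : Prog a .rat) (x : a.Val) :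
    (max f g).eval x = Max.max (α := ℚ) (f.eval x) (g.eval x) := by
  have h : (max f g).eval x = if decide ((f.eval x : ℚ) ≤ g.eval x) = true then (g.eval x : ℚ)
    else f.eval x := rfl
  rw [h, max_def]
  simp only [decide_eq_true_eq]

theorem PolyTimeOn.fold_of_loopFree {s a : Ty} {f : Prog (.prod s a) s}
    {I : Set (Ty.prod s (.list a)).Val} (hf : f.loopFree = true)
    {B : (Ty.prod s (.list a)).Val → ℕ} (hB : PolyBdd I (Ty.prod s (.list a)).size B)
    (h : ∀ x ∈ I, ∀ l₁, l₁ <+: x.2 → s.size ((Prog.fold f).eval (x.1, l₁)) ≤ B x) :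
    (Prog.fold f).PolyTimeOn I :=
  PolyTimeOn.fold (polyTimeOn_of_loopFree hf Set.univ) hB fun x hx l₁ y l₂ hl =>
    ⟨trivial, h x hx l₁ ⟨y :: l₂, hl.symm⟩⟩

theorem PolyTimeOn.comp_univ {g : Prog b c} {f : Prog a b} {I : Set a.Val}
    (hg : g.PolyTimeOn Set.univ) (hf : f.PolyTimeOn I) : (g.comp f).PolyTimeOn I :=
  hg.comp hf fun _ _ => trivial

end Basic

theorem size_prefix_le {a : Ty} {l₁ l : List a.Val} (h : l₁ <+: l) :
    (Ty.list a).size l₁ ≤ (Ty.list a).size l := by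
  obtain ⟨l₂, rfl⟩ := h
  have := Ty.size_append l₁ l₂
  have h2 := Ty.length_lt_size l₂
  omega

section Reverse

variable {a : Ty}

/-- Reversal of a list. -/
def reverse : Prog (.list a) (.list a) := (fold (cons snd fst)).comp (nil.pair id)

theorem eval_reverse_loop (l : List a.Val) (s : List a.Val) :
    (fold (cons (snd : Prog (.prod (.list a) a) a) fst)).eval (s, l) = l.reverse ++ s := by
  have h := foldl_cons_map (fun y : a.Val => y) l s
  rwa [List.map_id'] at h

theorem eval_reverse (l : List a.Val) : reverse.eval l = l.reverse := by
  have := eval_reverse_loop l []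
  rw [List.append_nil] at this
  exact this

theorem reverse_polyTimeOn {I : Set (Ty.list a).Val} : reverse.PolyTimeOn I := by
  refine PolyTimeOn.comp (J := {x | x.1 = []}) ?_ (polyTimeOn_of_loopFree rfl _) fun _ _ => rfl
  refine PolyTimeOn.fold_of_loopFree rfl polyBdd_self fun x hx l₁ hl => ?_
  obtain ⟨s, l⟩ := x
  obtain rfl : s = [] := hx
  rw [eval_reverse_loop, List.append_nil, Ty.size_reverse, Ty.size_prod]
  have := size_prefix_le hl
  simp only at this ⊢
  omega

end Reverse

section Masses

/-- The list of masses of a list of types, given as pairs of value and mass. -/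
def masses : Prog (.list (.prod .rat .rat)) (.list .rat) :=
  (fold (cons (snd.comp snd) fst)).comp (nil.pair reverse)

theorem eval_masses_loop (l : List (ℚ × ℚ)) (s : List ℚ) :
    (fold (cons (snd.comp snd) fst) : Prog (.prod (.list .rat) (.list (.prod .rat .rat))) (.list .rat)).eval
      (s, l) = (l.map Prod.snd).reverse ++ s := by
  exact foldl_cons_map (fun y : ℚ × ℚ => y.2) l s

theorem eval_masses (l : List (ℚ × ℚ)) : masses.eval l = l.map Prod.snd := by
  have h : masses.eval l = (fold (cons (snd.comp snd) fst) :
      Prog (.prod (.list .rat) (.list (.prod .rat .rat))) (.list .rat)).eval ([], reverse.eval l) := rfl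
  rw [h, eval_reverse, eval_masses_loop]
  simp

theorem masses_polyTimeOn {I : Set (Ty.list (.prod .rat .rat)).Val} : masses.PolyTimeOn I := by
  refine PolyTimeOn.comp (J := {x | x.1 = []}) ?_
    ((polyTimeOn_of_loopFree rfl _).pair reverse_polyTimeOn) fun _ _ => rfl
  refine PolyTimeOn.fold_of_loopFree rfl polyBdd_self fun x hx l₁ hl => ?_
  obtain ⟨s, l⟩ := x
  obtain rfl : s = [] := hx
  rw [eval_masses_loop, List.append_nil, Ty.size_reverse, Ty.size_prod]
  have h1 := size_prefix_le hl
  have h2 : (Ty.list .rat).size (l₁.map Prod.snd) ≤ (Ty.list (.prod .rat .rat)).size l₁ := by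
    clear h1 hl
    induction l₁ with
    | nil => exact le_rfl
    | cons y l₁ ih =>
      rw [List.map_cons, Ty.size_cons, Ty.size_cons, Ty.size_prod]
      omega
  simp only at h1 ⊢
  omega

end Masses

section Pad

/-- Prepend a zero to each list; the lists come out in reverse order. -/
def pad : Prog (.list (.list .rat)) (.list (.list .rat)) :=
  (fold (cons (cons (const 0) snd) fst)).comp (nil.pair id)

theorem eval_pad_loop (l s : List (List ℚ)) :
    (fold (cons (cons (const 0) snd) fst) :
      Prog (.prod (.list (.list .rat)) (.list (.list .rat))) (.list (.list .rat))).eval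
      (s, l) = (l.map (List.cons 0)).reverse ++ s := by
  exact foldl_cons_map (fun y : List ℚ => 0 :: y) l s

theorem eval_pad (l : List (List ℚ)) : pad.eval l = (l.map (List.cons 0)).reverse := by
  have := eval_pad_loop l []
  rw [List.append_nil] at this
  exact this

theorem pad_polyTimeOn {I : Set (Ty.list (.list .rat)).Val} : pad.PolyTimeOn I := by
  refine PolyTimeOn.comp (J := {x | x.1 = []}) ?_ (polyTimeOn_of_loopFree rfl _) fun _ _ => rfl
  refine PolyTimeOn.fold_of_loopFree rfl ((polyBdd_const (2 + ratSize 0)).mul polyBdd_self)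
    fun x hx l₁ hl => ?_
  obtain ⟨s, l⟩ := x
  obtain rfl : s = [] := hx
  rw [eval_pad_loop, List.append_nil, Ty.size_reverse, Ty.size_prod]
  have h1 := size_prefix_le hl
  have h2 : (Ty.list (.list .rat)).size (l₁.map (List.cons 0)) ≤
      (2 + ratSize 0) * (Ty.list (.list .rat)).size l₁ := by
    clear h1 hl
    induction l₁ with
    | nil => rw [List.map_nil, Ty.size_nil]; omega
    | cons y l₁ ih =>
      have h3 : Ty.rat.size 0 = ratSize 0 := rfl
      rw [List.map_cons, Ty.size_cons, Ty.size_cons, Ty.size_cons, h3, mul_add, mul_add]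
      have := Nat.le_mul_of_pos_left ((Ty.list .rat).size y) (show 0 < 2 + ratSize 0 by omega)
      omega
  refine h2.trans (Nat.mul_le_mul_left _ ?_)
  simp only at h1 ⊢
  omega

end Pad

section Mem

/-- The body of the membership test; the state is the element sought and the result so far. -/
def memStep : Prog (.prod (.prod .rat .bool) .rat) (.prod .rat .bool) :=
  (fst.comp fst).pair (ite (le snd (fst.comp fst))
    (ite (le (fst.comp fst) snd) (le (const 0) (const 0)) (snd.comp fst)) (snd.comp fst))

theorem eval_memStep (q y : ℚ) (t : Bool) :
    memStep.eval ((q, t), y) = (q, t || decide (q = y)) := by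
  have h : memStep.eval ((q, t), y) = (q, if decide (y ≤ q) = true then
    if decide (q ≤ y) = true then decide ((0 : ℚ) ≤ 0) else t else t) := rfl
  rw [h]
  rcases lt_trichotomy y q with h | h | h
  · simp [h.le, not_le.2 h, h.ne']
  · simp [h]
  · simp [not_le.2 h, h.ne]

/-- Membership in a list of rationals. -/
def mem : Prog (.prod .rat (.list .rat)) .bool :=
  snd.comp ((fold memStep).comp ((fst.pair (le (const 1) (const 0))).pair snd))

theorem eval_mem (q : ℚ) (l : List ℚ) : mem.eval (q, l) = decide (q ∈ l) := by
  have key : ∀ (l : List ℚ) (t : Bool), l.foldl (fun (s : ℚ × Bool) y => memStep.eval (s, y))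
      (q, t) = (q, t || decide (q ∈ l)) := by
    intro l
    induction l with
    | nil => simp
    | cons y l ih =>
      intro t
      rw [List.foldl_cons, eval_memStep, ih]
      simp [Bool.or_assoc]
  have h : mem.eval (q, l) = (l.foldl (fun (s : ℚ × Bool) y => memStep.eval (s, y))
      (q, decide ((1 : ℚ) ≤ 0))).2 := rfl
  rw [h, key]
  simp

theorem mem_polyTimeOn {I : Set (Ty.prod .rat (.list .rat)).Val} : mem.PolyTimeOn I := by
  refine PolyTimeOn.comp_univ (polyTimeOn_of_loopFree rfl _)
    (PolyTimeOn.comp_univ ?_ (polyTimeOn_of_loopFree rfl _))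
  refine PolyTimeOn.fold_of_loopFree rfl polyBdd_self fun x _ l₁ hl => ?_
  have h : ((Prog.fold memStep).eval (x.1, l₁)).1 = x.1.1 :=
    foldl_invariant (f := fun s y => memStep.eval (s, y))
      (P := fun _ (s : ℚ × Bool) => s.1 = x.1.1) (l := l₁) rfl (fun l y s' _ h => h)
      List.prefix_rfl
  rw [Ty.size_prod, h, Ty.size_prod, Ty.size_prod]
  have : ∀ t, Ty.bool.size t = 1 := fun _ => rfl
  rw [this, this]
  omega

end Mem

section Value

/-- Sum of value times mass. -/
def value : Prog (.list (.prod .rat .rat)) .rat :=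
  (fold (add fst (mul (fst.comp snd) (snd.comp snd)))).comp ((const 0).pair id)

theorem eval_value (l : List (ℚ × ℚ)) : value.eval l = (l.map fun y => y.1 * y.2).sum := by
  have key : ∀ s : ℚ, l.foldl (fun (s : ℚ) y => s + y.1 * y.2) s =
      s + (l.map fun y => y.1 * y.2).sum := by
    induction l with
    | nil => simp
    | cons y l ih =>
      intro s
      rw [List.foldl_cons, ih, List.map_cons, List.sum_cons, add_assoc]
  have h := key 0
  rw [zero_add] at h
  exact h

theorem heightSize_zero : heightSize 0 = 1 := by simp [heightSize]

theorem heightSize_item_le (y : ℚ × ℚ) :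
    heightSize y.1 + heightSize y.2 + 1 ≤ Ty.size (.prod .rat .rat) y := by
  have h1 := heightSize_le y.1
  have h2 := heightSize_le y.2
  have h3 : Ty.size (.prod .rat .rat) y = 1 + ratSize y.1 + ratSize y.2 := rfl
  omega

theorem size_append_singleton {a : Ty} (l : List a.Val) (y : a.Val) :
    (Ty.list a).size (l ++ [y]) = (Ty.list a).size l + (1 + a.size y) := by
  have h1 := Ty.size_append l [y]
  have h2 := Ty.size_cons y []
  rw [Ty.size_nil] at h2
  omega

theorem value_polyTimeOn {I : Set (Ty.list (.prod .rat .rat)).Val} : value.PolyTimeOn I := by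
  refine PolyTimeOn.comp_univ ?_ (polyTimeOn_of_loopFree rfl _)
  refine PolyTimeOn.fold_of_loopFree rfl ((polyBdd_const 1).add
    ((polyBdd_const 2).mul polyBdd_self)) fun x _ l₁ hl => ?_
  have h : heightSize ((Prog.fold (add fst (mul (fst.comp snd) (snd.comp snd))) :
      Prog (.prod .rat (.list (.prod .rat .rat))) .rat).eval (x.1, l₁)) ≤
      heightSize x.1 + (Ty.list (.prod .rat .rat)).size l₁ :=
    foldl_invariant (P := fun l (s : ℚ) => heightSize s ≤ heightSize x.1 +
      (Ty.list (.prod .rat .rat)).size l) (l := l₁) (Nat.le_add_right _ _)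
      (fun l y s' _ h => by
        have h1 := heightSize_add_le s' (y.1 * y.2)
        have h2 := heightSize_mul_le y.1 y.2
        have h3 := heightSize_item_le y
        have h4 := size_append_singleton l y
        refine le_trans h1 ?_
        omega) List.prefix_rfl
  have h1 := size_prefix_le hl
  have h2 := heightSize_le x.1
  refine (ratSize_le _).trans ?_
  have h3 : (Ty.prod .rat (.list (.prod .rat .rat))).size x =
    1 + ratSize x.1 + (Ty.list (.prod .rat .rat)).size x.2 := rfl
  omega

end Value

/-! ### Programs for splitting off a segment -/

section Rate

/-- The body of the loop that computes the revenue of a new segment. The state consists of the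
reciprocal of the price, the mass from the price to the current type and the best ratio. -/
def rateStep : Prog (.prod (.prod (.prod .rat .rat) .rat) (.prod .rat .rat))
    (.prod (.prod .rat .rat) .rat) :=
  ((fst.comp (fst.comp fst)).pair (add (snd.comp (fst.comp fst)) (snd.comp snd))).pair
    (min (snd.comp fst) (div (snd.comp (fst.comp fst))
      (sub (fst.comp (fst.comp fst)) (div (const 1) (fst.comp snd)))))

theorem eval_rateStep (x : ((ℚ × ℚ) × ℚ) × (ℚ × ℚ)) : rateStep.eval x =
    ((x.1.1.1, x.1.1.2 + x.2.2), Min.min x.1.2 (x.1.1.2 / (x.1.1.1 - 1 / x.2.1))) := by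
  have h : rateStep.eval x = ((x.1.1.1, x.1.1.2 + x.2.2), (min
      (a := .prod (.prod (.prod .rat .rat) .rat) (.prod .rat .rat)) (snd.comp fst)
      (div (snd.comp (fst.comp fst)) (sub (fst.comp (fst.comp fst))
        (div (const 1) (fst.comp snd))))).eval x) := rfl
  rw [h, eval_min]
  rfl

/-- The revenue of the segment with the given lowest type, drawn from the given higher types. -/
def rate : Prog (.prod (.prod .rat .rat) (.list (.prod .rat .rat))) .rat :=
  (min snd (div (snd.comp fst) (fst.comp fst))).comp ((fold rateStep).comp
    ((((div (const 1) (fst.comp fst)).pair (snd.comp fst)).pair (fst.comp fst)).pair snd))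

theorem eval_rate (v p : ℚ) (l : List (ℚ × ℚ)) :
    rate.eval ((v, p), l) =
      let s := l.foldl (fun s y => ((s.1.1, s.1.2 + y.2), Min.min s.2 (s.1.2 / (s.1.1 - 1 / y.1))))
        (((1 / v, p), v) : (ℚ × ℚ) × ℚ)
      Min.min s.2 (s.1.2 / s.1.1) := by
  have h : (fold rateStep).eval (((1 / v, p), v), l) = l.foldl (fun s y =>
      ((s.1.1, s.1.2 + y.2), Min.min s.2 (s.1.2 / (s.1.1 - 1 / y.1)))) ((1 / v, p), v) := by
    simp only [Prog.eval, eval_rateStep]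
  rw [← h]
  exact eval_min _ _ _

theorem rate_polyTimeOn {I : Set (Ty.prod (.prod .rat .rat) (.list (.prod .rat .rat))).Val} :
    rate.PolyTimeOn I := by
  refine PolyTimeOn.comp_univ (polyTimeOn_of_loopFree rfl _)
    (PolyTimeOn.comp_univ ?_ (polyTimeOn_of_loopFree rfl _))
  -- Bit lengths add up under arithmetic, so a generous multiple of the input length suffices.
  refine PolyTimeOn.fold_of_loopFree rfl ((polyBdd_const 40).mul polyBdd_self) fun x _ l₁ hl => ?_
  obtain ⟨s, l⟩ := x
  set N := (Ty.prod (.prod (.prod .rat .rat) .rat) (.list (.prod .rat .rat))).size (s, l) with hN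
  have hN' : N = 1 + (1 + (1 + ratSize s.1.1 + ratSize s.1.2) + ratSize s.2) +
    (Ty.list (.prod .rat .rat)).size l := rfl
  have h1 := heightSize_le s.1.1
  have h2 := heightSize_le s.1.2
  have h3 := heightSize_le s.2
  have h10 : heightSize 1 ≤ 2 := Nat.size_le.2 (by norm_num)
  have h := foldl_invariant (f := fun s y => rateStep.eval (s, y)) (s := s) (l := l)
    (P := fun l (s' : (ℚ × ℚ) × ℚ) => s'.1.1 = s.1.1 ∧
      heightSize s'.1.2 ≤ heightSize s.1.2 + (Ty.list (.prod .rat .rat)).size l ∧ heightSize s'.2 ≤ 4 * N)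
    ⟨rfl, Nat.le_add_right _ _, by omega⟩
    (fun l' y s' hl' h => by
      rw [eval_rateStep]
      have h4 := heightSize_item_le y
      have h5 := size_append_singleton l' y
      have h6 := size_prefix_le hl'
      have h7 := heightSize_div_le 1 y.1
      have h8 := heightSize_sub_le s'.1.1 (1 / y.1)
      have h9 := heightSize_div_le s'.1.2 (s'.1.1 - 1 / y.1)
      refine ⟨h.1, ?_, ?_⟩
      · have := heightSize_add_le s'.1.2 y.2
        simp only
        omega
      · simp only
        rcases min_choice s'.2 (s'.1.2 / (s'.1.1 - 1 / y.1)) with hm | hm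
        · rw [hm]
          exact h.2.2
        · rw [hm]
          have := h.1
          rw [this] at h8 h9 ⊢
          omega) hl
  have h4 := size_prefix_le hl
  have h5 : ((Ty.prod (.prod .rat .rat) .rat)).size ((fold rateStep).eval (s, l₁)) =
      1 + (1 + ratSize (l₁.foldl (fun s y => rateStep.eval (s, y)) s).1.1 +
        ratSize (l₁.foldl (fun s y => rateStep.eval (s, y)) s).1.2) +
        ratSize (l₁.foldl (fun s y => rateStep.eval (s, y)) s).2 := rfl
  have h6 := ratSize_le (l₁.foldl (fun s y => rateStep.eval (s, y)) s).1.2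
  have h7 := ratSize_le (l₁.foldl (fun s y => rateStep.eval (s, y)) s).2
  rw [h5, h.1]
  simp only at h4
  omega

end Rate

section Split

/-- The state of the loop that splits off a segment: its revenue, the mass of the types seen so
far before and after the split, and the types and masses of the two parts. -/
abbrev splitTy : Ty :=
  .prod (.prod .rat (.prod .rat .rat)) (.prod (.list (.prod .rat .rat)) (.list .rat))

/-- Update of the two masses. -/
def splitMass : Prog (.prod splitTy (.prod .rat .rat)) (.prod .rat .rat) :=
  Prog.comp
    (snd.pair (max (snd.comp (snd.comp (fst.comp (fst.comp fst))))
      (sub snd (div (fst.comp (fst.comp (fst.comp fst))) (fst.comp (snd.comp fst))))))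
    (id.pair (add (fst.comp (snd.comp (fst.comp fst))) (snd.comp snd)))

theorem eval_splitMass (x : ((ℚ × (ℚ × ℚ)) × (List (ℚ × ℚ) × List ℚ)) × (ℚ × ℚ)) :
    splitMass.eval x = (x.1.1.2.1 + x.2.2,
      Max.max x.1.1.2.2 (x.1.1.2.1 + x.2.2 - x.1.1.1 / x.2.1)) := by
  have h : splitMass.eval x = (x.1.1.2.1 + x.2.2,
      (max (a := .prod (.prod splitTy (.prod .rat .rat)) .rat)
        (snd.comp (snd.comp (fst.comp (fst.comp fst)))) (sub snd
        (div (fst.comp (fst.comp (fst.comp fst))) (fst.comp (snd.comp fst))))).eval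
        (x, x.1.1.2.1 + x.2.2)) := rfl
  rw [h, eval_max]
  rfl

/-- The body of the loop that splits off a segment. -/
def splitStep : Prog (.prod splitTy (.prod .rat .rat)) splitTy :=
  Prog.comp
    (((fst.comp (fst.comp (fst.comp fst))).pair snd).pair
      ((cons ((fst.comp (snd.comp fst)).pair
          (sub (snd.comp snd) (snd.comp (snd.comp (fst.comp (fst.comp fst))))))
        (fst.comp (snd.comp (fst.comp fst)))).pair
      (cons (sub (snd.comp (snd.comp fst))
          (sub (snd.comp snd) (snd.comp (snd.comp (fst.comp (fst.comp fst))))))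
        (snd.comp (snd.comp (fst.comp fst))))))
    (id.pair splitMass)

theorem eval_splitStep (x : ((ℚ × (ℚ × ℚ)) × (List (ℚ × ℚ) × List ℚ)) × (ℚ × ℚ)) :
    splitStep.eval x =
      let rN := Max.max x.1.1.2.2 (x.1.1.2.1 + x.2.2 - x.1.1.1 / x.2.1)
      ((x.1.1.1, (x.1.1.2.1 + x.2.2, rN)), ((x.2.1, rN - x.1.1.2.2) :: x.1.2.1,
        (x.2.2 - (rN - x.1.1.2.2)) :: x.1.2.2)) := by
  have h := eval_splitMass x
  simp only [splitStep, Prog.eval, Op.eval, h]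

/-- Split the given types into the residual market and a segment of the given revenue. -/
def split : Prog (.prod .rat (.list (.prod .rat .rat)))
    (.prod (.list (.prod .rat .rat)) (.list .rat)) :=
  snd.comp ((fold splitStep).comp
    (((fst.pair ((const 0).pair (const 0))).pair (nil.pair nil)).pair (reverse.comp snd)))

theorem eval_split (R : ℚ) (l : List (ℚ × ℚ)) : split.eval (R, l) =
    (l.reverse.foldl (fun s y => splitStep.eval (s, y)) ((R, (0, 0)), ([], []))).2 := by
  have h : split.eval (R, l) = ((reverse.eval l).foldl (fun s y => splitStep.eval (s, y))
      ((R, (0, 0)), ([], []))).2 := rfl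
  rw [h, eval_reverse]

theorem split_polyTimeOn {I : Set (Ty.prod .rat (.list (.prod .rat .rat))).Val} :
    split.PolyTimeOn I := by
  refine PolyTimeOn.comp_univ (polyTimeOn_of_loopFree rfl _)
    (PolyTimeOn.comp (J := {x | x.1.2 = ([], []) ∧ x.1.1.2 = (0, 0)}) ?_
      ((polyTimeOn_of_loopFree rfl _).pair
        (reverse_polyTimeOn.comp_univ (polyTimeOn_of_loopFree rfl _))) fun _ _ => ⟨rfl, rfl⟩)
  -- The state holds two lists of at most `N` entries of linear bit length, hence a quadratic bound.
  refine PolyTimeOn.fold_of_loopFree rfl ((polyBdd_const 100).add (((polyBdd_const 100).mul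
    polyBdd_self).add (((polyBdd_const 100).mul polyBdd_self).mul polyBdd_self)))
    fun x hx l₁ hl => ?_
  obtain ⟨⟨⟨R, q⟩, q'⟩, l⟩ := x
  obtain ⟨rfl, rfl⟩ : q' = ([], []) ∧ q = (0, 0) := hx
  set N := (Ty.prod splitTy (.list (.prod .rat .rat))).size (((R, (0, 0)), ([], [])), l) with hN
  have hz : ratSize 0 = 2 := by simp [ratSize]
  have hN' : N = 1 + (1 + (1 + ratSize R + (1 + ratSize 0 + ratSize 0)) + (1 + 1 + 1)) +
    (Ty.list (.prod .rat .rat)).size l := rfl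
  have h1 := heightSize_le R
  have h0 := heightSize_zero
  have h := foldl_invariant (f := fun s y => splitStep.eval (s, y))
    (s := (((R, (0, 0)), ([], [])) : (ℚ × (ℚ × ℚ)) × (List (ℚ × ℚ) × List ℚ))) (l := l)
    (P := fun l s' => s'.1.1 = R ∧
      heightSize s'.1.2.1 ≤ (Ty.list (.prod .rat .rat)).size l ∧ heightSize s'.1.2.2 ≤ 3 * N ∧
      (∀ y ∈ s'.2.1, Ty.size (.prod .rat .rat) y ≤ 20 * N) ∧ (∀ y ∈ s'.2.2, ratSize y ≤ 20 * N) ∧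
      s'.2.1.length = l.length ∧ s'.2.2.length = l.length)
    ⟨rfl, by rw [heightSize_zero, Ty.size_nil], by simp only; omega, by simp, by simp, rfl, rfl⟩
    (fun l' y s' hl' h => by
      obtain ⟨⟨R', rO, rN⟩, RL, X⟩ := s'
      obtain ⟨w, ρ⟩ := y
      obtain ⟨i1, i2, i3, i4, i5, i6, i7⟩ := h
      simp only at i1 i2 i3 i4 i5 i6 i7
      subst i1
      rw [eval_splitStep]
      have h4 := heightSize_item_le (w, ρ)
      have h4' : Ty.size (.prod .rat .rat) (w, ρ) = 1 + ratSize w + ratSize ρ := rfl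
      have h5 := size_append_singleton (a := .prod .rat .rat) l' (w, ρ)
      have h6 := size_prefix_le hl'
      have h7 := heightSize_div_le R' w
      have h8 := heightSize_add_le rO ρ
      have h9 := heightSize_sub_le (rO + ρ) (R' / w)
      have h10 : heightSize (Max.max rN (rO + ρ - R' / w)) ≤ 3 * N := by
        rcases max_choice rN (rO + ρ - R' / w) with hm | hm
        · rw [hm]; exact i3
        · rw [hm]
          simp only at h4
          omega
      set r := Max.max rN (rO + ρ - R' / w)
      have h11 := heightSize_sub_le r rN
      have h12 := ratSize_le (r - rN)
      have h13 := heightSize_sub_le ρ (r - rN)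
      have h14 := ratSize_le (ρ - (r - rN))
      simp only at h4
      simp only [List.mem_cons, forall_eq_or_imp, List.length_cons, List.length_append,
        List.length_nil, i6, i7, and_true]
      have h15 : Ty.size (.prod .rat .rat) (w, r - rN) = 1 + ratSize w + ratSize (r - rN) := rfl
      refine ⟨trivial, by omega, h10, ⟨by omega, i4⟩, ⟨by omega, i5⟩⟩) hl
  obtain ⟨i1, i2, i3, i4, i5, i6, i7⟩ := h
  have h5 : Ty.size splitTy ((fold splitStep).eval (((R, (0, 0)), ([], [])), l₁)) =
      Ty.size splitTy (l₁.foldl (fun s y => splitStep.eval (s, y))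
        ((R, (0, 0)), ([], []))) := rfl
  rw [h5]
  generalize l₁.foldl (fun s y => splitStep.eval (s, y)) ((R, (0, 0)), ([], [])) = s' at *
  have h4 := size_prefix_le hl
  have h6 := ratSize_le s'.1.2.1
  have h7 := ratSize_le s'.1.2.2
  have h8 := Ty.length_lt_size l₁
  have h9 := Ty.size_list_le i4
  have h10 := Ty.size_list_le (a := .rat) i5
  rw [i6] at h9
  rw [i7] at h10
  have h11 : Ty.size splitTy s' = 1 + (1 + ratSize s'.1.1 + (1 + ratSize s'.1.2.1 +
      ratSize s'.1.2.2)) + (1 + (Ty.list (.prod .rat .rat)).size s'.2.1 + (Ty.list .rat).size s'.2.2) := rfl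
  rw [h11, i1]
  simp only at h4
  have h12 : l₁.length * (1 + 20 * N) ≤ N * (1 + 20 * N) := Nat.mul_le_mul_right _ (by omega)
  have h13 : N * (1 + 20 * N) = N + 20 * (N * N) := by ring
  have h14 : 100 * N * N = 100 * (N * N) := by ring
  rw [h14]
  omega

end Split

end Prog


/-! ### The segments of the greedy scheme -/

section Segments

variable {u p : ℕ → ℚ} {K : Finset ℕ} {i j k l : ℕ}

theorem residualTail_zero (hu : StrictMono u) (hu0 : u 0 = 0) (hp : ∀ i, 0 ≤ p i) (i : ℕ) :
    residualTail u p K i 0 = 0 := residualTail_zero_right hu hu0 hp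

theorem residualTail_mono (hu : StrictMono u) (hu0 : u 0 = 0) (hp : ∀ i, 0 ≤ p i) (hjl : j ≤ l)
    (hl : l ≤ i) : residualTail u p K i j ≤ residualTail u p K i l := by
  have h := residualSpec (K := K) hu hu0 hp i
  rw [h.eq_sups j (hjl.trans hl), h.eq_sups l hl]
  exact partialSups_monotone _ hjl

theorem pushTail_mono (hu : StrictMono u) (hu0 : u 0 = 0) (hp : ∀ i, 0 ≤ p i) (hjl : j ≤ l)
    (hl : l ≤ i + 1) : pushTail p (residualTail u p K i) i j ≤
      pushTail p (residualTail u p K i) i l := by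
  have h := residualSpec (K := K) hu hu0 hp i
  rw [h.push hp (hjl.trans hl), h.push hp hl]
  exact partialSups_monotone _ hjl

theorem residualTail_succ_of_mem (hi : i + 1 ∈ K) : residualTail u p K (i + 1) =
    partialSups fun x => pushTail p (residualTail u p K i) i x -
      maxRevenue u (pushTail p (residualTail u p K i) i) i * u x := by
  rw [residualTail]
  simp only [if_pos hi]

theorem residualTail_succ_of_notMem (hi : i + 1 ∉ K) :
    residualTail u p K (i + 1) = pushTail p (residualTail u p K i) i := by
  rw [residualTail]
  simp only [if_neg hi]

theorem maxRevenue_pushTail_nonneg (hu : StrictMono u) (hu0 : u 0 = 0) (hp : ∀ i, 0 ≤ p i) :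
    0 ≤ maxRevenue u (pushTail p (residualTail u p K i) i) i :=
  maxRevenue_nonneg hu fun _ hl => pushTail_mono hu hu0 hp (by omega) le_rfl

theorem residualTail_succ_le (hu : StrictMono u) (hu0 : u 0 = 0) (hp : ∀ i, 0 ≤ p i)
    (hl : l ≤ i + 1) :
    residualTail u p K (i + 1) l ≤ pushTail p (residualTail u p K i) i l := by
  by_cases hi : i + 1 ∈ K
  · rw [residualTail_succ_of_mem hi]
    refine partialSups_le _ _ _ fun x hx => ?_
    have h1 := mul_nonneg (maxRevenue_pushTail_nonneg (K := K) (i := i) hu hu0 hp)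
      (hu0 ▸ hu.monotone (Nat.zero_le x) : 0 ≤ u x)
    have h2 := pushTail_mono (K := K) hu hu0 hp hx hl
    linarith
  · rw [residualTail_succ_of_notMem hi]

theorem residualTail_le_headMass (hu : StrictMono u) (hu0 : u 0 = 0) (hp : ∀ i, 0 ≤ p i)
    (hl : l ≤ i) : residualTail u p K i l ≤ headMass p l := by
  induction i generalizing l with
  | zero =>
    obtain rfl : l = 0 := by omega
    rw [headMass_zero]
    exact le_rfl
  | succ i ih =>
    refine (residualTail_succ_le hu hu0 hp hl).trans ?_
    rcases hl.eq_or_lt with rfl | hl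
    · rw [pushTail_succ, headMass_succ]
      linarith [ih le_rfl]
    · rw [pushTail_of_le (by omega)]
      exact ih (by omega)

theorem pushTail_last_le_headMass (hu : StrictMono u) (hu0 : u 0 = 0) (hp : ∀ i, 0 ≤ p i) :
    pushTail p (residualTail u p K i) i (i + 1) ≤ headMass p (i + 1) := by
  rw [pushTail_succ, headMass_succ]
  linarith [residualTail_le_headMass (K := K) hu hu0 hp (le_refl i)]

/-- The segment that is split off when type `i + 1` becomes a price. -/
def newSegment (u p : ℕ → ℚ) (K : Finset ℕ) (i j : ℕ) : ℚ :=
  if j ≤ i + 1 then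
    (pushTail p (residualTail u p K i) i j - pushTail p (residualTail u p K i) i (j - 1)) -
      (residualTail u p K (i + 1) j - residualTail u p K (i + 1) (j - 1))
  else 0

/-- The segments of the greedy scheme after the first `i` types. The order in which they are
listed is the one in which the program produces them. -/
def segmentList (u p : ℕ → ℚ) (K : Finset ℕ) : ℕ → List (ℕ → ℚ)
  | 0 => []
  | i + 1 => if i + 1 ∈ K then newSegment u p K i :: (segmentList u p K i).reverse
    else (segmentList u p K i).reverse

/-- The segment `x` contains no type beyond the `k`-th, and the value of type `k` is a best price:
in terms of `u l = 1 / v l`, the inequality `headMass_le` says that the price at `l` earns no more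
than the one at `k`. -/
structure IsSegment (u x : ℕ → ℚ) (k : ℕ) : Prop where
  pos : 0 < k
  nonneg : ∀ j, 0 ≤ x j
  eq_zero : ∀ j, k < j → x j = 0
  headMass_le : ∀ l ≤ k, headMass x l * u k ≤ headMass x k * u l

theorem headMass_newSegment (hu : StrictMono u) (hu0 : u 0 = 0) (hp : ∀ i, 0 ≤ p i)
    (hl : l ≤ i + 1) : headMass (newSegment u p K i) l =
      pushTail p (residualTail u p K i) i l - residualTail u p K (i + 1) l := by
  induction l with
  | zero =>
    rw [headMass_zero, pushTail_of_le (Nat.zero_le i), residualTail_zero hu hu0 hp,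
      residualTail_zero hu hu0 hp, sub_zero]
  | succ l ih =>
    rw [headMass_succ, ih (by omega), newSegment, if_pos hl, Nat.add_sub_cancel]
    ring

theorem isSegment_newSegment (hu : StrictMono u) (hu0 : u 0 = 0) (hp : ∀ i, 0 ≤ p i)
    (hi : i + 1 ∈ K) : IsSegment u (newSegment u p K i) (i + 1) where
  pos := Nat.succ_pos i
  nonneg j := by
    unfold newSegment
    split
    · rename_i hj
      rcases j with _ | j
      · simp
      · rw [Nat.add_sub_cancel, residualTail_succ_of_mem hi, sub_nonneg]
        exact partialSups_succ_sub_le hu.monotone (maxRevenue_pushTail_nonneg hu hu0 hp)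
          (pushTail_mono hu hu0 hp (Nat.le_succ j) hj)
    · exact le_rfl
  eq_zero j hj := if_neg (not_le.2 hj)
  headMass_le l hl := by
    set R := maxRevenue u (pushTail p (residualTail u p K i) i) i with hR
    have h1 : headMass (newSegment u p K i) l ≤ R * u l := by
      rw [headMass_newSegment hu hu0 hp hl, residualTail_succ_of_mem hi]
      have := le_partialSups (fun x => pushTail p (residualTail u p K i) i x - R * u x) l
      simp only at this
      linarith
    have h2 : headMass (newSegment u p K i) (i + 1) = R * u (i + 1) := by
      rw [headMass_newSegment hu hu0 hp le_rfl, residualTail_succ_of_mem hi,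
        partialSups_nat_succ, sup_eq_right.2]
      · rw [← hR]; ring
      · refine partialSups_le _ _ _ fun x hx => ?_
        have := maxRevenue_mul_le (t := pushTail p (residualTail u p K i) i) hu hx
        linarith
    have h3 : 0 ≤ u (i + 1) := hu0 ▸ hu.monotone (Nat.zero_le _)
    rw [h2]
    nlinarith

theorem exists_isSegment (hu : StrictMono u) (hu0 : u 0 = 0) (hp : ∀ i, 0 ≤ p i)
    {x : ℕ → ℚ} (hx : x ∈ segmentList u p K i) : ∃ k ∈ K, k ≤ i ∧ IsSegment u x k := by
  induction i with
  | zero => simp [segmentList] at hx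
  | succ i ih =>
    rw [segmentList] at hx
    split at hx
    · rename_i hi
      rcases List.mem_cons.1 hx with rfl | hx
      · exact ⟨i + 1, hi, le_rfl, isSegment_newSegment hu hu0 hp hi⟩
      · obtain ⟨k, hk, hki, h⟩ := ih (List.mem_reverse.1 hx)
        exact ⟨k, hk, by omega, h⟩
    · obtain ⟨k, hk, hki, h⟩ := ih (List.mem_reverse.1 hx)
      exact ⟨k, hk, by omega, h⟩

/-- The segments and the residual market add up to the whole market. -/
theorem sum_segmentList (hu : StrictMono u) (hu0 : u 0 = 0) (hp : ∀ i, 0 ≤ p i) (hj0 : 0 < j)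
    (hj : j ≤ i) : ((segmentList u p K i).map fun x => x j).sum +
      (residualTail u p K i j - residualTail u p K i (j - 1)) = p j := by
  induction i with
  | zero => omega
  | succ i ih =>
    have h0 : ((segmentList u p K i).map fun x => x j).sum +
        (pushTail p (residualTail u p K i) i j - pushTail p (residualTail u p K i) i (j - 1)) =
          p j := by
      rcases hj.eq_or_lt with rfl | hj
      · rw [Nat.add_sub_cancel, pushTail_succ, pushTail_of_le le_rfl, List.sum_eq_zero]
        · ring
        · intro q hq
          obtain ⟨x, hx, rfl⟩ := List.mem_map.1 hq
          obtain ⟨k, hk, hki, h⟩ := exists_isSegment hu hu0 hp hx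
          exact h.eq_zero _ (by omega)
      · rw [pushTail_of_le (by omega), pushTail_of_le (by omega)]
        exact ih (by omega)
    rw [segmentList]
    split
    · rename_i hi
      rw [List.map_cons, List.sum_cons, List.map_reverse, List.sum_reverse, newSegment, if_pos hj]
      linarith
    · rename_i hi
      rw [List.map_reverse, List.sum_reverse, residualTail_succ_of_notMem hi]
      exact h0

theorem length_segmentList_le :
    (segmentList u p K i).length ≤ (K.filter (· ≤ i)).card := by
  induction i with
  | zero => simp [segmentList]
  | succ i ih =>
    rw [segmentList]
    split
    · rename_i hi
      rw [List.length_cons, List.length_reverse]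
      refine (Nat.succ_le_succ ih).trans ?_
      rw [Nat.succ_eq_add_one, ← Finset.card_insert_of_notMem (a := i + 1) (by simp)]
      refine Finset.card_le_card fun x hx => ?_
      rcases Finset.mem_insert.1 hx with rfl | hx
      · simp [hi]
      · rw [Finset.mem_filter] at hx ⊢
        exact ⟨hx.1, by omega⟩
    · rw [List.length_reverse]
      refine ih.trans (Finset.card_le_card fun x hx => ?_)
      rw [Finset.mem_filter] at hx ⊢
      exact ⟨hx.1, by omega⟩

end Segments

/-! ### Lists in decreasing order of the index -/

section Desc

variable {β γ : Type*}

/-- The list `f n, …, f 1`. -/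
def desc (f : ℕ → β) : ℕ → List β
  | 0 => []
  | n + 1 => f (n + 1) :: desc f n

theorem desc_congr {f g : ℕ → β} {n : ℕ} (h : ∀ j, 0 < j → j ≤ n → f j = g j) :
    desc f n = desc g n := by
  induction n with
  | zero => rfl
  | succ n ih =>
    rw [desc, desc, h _ (Nat.succ_pos n) le_rfl, ih fun j h0 hj => h j h0 (by omega)]

theorem map_desc (φ : β → γ) (f : ℕ → β) (n : ℕ) :
    (desc f n).map φ = desc (fun j => φ (f j)) n := by
  induction n with
  | zero => rfl
  | succ n ih => rw [desc, desc, List.map_cons, ih]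

theorem length_desc (f : ℕ → β) (n : ℕ) : (desc f n).length = n := by
  induction n with
  | zero => rfl
  | succ n ih => rw [desc, List.length_cons, ih]

theorem mem_desc {f : ℕ → β} {n : ℕ} {y : β} :
    y ∈ desc f n ↔ ∃ j, 0 < j ∧ j ≤ n ∧ f j = y := by
  induction n with
  | zero => simp only [desc, List.not_mem_nil, false_iff]; rintro ⟨j, h⟩; omega
  | succ n ih =>
    rw [desc, List.mem_cons, ih]
    constructor
    · rintro (rfl | ⟨j, h0, hj, rfl⟩)
      · exact ⟨n + 1, Nat.succ_pos n, le_rfl, rfl⟩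
      · exact ⟨j, h0, by omega, rfl⟩
    · rintro ⟨j, h0, hj, rfl⟩
      rcases hj.eq_or_lt with rfl | hj
      · exact Or.inl rfl
      · exact Or.inr ⟨j, h0, by omega, rfl⟩

theorem sum_desc (f : ℕ → ℚ) (n : ℕ) :
    (desc f n).sum = ∑ j ∈ Finset.range n, f (j + 1) := by
  induction n with
  | zero => rfl
  | succ n ih => rw [desc, List.sum_cons, ih, Finset.sum_range_succ, add_comm]

theorem ofFn_eq_desc {n : ℕ} (f : ℕ → β) (g : Fin n → β) (h : ∀ i : Fin n, g i = f (n - i)) :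
    List.ofFn g = desc f n := by
  induction n with
  | zero => simp [desc]
  | succ n ih =>
    rw [List.ofFn_succ, desc, h 0, ih (fun i => g i.succ) fun i => ?_]
    · rfl
    · rw [h i.succ, Fin.val_succ, Nat.add_sub_add_right]

end Desc

/-! ### The results of the programs for one segment -/

section Semantics

open Prog

variable {v u t : ℕ → ℚ} {i l m : ℕ} {R : ℚ}

/-- The list of types `l, …, 1` with the masses whose partial sums are `t`. -/
def marketList (v t : ℕ → ℚ) (l : ℕ) : List (ℚ × ℚ) := desc (fun j => (v j, t j - t (j - 1))) l

theorem marketList_succ : marketList v t (l + 1) =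
    (v (l + 1), t (l + 1) - t l) :: marketList v t l := rfl

theorem marketList_congr {t' : ℕ → ℚ} (h : ∀ j ≤ l, t j = t' j) :
    marketList v t l = marketList v t' l :=
  desc_congr fun j _ hj => by rw [h j hj, h (j - 1) (by omega)]

/-- The loop visits the types `m, …, 1`; the state carries the mass `t (i + 1) - t m` and a bound
`b` from the types visited before. -/
theorem foldl_rate (hu : ∀ j, 0 < j → j ≤ i → u j = 1 / v j) (hm : m ≤ i) (b : ℚ) :
    let s := (marketList v t m).foldl (fun s y =>
      ((s.1.1, s.1.2 + y.2), Min.min s.2 (s.1.2 / (s.1.1 - 1 / y.1))))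
        (((u (i + 1), t (i + 1) - t m), b) : (ℚ × ℚ) × ℚ)
    Min.min s.2 (s.1.2 / (s.1.1 - u 0)) = Min.min b ((Finset.range (m + 1)).inf'
      Finset.nonempty_range_add_one fun l => (t (i + 1) - t l) / (u (i + 1) - u l)) ∧
      s.1 = (u (i + 1), t (i + 1) - t 0) := by
  induction m generalizing b with
  | zero => simp [marketList, desc]
  | succ m ih =>
    have h := ih (by omega) (Min.min b ((t (i + 1) - t (m + 1)) / (u (i + 1) - u (m + 1))))
    rw [marketList_succ, List.foldl_cons]
    simp only at h ⊢
    rw [← hu (m + 1) (Nat.succ_pos m) hm, sub_add_sub_cancel]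
    refine ⟨h.1.trans ?_, h.2⟩
    rw [min_assoc]
    congr 1
    have : Finset.range (m + 1 + 1) = insert (m + 1) (Finset.range (m + 1)) :=
      Finset.range_add_one
    simp only [this]
    rw [Finset.inf'_insert]

/-- The search starts from the value `v (i + 1)` as a first bound. This does not affect the minimum,
as the total mass `t (i + 1)` is at most `1`. -/
theorem eval_rate_marketList (hu : StrictMono u) (hu0 : u 0 = 0)
    (hv : 0 < v (i + 1)) (huv : ∀ j, 0 < j → j ≤ i + 1 → u j = 1 / v j) (ht0 : t 0 = 0)
    (ht1 : t (i + 1) ≤ 1) : rate.eval ((v (i + 1), t (i + 1) - t i), marketList v t i) =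
      maxRevenue u t i := by
  have h := foldl_rate (t := t) (i := i) (fun j h0 hj => huv j h0 (by omega)) le_rfl (v (i + 1))
  rw [eval_rate, ← huv (i + 1) (Nat.succ_pos i) le_rfl]
  simp only [hu0, sub_zero] at h ⊢
  rw [h.1]
  refine min_eq_right ?_
  have h1 := maxRevenue_mul_le (t := t) hu (Nat.zero_le i)
  have h2 := huv (i + 1) (Nat.succ_pos i) le_rfl
  rw [hu0, sub_zero, ht0, sub_zero, h2, mul_one_div] at h1
  have h3 := (div_le_iff₀ hv).1 (h1.trans ht1)
  rwa [one_mul] at h3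

theorem eval_split_marketList (hu0 : u 0 = 0) (huv : ∀ j, 0 < j → j ≤ l → u j = 1 / v j)
    (ht0 : t 0 = 0) : split.eval (R, marketList v t l) =
      (marketList v (partialSups fun x => t x - R * u x) l,
        desc (fun j => (t j - t (j - 1)) - (partialSups (fun x => t x - R * u x) j -
          partialSups (fun x => t x - R * u x) (j - 1))) l) := by
  have key : ∀ m ≤ l, (marketList v t m).reverse.foldl (fun s y => splitStep.eval (s, y))
      (((R, (0, 0)), ([], [])) : (ℚ × (ℚ × ℚ)) × (List (ℚ × ℚ) × List ℚ)) =
      ((R, (t m, partialSups (fun x => t x - R * u x) m)),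
        (marketList v (partialSups fun x => t x - R * u x) m,
        desc (fun j => (t j - t (j - 1)) - (partialSups (fun x => t x - R * u x) j -
          partialSups (fun x => t x - R * u x) (j - 1))) m)) := by
    intro m hm
    induction m with
    | zero => simp [marketList, desc, ht0, hu0]
    | succ m ih =>
      rw [marketList_succ, List.reverse_cons, List.foldl_append, ih (by omega),
        List.foldl_cons, List.foldl_nil, eval_splitStep, marketList_succ, desc]
      have e : Max.max (partialSups (fun x => t x - R * u x) m)
          (t (m + 1) - R / v (m + 1)) = partialSups (fun x => t x - R * u x) (m + 1) := by
        rw [partialSups_nat_succ, huv (m + 1) (Nat.succ_pos m) hm, mul_one_div]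
      simp only [add_sub_cancel, e, Nat.add_sub_cancel]
  rw [eval_split, key l le_rfl]

end Semantics


namespace Prog

/-! ### The greedy segmentation program -/

section Sim

/-- The state of the greedy segmentation: the list of prices at which a segment is split off, the
types seen so far with their residual masses, and the segments. -/
abbrev simTy : Ty :=
  .prod (.prod (.list .rat) (.list (.prod .rat .rat))) (.list (.list .rat))

/-- Split off the segment whose lowest type is the current one. -/
def splitCurrent : Prog (.prod simTy (.prod .rat .rat))
    (.prod (.list (.prod .rat .rat)) (.list .rat)) :=
  split.comp ((rate.comp (snd.pair (snd.comp (fst.comp fst)))).pair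
    (cons snd (snd.comp (fst.comp fst))))

/-- The body of the segmentation loop: add the current type and, if its value is a price, split
off a segment. -/
def simStep : Prog (.prod simTy (.prod .rat .rat)) simTy :=
  ite (mem.comp ((fst.comp snd).pair (fst.comp (fst.comp fst))))
    (Prog.comp
      (((fst.comp (fst.comp (fst.comp fst))).pair (fst.comp snd)).pair
        (cons (snd.comp snd) (pad.comp (snd.comp (fst.comp fst)))))
      (id.pair splitCurrent))
    (((fst.comp (fst.comp fst)).pair (cons snd (snd.comp (fst.comp fst)))).pair
      (pad.comp (snd.comp fst)))

theorem eval_simStep (K : List ℚ) (RL : List (ℚ × ℚ)) (XS : List (List ℚ)) (y : ℚ × ℚ) :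
    simStep.eval (((K, RL), XS), y) =
      if y.1 ∈ K then
        let s := split.eval (rate.eval (y, RL), y :: RL)
        ((K, s.1), s.2 :: (XS.map (List.cons 0)).reverse)
      else ((K, y :: RL), (XS.map (List.cons 0)).reverse) := by
  rw [← eval_pad]
  have h : simStep.eval (((K, RL), XS), y) = if mem.eval (y.1, K) = true then
        ((K, (split.eval (rate.eval (y, RL), y :: RL)).1),
          (split.eval (rate.eval (y, RL), y :: RL)).2 :: pad.eval XS)
      else ((K, y :: RL), pad.eval XS) := rfl
  rw [h, eval_mem]
  simp only [decide_eq_true_eq]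

/-- The greedy segmentation of a list of types, given in decreasing order of their values. -/
def sim : Prog (.prod (.list .rat) (.list (.prod .rat .rat))) simTy :=
  (fold simStep).comp (((fst.pair nil).pair nil).pair snd)

theorem simStep_polyTimeOn {I : Set (Ty.prod simTy (.prod .rat .rat)).Val} :
    simStep.PolyTimeOn I := by
  have h1 : splitCurrent.PolyTimeOn I := split_polyTimeOn.comp_univ
    ((rate_polyTimeOn.comp_univ (polyTimeOn_of_loopFree rfl _)).pair
      (polyTimeOn_of_loopFree rfl _))
  have hl : ∀ {a b : Ty} {A : Prog a b} (J : Set a.Val), A.loopFree = true → A.PolyTimeOn J :=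
    fun J h => polyTimeOn_of_loopFree h J
  refine PolyTimeOn.ite' (mem_polyTimeOn.comp_univ (hl _ rfl)) (PolyTimeOn.comp_univ ?_
    ((hl _ rfl).pair h1)) ((hl _ rfl).pair (pad_polyTimeOn.comp_univ (hl _ rfl)))
  exact (hl _ rfl).pair (PolyTimeOn.comp_univ (hl _ rfl)
    ((hl _ rfl).pair (pad_polyTimeOn.comp_univ (hl _ rfl))))

variable {v u p : ℕ → ℚ} {n i : ℕ} {Kl : List ℚ} {K : Finset ℕ}

theorem pushTail_residualTail_zero (hu : StrictMono u) (hu0 : u 0 = 0) (hp : ∀ i, 0 ≤ p i) (i : ℕ) :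
    pushTail p (residualTail u p K i) i 0 = 0 := by
  rw [pushTail_of_le (Nat.zero_le i), residualTail_zero hu hu0 hp]

/-- The state after the first `i` types: the residual masses and the segments are those of the
greedy scheme with price set `K`. -/
theorem eval_sim_loop (hu : StrictMono u) (hu0 : u 0 = 0) (hp : ∀ i, 0 ≤ p i)
    (hp1 : ∀ i ≤ n, headMass p i ≤ 1) (hK : ∀ j, 0 < j → j ≤ n → (v j ∈ Kl ↔ j ∈ K))
    (hv : ∀ j ∈ K, 0 < v j) (huv : ∀ k ∈ K, ∀ j, 0 < j → j ≤ k → u j = 1 / v j) (hi : i ≤ n) :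
    (fold simStep).eval (((Kl, []), []), (desc (fun j => (v j, p j)) i).reverse) =
      ((Kl, marketList v (residualTail u p K i) i),
        (segmentList u p K i).map fun x => desc x i) := by
  induction i with
  | zero => rfl
  | succ i ih =>
    have hstep : (fold simStep).eval (((Kl, []), []),
        (desc (fun j => (v j, p j)) (i + 1)).reverse) = simStep.eval ((fold simStep).eval
          (((Kl, []), []), (desc (fun j => (v j, p j)) i).reverse), (v (i + 1), p (i + 1))) := by
      rw [desc, List.reverse_cons]
      simp only [Prog.eval, List.foldl_append, List.foldl_cons, List.foldl_nil]
    rw [hstep, ih (by omega), eval_simStep]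
    set t := pushTail p (residualTail u p K i) i with ht
    have hzero : ((segmentList u p K i).map fun x => desc x i).map (List.cons 0) =
        (segmentList u p K i).map fun x => desc x (i + 1) := by
      rw [List.map_map]
      refine List.map_congr_left fun x hx => ?_
      obtain ⟨k, hk, hki, h⟩ := exists_isSegment hu hu0 hp hx
      rw [Function.comp, desc, h.eq_zero _ (by omega)]
    have ht0 : t 0 = 0 := pushTail_residualTail_zero hu hu0 hp i
    have hm : marketList v (residualTail u p K i) i = marketList v t i :=
      marketList_congr fun j hj => (pushTail_of_le hj).symm
    have hpt : p (i + 1) = t (i + 1) - t i := by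
      rw [ht, pushTail_succ, pushTail_of_le le_rfl]
      ring
    rw [hzero, hm, ← List.map_reverse]
    by_cases hk : i + 1 ∈ K
    · rw [if_pos ((hK _ (Nat.succ_pos i) hi).2 hk), hpt, eval_rate_marketList hu hu0 (hv _ hk)
        (huv _ hk) ht0 ((pushTail_last_le_headMass hu hu0 hp).trans (hp1 _ hi)),
        ← marketList_succ, eval_split_marketList hu0 (huv _ hk) ht0,
        ← residualTail_succ_of_mem hk, segmentList, if_pos hk, List.map_cons]
      have hseg : desc (fun j => (t j - t (j - 1)) - (residualTail u p K (i + 1) j -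
          residualTail u p K (i + 1) (j - 1))) (i + 1) = desc (newSegment u p K i) (i + 1) :=
        desc_congr fun j _ hj => (if_pos hj).symm
      simp only [hseg]
    · rw [if_neg fun h => hk ((hK _ (Nat.succ_pos i) hi).1 h), hpt, ← marketList_succ, segmentList,
        if_neg hk, residualTail_succ_of_notMem hk]

end Sim

end Prog

/-! ### Common denominators of the greedy scheme -/

section Denominators

/-- `q` is an integer multiple of `1 / E`. -/
def IsMultiple (E : ℕ) (q : ℚ) : Prop := ∃ z : ℤ, (E : ℚ) * q = z

variable {E F : ℕ} {q r : ℚ}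

theorem IsMultiple.sub (hq : IsMultiple E q) (hr : IsMultiple E r) : IsMultiple E (q - r) := by
  obtain ⟨z, hz⟩ := hq
  obtain ⟨w, hw⟩ := hr
  exact ⟨z - w, by push_cast; rw [mul_sub, hz, hw]⟩

theorem IsMultiple.add (hq : IsMultiple E q) (hr : IsMultiple E r) : IsMultiple E (q + r) := by
  obtain ⟨z, hz⟩ := hq
  obtain ⟨w, hw⟩ := hr
  exact ⟨z + w, by push_cast; rw [mul_add, hz, hw]⟩

theorem isMultiple_zero : IsMultiple E 0 := ⟨0, by simp⟩

theorem IsMultiple.mul_left (hq : IsMultiple E q) (F : ℕ) : IsMultiple (F * E) q := by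
  obtain ⟨z, hz⟩ := hq
  exact ⟨F * z, by push_cast; rw [← hz, mul_assoc]⟩

theorem IsMultiple.of_dvd (hq : IsMultiple E q) (h : E ∣ F) : IsMultiple F q := by
  obtain ⟨d, rfl⟩ := h
  rw [mul_comm]
  exact hq.mul_left d

theorem IsMultiple.den_le (hE : 0 < E) (hq : IsMultiple E q) : q.den ≤ E := by
  obtain ⟨z, hz⟩ := hq
  have hE' : (E : ℚ) ≠ 0 := by exact_mod_cast hE.ne'
  have h := (num_den_le (q := q) (a := z) (b := E) (by exact_mod_cast hE.ne') (by
    rw [← hz, Int.cast_natCast, mul_div_cancel_left₀ _ hE'])).2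
  rwa [Int.natAbs_natCast] at h

theorem IsMultiple.ratSize_le (hE : 0 < E) (hq : IsMultiple E q) (h0 : 0 ≤ q) (h1 : q ≤ 1) :
    ratSize q ≤ 1 + 2 * Nat.size E := by
  have h2 := hq.den_le hE
  have h3 : q.num.natAbs ≤ q.den := by
    have h4 : q.num ≤ q.den := by
      have := Rat.num_le_denom_iff.2 h1
      exact this
    have h5 := Rat.num_nonneg.2 h0
    omega
  have h6 := Nat.size_le_size h2
  have h7 := Nat.size_le_size h3
  rw [ratSize]
  omega

variable {u p t : ℕ → ℚ} {K : Finset ℕ} {i n L : ℕ}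

/-- Splitting off a segment multiplies the common denominator of the tails by a bounded factor: the
revenue is a quotient of differences of `t` and of `u`, so the factor is the integer
`L * (u (i + 1) - u l)`, times `L` for the multiplication by `u j`. -/
theorem exists_isMultiple_sub_maxRevenue (hu : StrictMono u) (hu0 : u 0 = 0) (hL : 0 < L)
    (hLu : ∀ j ≤ i + 1, IsMultiple L (u j)) (huL : u (i + 1) ≤ L)
    (ht : ∀ j ≤ i + 1, IsMultiple E (t j)) :
    ∃ F, 0 < F ∧ F ≤ L ^ 3 ∧ ∀ j ≤ i + 1,
      IsMultiple (F * E) (t j - maxRevenue u t i * u j) ∧ IsMultiple (F * E) (t j) := by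
  obtain ⟨l, hl, he⟩ := exists_maxRevenue_mul_eq hu t i
  obtain ⟨D, hD⟩ := (hLu _ le_rfl).sub (hLu l (by omega))
  have hpos : 0 < u (i + 1) - u l := sub_pos.2 (hu (by omega))
  have hL' : (0 : ℚ) < L := by exact_mod_cast hL
  have hD0 : 0 < D := by
    have : (0 : ℚ) < D := hD ▸ mul_pos hL' hpos
    exact_mod_cast this
  lift D to ℕ using hD0.le
  have hDL : D ≤ L * L := by
    have h1 : 0 ≤ u l := hu0 ▸ hu.monotone (Nat.zero_le l)
    have h2 : (D : ℚ) ≤ L * L := by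
      have h3 : ((D : ℤ) : ℚ) = D := by simp
      rw [← h3, ← hD]
      exact mul_le_mul_of_nonneg_left (by linarith) hL'.le
    exact_mod_cast h2
  refine ⟨D * L, Nat.mul_pos (by exact_mod_cast hD0) hL, ?_, fun j hj => ⟨?_, ?_⟩⟩
  · rw [pow_succ, pow_two]
    exact Nat.mul_le_mul_right _ hDL
  · refine ((ht j hj).mul_left _).sub ?_
    obtain ⟨a, ha⟩ := (ht _ le_rfl).sub (ht l (by omega))
    obtain ⟨b, hb⟩ := hLu j hj
    refine ⟨L * a * b, ?_⟩
    push_cast at hD ⊢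
    rw [← ha, ← hb, ← he, ← hD]
    ring
  · exact (ht j hj).mul_left _

theorem IsMultiple.partialSups (h : ∀ j ≤ i, IsMultiple E (t j)) :
    IsMultiple E (partialSups t i) := by
  obtain ⟨x, hx, he, -⟩ := exists_partialSups_eq t i
  rw [he]
  exact h x hx

/-- All masses after `i` steps have a common denominator, of bit length linear in `i`. -/
theorem exists_isMultiple_residualTail (hu : StrictMono u) (hu0 : u 0 = 0) (hL : 0 < L)
    (hLu : ∀ k ∈ K, ∀ j ≤ k, IsMultiple L (u j)) (huL : ∀ k ∈ K, u k ≤ L)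
    (hLp : ∀ j, IsMultiple L (p j)) (i : ℕ) :
    ∃ E, 0 < E ∧ E ≤ L * (L ^ 3) ^ i ∧ L ∣ E ∧ (∀ j ≤ i, IsMultiple E (residualTail u p K i j)) ∧
      ∀ x ∈ segmentList u p K i, ∀ j, IsMultiple E (x j) := by
  induction i with
  | zero =>
    refine ⟨L, hL, by simp, dvd_rfl, fun j _ => ⟨0, by simp [residualTail]⟩, ?_⟩
    simp [segmentList]
  | succ i ih =>
    obtain ⟨E, hE, hEL, hdvd, hr, hx⟩ := ih
    have ht : ∀ j ≤ i + 1, IsMultiple E (pushTail p (residualTail u p K i) i j) := by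
      intro j hj
      rcases hj.eq_or_lt with rfl | hj
      · rw [pushTail_succ]
        exact (hr i le_rfl).add ((hLp _).of_dvd hdvd)
      · rw [pushTail_of_le (by omega)]
        exact hr j (by omega)
    by_cases hi : i + 1 ∈ K
    · obtain ⟨F, hF, hFL, h⟩ := exists_isMultiple_sub_maxRevenue hu hu0 hL (hLu _ hi) (huL _ hi) ht
      have hr' : ∀ j ≤ i + 1, IsMultiple (F * E) (residualTail u p K (i + 1) j) := by
        intro j hj
        rw [residualTail_succ_of_mem hi]
        exact IsMultiple.partialSups fun x hx => (h x (hx.trans hj)).1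
      refine ⟨F * E, Nat.mul_pos hF hE, ?_, dvd_mul_of_dvd_right hdvd F, hr', ?_⟩
      · rw [pow_succ, ← mul_assoc, mul_comm F]
        exact Nat.mul_le_mul hEL hFL
      · intro x hx'
        rw [segmentList, if_pos hi, List.mem_cons, List.mem_reverse] at hx'
        rcases hx' with rfl | hx'
        · intro j
          unfold newSegment
          split
          · rename_i hj
            exact ((h j hj).2.sub (h _ (by omega)).2).sub ((hr' j hj).sub (hr' _ (by omega)))
          · exact isMultiple_zero
        · exact fun j => (hx x hx' j).mul_left F
    · refine ⟨E, hE, hEL.trans ?_, hdvd, ?_, ?_⟩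
      · exact Nat.mul_le_mul_left _ (Nat.pow_le_pow_right (by positivity) (Nat.le_succ i))
      · rw [residualTail_succ_of_notMem hi]
        exact ht
      · rw [segmentList, if_neg hi]
        exact fun x hx' => hx x (List.mem_reverse.1 hx')

end Denominators


/-! ### Running time of the greedy segmentation -/

section MarketList

theorem prefix_reverse_desc {β : Type*} {f : ℕ → β} {n : ℕ} {l : List β}
    (h : l <+: (desc f n).reverse) : ∃ i ≤ n, l = (desc f i).reverse := by
  induction n with
  | zero =>
    rw [desc, List.reverse_nil, List.prefix_nil] at h
    exact ⟨0, le_rfl, by rw [h, desc, List.reverse_nil]⟩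
  | succ n ih =>
    rw [desc, List.reverse_cons, List.prefix_concat_iff] at h
    rcases h with h | h
    · exact ⟨n + 1, le_rfl, by rw [h, desc, List.reverse_cons]⟩
    · obtain ⟨i, hi, he⟩ := ih h
      exact ⟨i, by omega, he⟩

variable {n : ℕ} {v p : Fin n → ℚ}

/-- The types of a market in decreasing order of their values. -/
def typeList {n : ℕ} (v p : Fin n → ℚ) : List (ℚ × ℚ) :=
  (desc (fun j => (atTime v j, atTime p j)) n).reverse

theorem ofFn_eq_reverse_typeList (v p : Fin n → ℚ) :
    List.ofFn (fun i => (v i, p i)) = (typeList v p).reverse := by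
  rw [typeList, List.reverse_reverse]
  exact ofFn_eq_desc _ _ fun i => by rw [atTime_sub, atTime_sub]

theorem length_typeList : (typeList v p).length = n := by
  rw [typeList, List.length_reverse, length_desc]

theorem mem_typeList {y : ℚ × ℚ} :
    y ∈ typeList v p ↔ ∃ j, 0 < j ∧ j ≤ n ∧ (atTime v j, atTime p j) = y := by
  rw [typeList, List.mem_reverse, mem_desc]

/-- The set of positions of the prices in the list `l`. -/
def priceSet {n : ℕ} (v : Fin n → ℚ) (l : List ℚ) : Finset ℕ :=
  (Finset.Icc 1 n).filter fun j => atTime v j ∈ l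

theorem mem_priceSet {l : List ℚ} {j : ℕ} :
    j ∈ priceSet v l ↔ 0 < j ∧ j ≤ n ∧ atTime v j ∈ l := by
  rw [priceSet, Finset.mem_filter, Finset.mem_Icc, and_assoc]
  rfl

theorem IsMarket.headMass_le_one (h : IsMarket v p) {i : ℕ} (hi : i ≤ n) :
    headMass (atTime p) i ≤ 1 := by
  rw [← h.sum_eq_one, sum_univ_eq p]
  exact headMass_mono h.atTime_mass_nonneg hi

theorem IsMarket.invPrice_eq (h : IsMarket v p) {l : List ℚ} (hl : ∀ q ∈ l, 0 < q) {k : ℕ}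
    (hk : k ∈ priceSet v l) {j : ℕ} (hj0 : 0 < j) (hj : j ≤ k) :
    0 < atTime v j ∧ invPrice (atTime v) j = 1 / atTime v j := by
  obtain ⟨hk0, hkn, hkl⟩ := mem_priceSet.1 hk
  have h1 : 0 < atTime v j := by
    rcases hj.eq_or_lt with rfl | hlt
    · exact hl _ hkl
    · exact (hl _ hkl).trans (h.atTime_lt hj0 hlt hkn)
  exact ⟨h1, invPrice_of_pos hj0 h1⟩

theorem IsMarket.eval_sim_loop (h : IsMarket v p) {l : List ℚ} (hl : ∀ q ∈ l, 0 < q) {i : ℕ}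
    (hi : i ≤ n) : (Prog.fold Prog.simStep).eval
      (((l, []), []), (desc (fun j => (atTime v j, atTime p j)) i).reverse) =
      ((l, marketList (atTime v) (residualTail (invPrice (atTime v)) (atTime p) (priceSet v l) i) i),
        (segmentList (invPrice (atTime v)) (atTime p) (priceSet v l) i).map fun x => desc x i) :=
  Prog.eval_sim_loop h.invPrice_strictMono rfl h.atTime_mass_nonneg
    (fun _ => h.headMass_le_one) (fun j h0 hj => by rw [mem_priceSet]; tauto)
    (fun k hk => hl _ (mem_priceSet.1 hk).2.2)
    (fun k hk j h0 hj => (h.invPrice_eq hl hk h0 hj).2) hi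

theorem IsMarket.eval_sim (h : IsMarket v p) {l : List ℚ} (hl : ∀ q ∈ l, 0 < q) :
    Prog.sim.eval (l, typeList v p) =
      ((l, marketList (atTime v) (residualTail (invPrice (atTime v)) (atTime p) (priceSet v l) n) n),
        (segmentList (invPrice (atTime v)) (atTime p) (priceSet v l) n).map fun x => desc x n) :=
  h.eval_sim_loop hl le_rfl

/-- A common multiple of the denominators of all values and masses and of all numerators of
positive values. -/
def commonMultiple (l : List (ℚ × ℚ)) : ℕ :=
  (l.map fun y => y.2.den * (y.1.den * max y.1.num.natAbs 1)).prod

theorem commonMultiple_pos (l : List (ℚ × ℚ)) : 0 < commonMultiple l := by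
  refine Nat.pos_of_ne_zero fun h => ?_
  rw [commonMultiple, List.prod_eq_zero_iff, List.mem_map] at h
  obtain ⟨y, -, hy⟩ := h
  have h1 := y.2.den_pos
  have h2 := y.1.den_pos
  have h3 : 0 < max y.1.num.natAbs 1 := by omega
  have := Nat.mul_pos h1 (Nat.mul_pos h2 h3)
  omega

theorem dvd_commonMultiple {l : List (ℚ × ℚ)} {y : ℚ × ℚ} (hy : y ∈ l) :
    y.2.den * (y.1.den * max y.1.num.natAbs 1) ∣ commonMultiple l :=
  List.dvd_prod (List.mem_map.2 ⟨y, hy, rfl⟩)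

theorem size_commonMultiple_le (l : List (ℚ × ℚ)) :
    Nat.size (commonMultiple l) ≤ (Ty.list (.prod .rat .rat)).size l := by
  induction l with
  | nil => simp [commonMultiple, Ty.size]
  | cons y l ih =>
    have e : commonMultiple (y :: l) =
        y.2.den * (y.1.den * max y.1.num.natAbs 1) * commonMultiple l := by
      simp [commonMultiple]
    rw [e, Ty.size_cons]
    have h1 := size_mul_le (y.2.den * (y.1.den * max y.1.num.natAbs 1)) (commonMultiple l)
    have h2 := size_mul_le y.2.den (y.1.den * max y.1.num.natAbs 1)
    have h3 := size_mul_le y.1.den (max y.1.num.natAbs 1)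
    have h4 : Nat.size (max y.1.num.natAbs 1) ≤ Nat.size y.1.num.natAbs + 1 := by
      rcases max_choice y.1.num.natAbs 1 with h | h <;> rw [h]
      · omega
      · rw [Nat.size_one]; omega
    have h5 : (Ty.prod .rat .rat).size y = 1 + (1 + Nat.size y.1.num.natAbs + Nat.size y.1.den) +
        (1 + Nat.size y.2.num.natAbs + Nat.size y.2.den) := rfl
    omega

theorem size_pow_le (a k : ℕ) : Nat.size (a ^ k) ≤ 1 + k * Nat.size a := by
  induction k with
  | zero => simp
  | succ k ih =>
    rw [pow_succ, Nat.succ_mul]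
    have := size_mul_le (a ^ k) a
    omega

theorem isMultiple_of_den_dvd {L : ℕ} {q : ℚ} (h : q.den ∣ L) : IsMultiple L q := by
  refine IsMultiple.of_dvd ⟨q.num, ?_⟩ h
  rw [mul_comm, Rat.mul_den_eq_num]

theorem isMultiple_inv {L : ℕ} {q : ℚ} (hq : 0 < q) (h : q.num.natAbs ∣ L) :
    IsMultiple L (1 / q) := by
  refine IsMultiple.of_dvd ⟨q.den, ?_⟩ h
  have h1 : ((q.num.natAbs : ℕ) : ℚ) = q.num := by
    have : ((q.num.natAbs : ℕ) : ℤ) = q.num := Int.natAbs_of_nonneg (Rat.num_nonneg.2 hq.le)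
    rw [← Int.cast_natCast, this]
  rw [h1, mul_one_div, div_eq_iff hq.ne', Int.cast_natCast, mul_comm, Rat.mul_den_eq_num]

theorem inv_le_den {q : ℚ} (hq : 0 < q) : 1 / q ≤ q.den := by
  rw [div_le_iff₀ hq, mul_comm, Rat.mul_den_eq_num]
  have := Rat.num_pos.2 hq
  exact_mod_cast this

theorem IsMarket.exists_isMultiple (h : IsMarket v p) {l : List ℚ} (hl : ∀ q ∈ l, 0 < q) {i : ℕ} :
    ∃ E, 0 < E ∧ Nat.size E ≤ Nat.size (commonMultiple (typeList v p)) +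
        (1 + i * (1 + 3 * Nat.size (commonMultiple (typeList v p)))) ∧
      (∀ j ≤ i, IsMultiple E
        (residualTail (invPrice (atTime v)) (atTime p) (priceSet v l) i j)) ∧
      ∀ x ∈ segmentList (invPrice (atTime v)) (atTime p) (priceSet v l) i, ∀ j,
        IsMultiple E (x j) := by
  set L := commonMultiple (typeList v p) with hL
  have hdvd : ∀ j, 0 < j → j ≤ n →
      (atTime p j).den * ((atTime v j).den * max (atTime v j).num.natAbs 1) ∣ L :=
    fun j h0 hj => dvd_commonMultiple (y := (atTime v j, atTime p j))
      (mem_typeList.2 ⟨j, h0, hj, rfl⟩)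
  have hLpos : 0 < L := commonMultiple_pos _
  obtain ⟨E, hE, hEL, -, h1, h2⟩ := exists_isMultiple_residualTail (K := priceSet v l) (L := L)
    h.invPrice_strictMono rfl hLpos
    (fun k hk j hj => by
      rcases Nat.eq_zero_or_pos j with rfl | h0
      · exact isMultiple_zero
      · obtain ⟨hv, he⟩ := h.invPrice_eq hl hk h0 hj
        rw [he]
        refine isMultiple_inv hv (dvd_trans ?_ (hdvd j h0 (hj.trans (mem_priceSet.1 hk).2.1)))
        have hnum := Rat.num_pos.2 hv
        rw [max_eq_left (by omega)]
        exact dvd_mul_of_dvd_right (dvd_mul_left _ _) _)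
    (fun k hk => by
      obtain ⟨hv, he⟩ := h.invPrice_eq hl hk (mem_priceSet.1 hk).1 le_rfl
      rw [he]
      refine (inv_le_den hv).trans (Nat.cast_le.2 (Nat.le_of_dvd hLpos ?_))
      exact (dvd_mul_of_dvd_right (dvd_mul_right _ _) _).trans
        (hdvd k (mem_priceSet.1 hk).1 (mem_priceSet.1 hk).2.1))
    (fun j => by
      by_cases hj : 0 < j ∧ j ≤ n
      · exact isMultiple_of_den_dvd ((dvd_mul_right _ _).trans (hdvd j hj.1 hj.2))
      · rw [show atTime p j = 0 from dif_neg hj]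
        exact isMultiple_zero) i
  refine ⟨E, hE, (Nat.size_le_size hEL).trans ((size_mul_le _ _).trans
    (Nat.add_le_add_left ((size_pow_le _ _).trans (Nat.add_le_add_left
      (Nat.mul_le_mul_left _ (size_pow_le _ _)) _)) _)), h1, h2⟩

/-- The inputs of the greedy segmentation that occur: the types of a market and positive prices. -/
def simInputs : Set (Ty.prod (.list .rat) (.list (.prod .rat .rat))).Val :=
  {x | (∀ q ∈ x.1, 0 < q) ∧ ∃ (n : ℕ) (v p : Fin n → ℚ), IsMarket v p ∧ x.2 = typeList v p}

theorem IsMarket.size_marketList_le (h : IsMarket v p) {l : List ℚ} (hl : ∀ q ∈ l, 0 < q) {i N : ℕ}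
    (hi : i ≤ n) (hN : (Ty.list (.prod .rat .rat)).size (typeList v p) ≤ N) :
    (Ty.list (.prod .rat .rat)).size (marketList (atTime v)
      (residualTail (invPrice (atTime v)) (atTime p) (priceSet v l) i) i) ≤
        1 + N * (1 + (2 + N + 2 * (N + (1 + N * (1 + 3 * N))))) ∧
    (Ty.list (.list .rat)).size
      ((segmentList (invPrice (atTime v)) (atTime p) (priceSet v l) i).map fun x => desc x i) ≤
        1 + N * (1 + (1 + N * (1 + (1 + 2 * (N + (1 + N * (1 + 3 * N))))))) := by
  have hu := h.invPrice_strictMono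
  have hp := h.atTime_mass_nonneg
  have hu0 : invPrice (atTime v) 0 = 0 := rfl
  obtain ⟨E, hE, hEN, hr, hx⟩ := h.exists_isMultiple hl (i := i)
  have hn : n ≤ N := by
    have := Ty.length_lt_size (a := .prod .rat .rat) (typeList v p)
    rw [length_typeList] at this
    omega
  have hC := (size_commonMultiple_le (typeList v p)).trans hN
  set C := Nat.size (commonMultiple (typeList v p))
  have hEN' : Nat.size E ≤ N + (1 + N * (1 + 3 * N)) := by
    have := Nat.mul_le_mul (hi.trans hn) (show 1 + 3 * C ≤ 1 + 3 * N by omega)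
    omega
  set S := N + (1 + N * (1 + 3 * N))
  have hincr : ∀ j, 0 < j → j ≤ i →
      0 ≤ residualTail (invPrice (atTime v)) (atTime p) (priceSet v l) i j -
        residualTail (invPrice (atTime v)) (atTime p) (priceSet v l) i (j - 1) :=
    fun j h0 hj => sub_nonneg.2 (residualTail_mono hu hu0 hp (Nat.sub_le j 1) hj)
  have hle1 : ∀ j ≤ i, residualTail (invPrice (atTime v)) (atTime p) (priceSet v l) i j ≤ 1 :=
    fun j hj => (residualTail_le_headMass hu hu0 hp hj).trans (h.headMass_le_one (hj.trans hi))
  have hge0 : ∀ j ≤ i, 0 ≤ residualTail (invPrice (atTime v)) (atTime p) (priceSet v l) i j :=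
    fun j hj => (residualTail_zero hu hu0 hp i).symm.le.trans
      (residualTail_mono hu hu0 hp (Nat.zero_le j) hj)
  constructor
  · refine (Ty.size_list_le (a := .prod .rat .rat) (B := 2 + N + 2 * S) fun y hy => ?_).trans ?_
    · obtain ⟨j, h0, hj, rfl⟩ := mem_desc.1 hy
      have h1 : ratSize (atTime v j) ≤ N := by
        have h2 := Ty.size_le_of_mem (a := .prod .rat .rat)
          (mem_typeList.2 ⟨j, h0, hj.trans hi, rfl⟩ : (atTime v j, atTime p j) ∈ typeList v p)
        have h3 : (Ty.prod .rat .rat).size (atTime v j, atTime p j) =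
          1 + ratSize (atTime v j) + ratSize (atTime p j) := rfl
        omega
      have h2 := ((hr j hj).sub (hr (j - 1) (by omega))).ratSize_le hE (hincr j h0 hj)
        (by linarith [hle1 j hj, hge0 (j - 1) (by omega)])
      rw [Ty.size_prod]
      simp only [Ty.size]
      omega
    · rw [marketList, length_desc]
      exact Nat.add_le_add_left (Nat.mul_le_mul_right _ (hi.trans hn)) _
  · refine (Ty.size_list_le (a := .list .rat) (B := 1 + N * (1 + (1 + 2 * S))) fun y hy => ?_).trans ?_
    · obtain ⟨x, hxs, rfl⟩ := List.mem_map.1 hy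
      obtain ⟨k, hk, hki, hseg⟩ := exists_isSegment hu hu0 hp hxs
      refine (Ty.size_list_le (a := .rat) (B := 1 + 2 * S) fun q hq => ?_).trans ?_
      · obtain ⟨j, h0, hj, rfl⟩ := mem_desc.1 hq
        refine ((hx x hxs j).ratSize_le hE (hseg.nonneg j) ?_).trans (by omega)
        have h1 := sum_segmentList (K := priceSet v l) hu hu0 hp h0 hj
        have h2 : x j ≤ ((segmentList (invPrice (atTime v)) (atTime p) (priceSet v l) i).map
            fun x => x j).sum := by
          refine List.single_le_sum (fun q hq => ?_) _ (List.mem_map.2 ⟨x, hxs, rfl⟩)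
          obtain ⟨z, hz, rfl⟩ := List.mem_map.1 hq
          obtain ⟨_, _, _, hz'⟩ := exists_isSegment hu hu0 hp hz
          exact hz'.nonneg j
        have h3 := hincr j h0 hj
        have h4 : atTime p j ≤ 1 := by
          have h5 := h.headMass_le_one (hj.trans hi)
          obtain ⟨j, rfl⟩ : ∃ m, j = m + 1 := ⟨j - 1, by omega⟩
          rw [headMass_succ] at h5
          have h6 := headMass_mono hp (Nat.zero_le j)
          rw [headMass_zero] at h6
          linarith
        linarith
      · rw [length_desc]
        exact Nat.add_le_add_left (Nat.mul_le_mul_right _ (hi.trans hn)) _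
    · rw [List.length_map]
      refine Nat.add_le_add_left (Nat.mul_le_mul_right _ (length_segmentList_le.trans ?_)) _
      refine (Finset.card_le_card (t := Finset.Icc 1 n) fun j hj => ?_).trans ?_
      · rw [Finset.mem_filter, mem_priceSet] at hj
        exact Finset.mem_Icc.2 ⟨hj.1.1, hj.1.2.1⟩
      · rw [Nat.card_Icc]
        omega

theorem Prog.sim_polyTimeOn : Prog.sim.PolyTimeOn simInputs := by
  refine Prog.PolyTimeOn.comp (J := {x | x.1.1.2 = [] ∧ x.1.2 = [] ∧ (x.1.1.1, x.2) ∈ simInputs}) ?_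
    (polyTimeOn_of_loopFree rfl _) fun x hx => ⟨rfl, rfl, hx⟩
  refine Prog.PolyTimeOn.fold (J := Set.univ) simStep_polyTimeOn (B := fun x =>
    (fun N => 1 + (1 + N + (1 + N * (1 + (2 + N + 2 * (N + (1 + N * (1 + 3 * N))))))) +
      (1 + N * (1 + (1 + N * (1 + (1 + 2 * (N + (1 + N * (1 + 3 * N)))))))))
      ((Ty.prod simTy (.list (.prod .rat .rat))).size x)) ?_ ?_
  · refine ⟨(fun N => 1 + (1 + N + (1 + N * (1 + (2 + N + 2 * (N + (1 + N * (1 + 3 * N))))))) +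
      (1 + N * (1 + (1 + N * (1 + (1 + 2 * (N + (1 + N * (1 + 3 * N))))))))) Polynomial.X,
      fun x _ => le_of_eq ?_⟩
    simp
  · rintro ⟨⟨⟨l, t⟩, s⟩, ts⟩ ⟨h1, h2, hl, n, v, p, h, h3⟩ l₁ y l₂ hl₁
    simp only at h1 h2 hl h3 hl₁
    subst h1 h2 h3
    obtain ⟨i, hi, rfl⟩ := prefix_reverse_desc ⟨y :: l₂, hl₁.symm⟩
    refine ⟨trivial, ?_⟩
    rw [h.eval_sim_loop hl hi]
    set N := (Ty.prod simTy (.list (.prod .rat .rat))).size (((l, []), []), typeList v p) with hN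
    have hN' : N = 1 + (1 + (1 + (Ty.list .rat).size l + 1) + 1) +
      (Ty.list (.prod .rat .rat)).size (typeList v p) := rfl
    have h4 := h.size_marketList_le hl hi (N := N) (by omega)
    have h5 : (Ty.list .rat).size l ≤ N := by omega
    exact Nat.add_le_add (Nat.add_le_add_left (Nat.add_le_add (Nat.add_le_add_left h5 1) h4.1) 1)
      h4.2

end MarketList


namespace Prog

/-! ### The greedy choice of prices -/

section Unserved

/-- The value of the types that the greedy scheme with the given prices leaves unserved. -/
def unservedValue : Prog (.prod (.list .rat) (.list (.prod .rat .rat))) .rat :=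
  value.comp (snd.comp (fst.comp sim))

theorem unservedValue_polyTimeOn : unservedValue.PolyTimeOn simInputs :=
  value_polyTimeOn.comp_univ (PolyTimeOn.comp_univ (polyTimeOn_of_loopFree rfl _)
    (PolyTimeOn.comp_univ (polyTimeOn_of_loopFree rfl _) sim_polyTimeOn))

theorem _root_.LimitedSignaling.IsMarket.eval_unservedValue {n : ℕ} {v p : Fin n → ℚ}
    (h : IsMarket v p) {l : List ℚ} (hl : ∀ q ∈ l, 0 < q) :
    unservedValue.eval (l, typeList v p) =
      ∑ j ∈ Finset.range n, atTime v (j + 1) * atTime p (j + 1) -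
        greedyWelfare (atTime v) (invPrice (atTime v)) (atTime p) n (priceSet v l) := by
  have h1 : unservedValue.eval (l, typeList v p) =
    value.eval (sim.eval (l, typeList v p)).1.2 := rfl
  rw [h1, h.eval_sim hl, eval_value, marketList, map_desc, sum_desc, greedyWelfare,
    ← Finset.sum_sub_distrib]
  refine Finset.sum_congr rfl fun j _ => ?_
  rw [Nat.add_sub_cancel]
  ring

end Unserved

section Improve

/-- The state of the search for the best additional price: the market and the current prices, and
the best prices found with the unserved value that they leave. -/
abbrev improveTy : Ty :=
  .prod (.prod (.list (.prod .rat .rat)) (.list .rat)) (.prod .rat (.list .rat))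

/-- The current prices together with the value of the current type, and their unserved value. -/
def candidate : Prog (.prod improveTy (.prod .rat .rat)) (.prod .rat (.list .rat)) :=
  (unservedValue.comp ((cons (fst.comp snd) (snd.comp (fst.comp fst))).pair
    (fst.comp (fst.comp fst)))).pair (cons (fst.comp snd) (snd.comp (fst.comp fst)))

/-- The body of the search for the best additional price. Values that are not positive are
skipped, as they are no prices of the greedy scheme. -/
def improveStep : Prog (.prod improveTy (.prod .rat .rat)) improveTy :=
  ite (le (fst.comp snd) (const 0)) fst
    (Prog.comp (ite (le (fst.comp (snd.comp (fst.comp fst))) (fst.comp snd)) (fst.comp fst)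
      ((fst.comp (fst.comp fst)).pair snd)) (id.pair candidate))

theorem eval_improveStep (x : (List (ℚ × ℚ) × List ℚ) × (ℚ × List ℚ)) (y : ℚ × ℚ) :
    improveStep.eval (x, y) = if y.1 ≤ 0 then x else
      if x.2.1 ≤ unservedValue.eval (y.1 :: x.1.2, x.1.1) then x else
        (x.1, (unservedValue.eval (y.1 :: x.1.2, x.1.1), y.1 :: x.1.2)) := by
  have h : improveStep.eval (x, y) = if decide (y.1 ≤ 0) = true then x else
      if decide (x.2.1 ≤ (unservedValue.eval (y.1 :: x.1.2, x.1.1) : ℚ)) = true then x else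
        (x.1, (unservedValue.eval (y.1 :: x.1.2, x.1.1), y.1 :: x.1.2)) := rfl
  rw [h]
  simp only [decide_eq_true_eq]

/-- One greedy step: add the price that leaves the least value unserved. -/
def improve : Prog (.prod (.list (.prod .rat .rat)) (.list .rat)) (.list .rat) :=
  (snd.comp snd).comp ((fold improveStep).comp
    ((id.pair ((unservedValue.comp (snd.pair fst)).pair snd)).pair fst))

/-- The states of the search after the types `l`. -/
structure ImproveState (ts : List (ℚ × ℚ)) (K : List ℚ) (l : List (ℚ × ℚ))
    (s : (List (ℚ × ℚ) × List ℚ) × (ℚ × List ℚ)) : Prop where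
  market : s.1 = (ts, K)
  value : s.2.1 = unservedValue.eval (s.2.2, ts)
  prices : s.2.2 = K ∨ ∃ y ∈ ts, 0 < y.1 ∧ s.2.2 = y.1 :: K
  best : ∀ y ∈ l, 0 < y.1 → s.2.1 ≤ unservedValue.eval (y.1 :: K, ts)

theorem improveState_foldl {ts : List (ℚ × ℚ)} {K : List ℚ} {l : List (ℚ × ℚ)} (hl : l <+: ts) :
    ImproveState ts K l (l.foldl (fun s y => improveStep.eval (s, y))
      ((ts, K), (unservedValue.eval (K, ts), K))) := by
  refine foldl_invariant (P := ImproveState ts K) ⟨rfl, rfl, Or.inl rfl, by simp⟩ ?_ hl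
  intro l₁ y s hl₁ h
  have hy : y ∈ ts := hl₁.subset (by simp)
  obtain ⟨⟨ts', K'⟩, U, Kb⟩ := s
  obtain ⟨h1, h2, h3, h4⟩ := h
  simp only [Prod.mk.injEq] at h1
  obtain ⟨rfl, rfl⟩ := h1
  rw [eval_improveStep]
  split
  · rename_i hy0
    refine ⟨rfl, h2, h3, fun z hz hz0 => ?_⟩
    rcases List.mem_append.1 hz with hz | hz
    · exact h4 z hz hz0
    · rw [List.mem_singleton.1 hz] at hz0
      exact absurd hy0 (not_le.2 hz0)
  · rename_i hy0
    split
    · rename_i hU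
      refine ⟨rfl, h2, h3, fun z hz hz0 => ?_⟩
      rcases List.mem_append.1 hz with hz | hz
      · exact h4 z hz hz0
      · rw [List.mem_singleton.1 hz]
        exact hU
    · rename_i hU
      refine ⟨rfl, rfl, Or.inr ⟨y, hy, not_le.1 hy0, rfl⟩, fun z hz hz0 => ?_⟩
      rcases List.mem_append.1 hz with hz | hz
      · exact (not_le.1 hU).le.trans (h4 z hz hz0)
      · rw [List.mem_singleton.1 hz]

theorem eval_improve_eq (ts : List (ℚ × ℚ)) (K : List ℚ) :
    improve.eval (ts, K) = K ∨ ∃ y ∈ ts, 0 < y.1 ∧ improve.eval (ts, K) = y.1 :: K :=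
  (improveState_foldl (List.prefix_rfl (l := ts))).prices

theorem unservedValue_improve_le {ts : List (ℚ × ℚ)} {K : List ℚ} {y : ℚ × ℚ} (hy : y ∈ ts)
    (hy0 : 0 < y.1) : (unservedValue.eval (improve.eval (ts, K), ts) : ℚ) ≤
      unservedValue.eval (y.1 :: K, ts) := by
  have h := improveState_foldl (K := K) (List.prefix_rfl (l := ts))
  exact h.value.symm.le.trans (h.best y hy hy0)

/-- The inputs of a greedy step. -/
def improveInputs : Set (Ty.prod (.list (.prod .rat .rat)) (.list .rat)).Val :=
  {x | (x.2, x.1) ∈ simInputs}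

theorem improveStep_polyTimeOn : improveStep.PolyTimeOn {x | x.1.1 ∈ improveInputs} := by
  refine PolyTimeOn.ite (polyTimeOn_of_loopFree rfl _) (polyTimeOn_of_loopFree rfl _)
    (PolyTimeOn.comp (J := Set.univ) (polyTimeOn_of_loopFree rfl _)
      (PolyTimeOn.pair (polyTimeOn_of_loopFree rfl _) (PolyTimeOn.pair ?_
        (polyTimeOn_of_loopFree rfl _))) fun _ _ => trivial)
  refine unservedValue_polyTimeOn.comp (polyTimeOn_of_loopFree rfl _) ?_
  rintro ⟨⟨⟨ts, K⟩, s⟩, y⟩ ⟨⟨hK, hts⟩, h2⟩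
  have h2' : ¬ decide ((y.1 : ℚ) ≤ 0) = true := h2
  rw [decide_eq_true_eq, not_le] at h2'
  exact ⟨fun q hq => by
    rcases List.mem_cons.1 hq with rfl | hq
    · exact h2'
    · exact hK q hq, hts⟩

theorem simInputs_improve {ts : List (ℚ × ℚ)} {K Kb : List ℚ} (h : (K, ts) ∈ simInputs)
    (hKb : Kb = K ∨ ∃ y ∈ ts, 0 < y.1 ∧ Kb = y.1 :: K) : (Kb, ts) ∈ simInputs := by
  rcases hKb with rfl | ⟨y, -, hy, rfl⟩
  · exact h
  · refine ⟨fun q hq => ?_, h.2⟩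
    rcases List.mem_cons.1 hq with rfl | hq
    · exact hy
    · exact h.1 q hq

theorem size_improve_le {ts : List (ℚ × ℚ)} {K Kb : List ℚ}
    (hKb : Kb = K ∨ ∃ y ∈ ts, 0 < y.1 ∧ Kb = y.1 :: K) :
    (Ty.list .rat).size Kb ≤ (Ty.list .rat).size K + (Ty.list (.prod .rat .rat)).size ts := by
  rcases hKb with rfl | ⟨y, hy, -, rfl⟩
  · exact Nat.le_add_right _ _
  · have h1 := Ty.size_le_of_mem (a := .prod .rat .rat) hy
    have h2 : (Ty.prod .rat .rat).size y = 1 + ratSize y.1 + ratSize y.2 := rfl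
    have h3 : (Ty.list .rat).size (y.1 :: K) = 1 + ratSize y.1 + (Ty.list .rat).size K :=
      Ty.size_cons (a := .rat) y.1 K
    omega

theorem improve_polyTimeOn : improve.PolyTimeOn improveInputs := by
  refine PolyTimeOn.comp_univ (polyTimeOn_of_loopFree rfl _) (PolyTimeOn.comp
    (J := {x | x.1.1 ∈ improveInputs ∧ x.2 = x.1.1.1 ∧
      x.1.2 = (unservedValue.eval (x.1.1.2, x.1.1.1), x.1.1.2)}) ?_
    (((polyTimeOn_of_loopFree rfl _).pair (((unservedValue_polyTimeOn.comp
      (polyTimeOn_of_loopFree rfl _) fun x hx => hx)).pair (polyTimeOn_of_loopFree rfl _))).pair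
        (polyTimeOn_of_loopFree rfl _)) fun x hx => ⟨hx, rfl, rfl⟩)
  obtain ⟨q, hq⟩ := unservedValue_polyTimeOn
  refine PolyTimeOn.fold improveStep_polyTimeOn (B := fun x =>
    1 + (Ty.prod improveTy (.list (.prod .rat .rat))).size x +
      (1 + q.eval (1 + 2 * (Ty.prod improveTy (.list (.prod .rat .rat))).size x) +
        2 * (Ty.prod improveTy (.list (.prod .rat .rat))).size x)) ?_ ?_
  · exact ⟨1 + Polynomial.X + (1 + q.comp (1 + 2 * Polynomial.X) + 2 * Polynomial.X),
      fun x _ => le_of_eq (by simp)⟩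
  · rintro ⟨⟨⟨ts, K⟩, s⟩, ts'⟩ ⟨h1, h2, h3⟩ l₁ y l₂ hl
    simp only at h1 h2 h3 hl
    subst h2 h3
    have h := improveState_foldl (K := K) (ts := ts') (l := l₁) ⟨y :: l₂, hl.symm⟩
    have e : (fold improveStep).eval (((ts', K), (unservedValue.eval (K, ts'), K)), l₁) =
      l₁.foldl (fun s y => improveStep.eval (s, y))
        ((ts', K), (unservedValue.eval (K, ts'), K)) := rfl
    rw [e]
    generalize l₁.foldl (fun s y => improveStep.eval (s, y))
        ((ts', K), (unservedValue.eval (K, ts'), K)) = s at h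
    obtain ⟨⟨t, K'⟩, U, Kb⟩ := s
    obtain ⟨i1, i2, i3, -⟩ := h
    simp only [Prod.mk.injEq] at i1 i2 i3
    obtain ⟨rfl, rfl⟩ := i1
    refine ⟨h1, ?_⟩
    set N := (Ty.prod improveTy (.list (.prod .rat .rat))).size
      (((t, K'), (unservedValue.eval (K', t), K')), t) with hN
    have hN' : N = 1 + (1 + (1 + (Ty.list (.prod .rat .rat)).size t + (Ty.list .rat).size K') +
        (1 + ratSize (unservedValue.eval (K', t)) + (Ty.list .rat).size K')) +
        (Ty.list (.prod .rat .rat)).size t := rfl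
    have j1 := size_improve_le i3
    have j2 : unservedValue.cost (Kb, t) ≤
        q.eval ((Ty.prod (.list .rat) (.list (.prod .rat .rat))).size (Kb, t)) :=
      hq _ (simInputs_improve h1 i3)
    have j3 : ratSize U ≤ unservedValue.cost (Kb, t) := by
      rw [i2]
      exact unservedValue.size_eval_le_cost (Kb, t)
    have j4 : (Ty.prod (.list .rat) (.list (.prod .rat .rat))).size (Kb, t) ≤ 1 + 2 * N := by
      have : (Ty.prod (.list .rat) (.list (.prod .rat .rat))).size (Kb, t) =
        1 + (Ty.list .rat).size Kb + (Ty.list (.prod .rat .rat)).size t := rfl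
      omega
    have j5 := polynomial_eval_mono q j4
    have j6 : (1 + (1 + (Ty.list (.prod .rat .rat)).size t + (Ty.list .rat).size K') +
      (1 + ratSize U + (Ty.list .rat).size Kb)) ≤ 1 + N + (1 + q.eval (1 + 2 * N) + 2 * N) := by
      simp only at j5
      omega
    exact j6

end Improve

section Greedy

/-- The body of the greedy loop; the state is the number of prices that may still be added, the
market and the current prices. -/
def greedyStep : Prog (.prod (.prod (.prod .rat (.list (.prod .rat .rat))) (.list .rat))
    (.prod .rat .rat)) (.prod (.prod .rat (.list (.prod .rat .rat))) (.list .rat)) :=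
  ite (le (fst.comp (fst.comp fst)) (const 0)) fst
    (((sub (fst.comp (fst.comp fst)) (const 1)).pair (snd.comp (fst.comp fst))).pair
      (improve.comp ((snd.comp (fst.comp fst)).pair (snd.comp fst))))

theorem eval_greedyStep (x : (ℚ × List (ℚ × ℚ)) × List ℚ) (y : ℚ × ℚ) :
    greedyStep.eval (x, y) = if x.1.1 ≤ 0 then x else
      ((x.1.1 - 1, x.1.2), improve.eval (x.1.2, x.2)) := by
  have h : greedyStep.eval (x, y) = if decide (x.1.1 ≤ 0) = true then x else
      ((x.1.1 - 1, x.1.2), improve.eval (x.1.2, x.2)) := rfl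
  rw [h]
  simp only [decide_eq_true_eq]

/-- The greedy choice of at most the given number of prices. There are as many passes as types,
which suffices, since more prices than types are never needed. -/
def greedyPrices : Prog (.prod .rat (.list (.prod .rat .rat))) (.list .rat) :=
  snd.comp ((fold greedyStep).comp ((id.pair nil).pair snd))

/-- The prices after `k` greedy steps. -/
def greedyIter (ts : List (ℚ × ℚ)) (k : ℕ) : List ℚ :=
  (fun K => improve.eval (ts, K))^[k] []

theorem greedyIter_succ (ts : List (ℚ × ℚ)) (k : ℕ) :
    greedyIter ts (k + 1) = improve.eval (ts, greedyIter ts k) :=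
  Function.iterate_succ_apply' _ _ _

theorem eval_greedyPrices_loop (ts l : List (ℚ × ℚ)) (N : ℕ) :
    (fold greedyStep).eval ((((N : ℚ), ts), []), l) =
      ((((N - Min.min l.length N : ℕ) : ℚ), ts), greedyIter ts (Min.min l.length N)) := by
  induction l using List.reverseRecOn with
  | nil => simp [Prog.eval, greedyIter]
  | append_singleton l y ih =>
    have h : (fold greedyStep).eval ((((N : ℚ), ts), []), l ++ [y]) =
        greedyStep.eval ((fold greedyStep).eval ((((N : ℚ), ts), []), l), y) := by
      simp only [Prog.eval, List.foldl_append, List.foldl_cons, List.foldl_nil]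
    rw [h, ih, eval_greedyStep, List.length_append, List.length_singleton]
    rcases le_or_gt N l.length with hN | hN
    · rw [min_eq_right hN, min_eq_right (by omega), if_pos (by simp)]
    · rw [min_eq_left hN.le, min_eq_left (by omega), if_neg (by
        have h1 : 0 < ((N - l.length : ℕ) : ℚ) := Nat.cast_pos.2 (by omega)
        exact not_le.2 h1), greedyIter_succ]
      have : ((N - l.length : ℕ) : ℚ) - 1 = (N - (l.length + 1) : ℕ) := by
        rw [Nat.cast_sub hN.le, Nat.cast_sub (by omega)]
        push_cast
        ring
      simp only [this]

theorem eval_greedyPrices (ts : List (ℚ × ℚ)) (N : ℕ) :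
    greedyPrices.eval ((N : ℚ), ts) = greedyIter ts (Min.min ts.length N) := by
  have h : greedyPrices.eval ((N : ℚ), ts) =
    ((fold greedyStep).eval ((((N : ℚ), ts), []), ts)).2 := rfl
  rw [h, eval_greedyPrices_loop]

theorem greedyIter_mem_simInputs {ts : List (ℚ × ℚ)} (h : ([], ts) ∈ simInputs) (k : ℕ) :
    (greedyIter ts k, ts) ∈ simInputs := by
  induction k with
  | zero => exact h
  | succ k ih =>
    rw [greedyIter_succ]
    exact simInputs_improve ih (eval_improve_eq _ _)

theorem length_greedyIter_le (ts : List (ℚ × ℚ)) (k : ℕ) : (greedyIter ts k).length ≤ k := by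
  induction k with
  | zero => exact le_rfl
  | succ k ih =>
    rw [greedyIter_succ]
    rcases eval_improve_eq ts (greedyIter ts k) with h | ⟨y, -, -, h⟩
    · rw [h]; omega
    · rw [h, List.length_cons]; omega

theorem size_greedyIter_le (ts : List (ℚ × ℚ)) (k : ℕ) :
    (Ty.list .rat).size (greedyIter ts k) ≤ 1 + k * (Ty.list (.prod .rat .rat)).size ts := by
  induction k with
  | zero =>
    rw [Nat.zero_mul]
    exact le_rfl
  | succ k ih =>
    rw [greedyIter_succ, Nat.succ_mul]
    have := size_improve_le (eval_improve_eq ts (greedyIter ts k))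
    omega

/-- The inputs of the greedy choice of prices. -/
def greedyInputs : Set (Ty.prod .rat (.list (.prod .rat .rat))).Val :=
  {x | ∃ N : ℕ, x.1 = N ∧ ([], x.2) ∈ simInputs}

theorem greedyPrices_polyTimeOn : greedyPrices.PolyTimeOn greedyInputs := by
  refine PolyTimeOn.comp_univ (polyTimeOn_of_loopFree rfl _) (PolyTimeOn.comp
    (J := {x | x.1.1 ∈ greedyInputs ∧ x.1.2 = [] ∧ x.2 = x.1.1.2}) ?_
    (polyTimeOn_of_loopFree rfl _) fun x hx => ⟨hx, rfl, rfl⟩)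
  have hstep : greedyStep.PolyTimeOn {x | (x.1.2, x.1.1.2) ∈ simInputs} :=
    PolyTimeOn.ite' (polyTimeOn_of_loopFree rfl _) (polyTimeOn_of_loopFree rfl _)
      (PolyTimeOn.pair (polyTimeOn_of_loopFree rfl _)
        (improve_polyTimeOn.comp (polyTimeOn_of_loopFree rfl _) fun x hx => hx))
  refine PolyTimeOn.fold hstep (B := fun x =>
    (fun N => 1 + N + (1 + N * N)) ((Ty.prod (.prod (.prod .rat (.list (.prod .rat .rat)))
      (.list .rat)) (.list (.prod .rat .rat))).size x)) ?_ ?_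
  · exact ⟨1 + Polynomial.X + (1 + Polynomial.X * Polynomial.X), fun x _ => le_of_eq (by simp)⟩
  · rintro ⟨⟨⟨M, ts⟩, K⟩, ts'⟩ ⟨⟨N, h1, h2⟩, h3, h4⟩ l₁ y l₂ hl
    simp only at h1 h2 h3 h4 hl
    subst h1 h3 h4
    rw [eval_greedyPrices_loop]
    refine ⟨greedyIter_mem_simInputs h2 _, ?_⟩
    set S := (Ty.prod (.prod (.prod .rat (.list (.prod .rat .rat))) (.list .rat))
      (.list (.prod .rat .rat))).size ((((N : ℚ), ts'), []), ts') with hS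
    have hS' : S = 1 + (1 + (1 + ratSize N + (Ty.list (.prod .rat .rat)).size ts') + 1) +
      (Ty.list (.prod .rat .rat)).size ts' := rfl
    have i1 : ratSize ((N - Min.min l₁.length N : ℕ) : ℚ) ≤ ratSize N := by
      have := Nat.size_le_size (Nat.sub_le N (Min.min l₁.length N))
      simp only [ratSize, Rat.num_natCast, Rat.den_natCast, Int.natAbs_natCast]
      omega
    have i2 := size_greedyIter_le ts' (Min.min l₁.length N)
    have i3 : Min.min l₁.length N ≤ S := by
      have h5 := Ty.length_lt_size (a := .prod .rat .rat) l₁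
      have h6 := size_prefix_le (a := .prod .rat .rat) (l₁ := l₁) (l := ts') ⟨y :: l₂, hl.symm⟩
      have h7 := min_le_left l₁.length N
      omega
    have i4 := Nat.mul_le_mul i3 (show (Ty.list (.prod .rat .rat)).size ts' ≤ S by omega)
    have i5 : 1 + (1 + ratSize ((N - Min.min l₁.length N : ℕ) : ℚ) +
        (Ty.list (.prod .rat .rat)).size ts') +
        (Ty.list .rat).size (greedyIter ts' (Min.min l₁.length N)) ≤ 1 + S + (1 + S * S) := by
      omega
    exact i5

end Greedy

/-! ### The algorithm -/

section Main

/-- The algorithm: choose prices greedily, carve out the segments of the greedy scheme and send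
one more signal to the remaining types. -/
def approxScheme : Prog inputTy outputTy :=
  (cons (masses.comp (snd.comp fst)) snd).comp (sim.comp
    (((greedyPrices.comp ((sub fst (const 1)).pair snd)).pair snd).comp
      (fst.pair (reverse.comp snd))))

theorem eval_approxScheme (M : ℕ) (hM : 0 < M) (l : List (ℚ × ℚ)) :
    approxScheme.eval ((M : ℚ), l) =
      let s := sim.eval (greedyIter l.reverse (Min.min l.length (M - 1)), l.reverse)
      (s.1.2.map Prod.snd) :: s.2 := by
  have h : approxScheme.eval ((M : ℚ), l) =
      masses.eval (sim.eval (greedyPrices.eval ((M : ℚ) - 1, reverse.eval l), reverse.eval l)).1.2 ::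
        (sim.eval (greedyPrices.eval ((M : ℚ) - 1, reverse.eval l), reverse.eval l)).2 := rfl
  have h1 : (M : ℚ) - 1 = (M - 1 : ℕ) := by
    rw [Nat.cast_sub hM, Nat.cast_one]
  rw [h, eval_masses, eval_reverse, h1, eval_greedyPrices, List.length_reverse]

theorem eval_reverse_ofFn {n : ℕ} (v p : Fin n → ℚ) :
    (reverse (a := .prod .rat .rat)).eval (List.ofFn fun i => (v i, p i)) = typeList v p :=
  (eval_reverse (a := .prod .rat .rat) _).trans
    (by rw [ofFn_eq_reverse_typeList, List.reverse_reverse])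

theorem approxScheme_polyTimeOn : approxScheme.PolyTimeOn validInputs := by
  have h1 : Prog.PolyTimeOn (.pair fst (reverse.comp snd) :
      Prog inputTy (.prod .rat (.list (.prod .rat .rat)))) validInputs :=
    (polyTimeOn_of_loopFree rfl _).pair (reverse_polyTimeOn.comp_univ (polyTimeOn_of_loopFree rfl _))
  refine PolyTimeOn.comp_univ ((masses_polyTimeOn.comp_univ (polyTimeOn_of_loopFree rfl _)).pair
    (polyTimeOn_of_loopFree rfl _) |> PolyTimeOn.comp_univ (polyTimeOn_of_loopFree rfl _)) ?_
  refine sim_polyTimeOn.comp (PolyTimeOn.comp (J := {x | ∃ N : ℕ, x.1 = N + 1 ∧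
    ([], x.2) ∈ simInputs}) ?_ h1 ?_) ?_
  · refine PolyTimeOn.pair (greedyPrices_polyTimeOn.comp (polyTimeOn_of_loopFree rfl _) ?_)
      (polyTimeOn_of_loopFree rfl _)
    rintro ⟨M, ts⟩ ⟨N, hN, hts⟩
    refine ⟨N, ?_, hts⟩
    have h2 : (M : ℚ) = N + 1 := hN
    have h3 : (M : ℚ) - 1 = N := by rw [h2]; ring
    exact h3
  · rintro x ⟨n, M, v, p, hM, h, rfl⟩
    refine ⟨M - 1, ?_, fun q hq => absurd hq List.not_mem_nil, n, v, p, h, ?_⟩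
    · have : (M : ℚ) = (M - 1 : ℕ) + 1 := by
        rw [Nat.cast_sub (by omega), Nat.cast_one]
        ring
      exact this
    · exact eval_reverse_ofFn v p
  · rintro x ⟨n, M, v, p, hM, h, rfl⟩
    have h3 : (M : ℚ) - 1 = (M - 1 : ℕ) := by
      rw [Nat.cast_sub (by omega), Nat.cast_one]
    have h4 : (greedyPrices.eval ((M : ℚ) - 1, typeList v p), typeList v p) ∈ simInputs := by
      rw [h3, eval_greedyPrices]
      exact greedyIter_mem_simInputs ⟨fun q hq => absurd hq List.not_mem_nil, n, v, p, h, rfl⟩ _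
    rw [← eval_reverse_ofFn v p] at h4
    exact h4

end Main

end Prog


/-! ### The welfare of the output -/

section Output

variable {n : ℕ} {v p : Fin n → ℚ}

theorem le_servedWelfare {v x : Fin n → ℝ} (hv : ∀ i, 0 ≤ v i) (hx : ∀ i, 0 ≤ x i) {k : Fin n}
    (hk : IsBestPrice v x k) : ∑ i ∈ Finset.Ici k, v i * x i ≤ servedWelfare v x := by
  classical
  unfold servedWelfare
  refine Finset.sum_le_sum_of_subset_of_nonneg (fun i hi => ?_)
    fun i _ _ => mul_nonneg (hv i) (hx i)
  exact Finset.mem_filter.2 ⟨Finset.mem_univ _, k, Finset.mem_Ici.1 hi, hk⟩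

theorem servedWelfare_nonneg {v x : Fin n → ℝ} (hv : ∀ i, 0 ≤ v i) (hx : ∀ i, 0 ≤ x i) :
    0 ≤ servedWelfare v x := Finset.sum_nonneg fun i _ => mul_nonneg (hv i) (hx i)

theorem atTime_eq_of_pos_le {𝕜 : Type*} [Zero 𝕜] (x : ℕ → 𝕜) {j : ℕ} (h0 : 0 < j) (hj : j ≤ n) :
    atTime (fun i : Fin n => x (n - i)) j = x j := by
  obtain ⟨i, rfl⟩ := exists_sub_eq h0 hj
  rw [atTime_sub]

theorem sum_Ici_reverse {𝕜 : Type*} [AddCommMonoid 𝕜] (x : ℕ → 𝕜) (k : Fin n) :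
    ∑ i ∈ Finset.Ici k, x (n - i) = ∑ j ∈ Finset.range (n - k), x (j + 1) := by
  rw [sum_Ici_eq fun i : Fin n => x (n - i)]
  refine Finset.sum_congr rfl fun j hj => ?_
  have := Finset.mem_range.1 hj
  rw [atTime_eq_of_pos_le x (Nat.succ_pos j) (by omega)]

/-- The whole value of a segment is served at its price. -/
theorem IsMarket.sum_le_servedWelfare (h : IsMarket v p) {x : ℕ → ℚ} {k : ℕ} (hkn : k ≤ n)
    (hvk : 0 < atTime v k) (hx : IsSegment (invPrice (atTime v)) x k) :
    ((∑ j ∈ Finset.range n, atTime v (j + 1) * x (j + 1) : ℚ) : ℝ) ≤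
      servedWelfare (fun i : Fin n => (v i : ℝ)) fun i => (x (n - i) : ℝ) := by
  obtain ⟨κ, rfl⟩ := exists_sub_eq hx.pos hkn
  have hv : ∀ i, (0 : ℝ) ≤ (v i : ℝ) := fun i => Rat.cast_nonneg.2 (h.nonneg i)
  have hx0 : ∀ i : Fin n, (0 : ℝ) ≤ (x (n - i) : ℝ) := fun i => Rat.cast_nonneg.2 (hx.nonneg _)
  have hrev : ∀ j : Fin n, v j * headMass x (n - j) ≤ v κ * headMass x (n - κ) := by
    intro j
    rw [atTime_sub] at hvk
    rcases le_or_gt κ j with hj | hj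
    · have hvj : 0 < v j := hvk.trans_le (h.strictMono.monotone hj)
      have h1 := hx.headMass_le (n - j) (by have := Fin.le_def.1 hj; omega)
      have hj0 : 0 < n - (j : ℕ) := by omega
      rw [invPrice_of_pos hx.pos (by rwa [atTime_sub]),
        invPrice_of_pos hj0 (by rwa [atTime_sub]), atTime_sub, atTime_sub,
        mul_one_div, mul_one_div, div_le_div_iff₀ hvk hvj] at h1
      linarith
    · have h1 : headMass x (n - j) = headMass x (n - κ) := by
        have := Fin.lt_def.1 hj
        have h2 : ∀ m, headMass x (n - κ + m) = headMass x (n - κ) := by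
          intro m
          induction m with
          | zero => rfl
          | succ m ih => rw [← add_assoc, headMass_succ, ih, hx.eq_zero _ (by omega), add_zero]
        rw [show n - (j : ℕ) = n - κ + (κ - j) by omega, h2]
      rw [h1]
      have h2 := headMass_mono hx.nonneg (Nat.zero_le (n - (κ : ℕ)))
      rw [headMass_zero] at h2
      exact mul_le_mul_of_nonneg_right (h.strictMono.monotone hj.le) h2
  have hbest : IsBestPrice (fun i : Fin n => (v i : ℝ)) (fun i => (x (n - i) : ℝ)) κ := by
    intro j
    unfold revenue
    rw [sum_Ici_reverse fun m => (x m : ℝ), sum_Ici_reverse fun m => (x m : ℝ)]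
    have := (Rat.cast_le (K := ℝ)).2 (hrev j)
    unfold headMass at this
    push_cast at this
    exact this
  refine le_trans (le_of_eq ?_) (le_servedWelfare hv hx0 hbest)
  have h1 : ∀ i : Fin n, (v i : ℝ) * (x (n - i) : ℝ) =
      ((fun m => atTime v m * x m) (n - i) : ℚ) := fun i => by
    simp only [atTime_sub]
    push_cast
    rfl
  rw [Finset.sum_congr rfl fun i _ => h1 i,
    sum_Ici_reverse fun m => (((fun m => atTime v m * x m) m : ℚ) : ℝ)]
  push_cast
  refine (Finset.sum_subset (Finset.range_subset_range.2 (Nat.sub_le _ _)) fun j _ hj => ?_).symm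
  have hj' : n - (κ : ℕ) ≤ j := not_lt.1 fun h => hj (Finset.mem_range.2 h)
  rw [hx.eq_zero _ (by omega)]
  simp

/-- The scheme with one signal for each function in the list; the functions are indexed by
decreasing value. -/
def schemeOfList (n : ℕ) (l : List (ℕ → ℚ)) (i : Fin n) (σ : Fin l.length) : ℚ :=
  l.get σ (n - i)

theorem encodeScheme_schemeOfList (l : List (ℕ → ℚ)) :
    encodeScheme (schemeOfList n l) = l.map fun x => desc x n := by
  refine List.ext_get (by simp [encodeScheme]) fun k h1 h2 => ?_
  simp only [encodeScheme, List.get_eq_getElem, List.getElem_ofFn, List.getElem_map]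
  exact ofFn_eq_desc _ _ fun i => by simp [schemeOfList]

theorem sum_get_eq {𝕜 : Type*} [AddCommMonoid 𝕜] (l : List (ℕ → ℚ)) (g : (ℕ → ℚ) → 𝕜) :
    ∑ σ : Fin l.length, g (l.get σ) = (l.map g).sum := by
  rw [← List.sum_ofFn]
  congr 1
  refine List.ext_get (by simp) fun k h1 h2 => ?_
  simp

/-- The masses that remain after all segments of the greedy scheme have been split off. -/
def residualMass (u p : ℕ → ℚ) (K : Finset ℕ) (n j : ℕ) : ℚ :=
  residualTail u p K n j - residualTail u p K n (j - 1)

/-- The greedy scheme with one more signal for the residual market. -/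
def greedyScheme (u p : ℕ → ℚ) (K : Finset ℕ) (n : ℕ) : List (ℕ → ℚ) :=
  residualMass u p K n :: segmentList u p K n

theorem IsMarket.isScheme_greedyScheme (h : IsMarket v p) (K : Finset ℕ) :
    IsScheme (fun i => (p i : ℝ)) fun i σ =>
      (schemeOfList n (greedyScheme (invPrice (atTime v)) (atTime p) K n) i σ : ℝ) := by
  have hu := h.invPrice_strictMono
  have hp := h.atTime_mass_nonneg
  constructor
  · intro i σ
    refine Rat.cast_nonneg.2 ?_
    rw [schemeOfList]
    rcases List.mem_cons.1 (List.get_mem (greedyScheme (invPrice (atTime v)) (atTime p) K n) σ)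
      with hx | hx
    · rw [hx]
      exact sub_nonneg.2 (residualTail_mono hu rfl hp (Nat.sub_le _ 1) (Nat.sub_le _ _))
    · obtain ⟨k, -, -, hseg⟩ := exists_isSegment hu rfl hp hx
      exact hseg.nonneg _
  · intro i
    have h1 := sum_segmentList (K := K) hu rfl hp (i := n) (j := n - i) (by omega) (Nat.sub_le _ _)
    rw [← Rat.cast_sum]
    congr 1
    simp only [schemeOfList]
    rw [sum_get_eq _ fun x => x (n - i), greedyScheme, List.map_cons, List.sum_cons, add_comm,
      residualMass, h1, atTime_sub]

theorem IsMarket.greedyWelfare_le_welfare (h : IsMarket v p) {l : List ℚ} (hl : ∀ q ∈ l, 0 < q) :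
    ((greedyWelfare (atTime v) (invPrice (atTime v)) (atTime p) n (priceSet v l) : ℚ) : ℝ) ≤
      welfare (fun i => (v i : ℝ)) fun i σ => (schemeOfList n
        (greedyScheme (invPrice (atTime v)) (atTime p) (priceSet v l) n) i σ : ℝ) := by
  have hu := h.invPrice_strictMono
  have hp := h.atTime_mass_nonneg
  set K := priceSet v l
  set S := segmentList (invPrice (atTime v)) (atTime p) K n with hS
  have h1 : greedyWelfare (atTime v) (invPrice (atTime v)) (atTime p) n K =
      (S.map fun x => ∑ j ∈ Finset.range n, atTime v (j + 1) * x (j + 1)).sum := by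
    have e1 : ∀ T : List (ℕ → ℚ), (T.map fun x => ∑ j ∈ Finset.range n,
        atTime v (j + 1) * x (j + 1)).sum = ∑ j ∈ Finset.range n,
          atTime v (j + 1) * (T.map fun x => x (j + 1)).sum := by
      intro T
      induction T with
      | nil => simp
      | cons x T ih =>
        rw [List.map_cons, List.sum_cons, ih, ← Finset.sum_add_distrib]
        exact Finset.sum_congr rfl fun j _ => by rw [List.map_cons, List.sum_cons, mul_add]
    rw [e1, greedyWelfare]
    refine Finset.sum_congr rfl fun j hj => ?_
    have := sum_segmentList (K := K) hu rfl hp (Nat.succ_pos j) (Finset.mem_range.1 hj)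
    rw [Nat.succ_eq_add_one, Nat.add_sub_cancel] at this
    rw [← this]
    ring
  have h2 : welfare (fun i => (v i : ℝ)) (fun i σ => (schemeOfList n
      (greedyScheme (invPrice (atTime v)) (atTime p) K n) i σ : ℝ)) =
      ((greedyScheme (invPrice (atTime v)) (atTime p) K n).map fun x =>
        servedWelfare (fun i : Fin n => (v i : ℝ)) fun i => (x (n - i) : ℝ)).sum :=
    sum_get_eq _ fun x => servedWelfare (fun i : Fin n => (v i : ℝ)) fun i => (x (n - i) : ℝ)
  rw [h1, h2, greedyScheme, List.map_cons, List.sum_cons]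
  have h3 : 0 ≤ servedWelfare (fun i : Fin n => (v i : ℝ))
      fun i => (residualMass (invPrice (atTime v)) (atTime p) K n (n - i) : ℝ) :=
    servedWelfare_nonneg (fun i => Rat.cast_nonneg.2 (h.nonneg i)) fun i => Rat.cast_nonneg.2
      (sub_nonneg.2 (residualTail_mono hu rfl hp (Nat.sub_le _ 1) (Nat.sub_le _ _)))
  have h4 : (((S.map fun x => ∑ j ∈ Finset.range n, atTime v (j + 1) * x (j + 1)).sum : ℚ) : ℝ) ≤
      (S.map fun x => servedWelfare (fun i : Fin n => (v i : ℝ))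
        fun i => (x (n - i) : ℝ)).sum := by
    rw [Rat.cast_list_sum, List.map_map]
    refine List.sum_le_sum fun x hx => ?_
    obtain ⟨k, hk, hkn, hseg⟩ := exists_isSegment hu rfl hp hx
    exact h.sum_le_servedWelfare hkn (hl _ (mem_priceSet.1 hk).2.2) hseg
  linarith

theorem IsMarket.card_priceSet_le (h : IsMarket v p) (l : List ℚ) :
    (priceSet v l).card ≤ l.length := by
  rw [← Finset.card_image_of_injOn (f := atTime v)]
  · refine (Finset.card_le_card (t := l.toFinset) fun q hq => ?_).trans (List.toFinset_card_le l)
    obtain ⟨j, hj, rfl⟩ := Finset.mem_image.1 hq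
    exact List.mem_toFinset.2 (mem_priceSet.1 hj).2.2
  · intro i hi j hj hij
    have hi' := mem_priceSet.1 hi
    have hj' := mem_priceSet.1 hj
    rcases lt_trichotomy i j with hlt | rfl | hlt
    · exact absurd hij (h.atTime_lt hi'.1 hlt hj'.2.1).ne'
    · rfl
    · exact absurd hij (h.atTime_lt hj'.1 hlt hi'.2.1).ne

theorem IsMarket.priceSet_cons (h : IsMarket v p) (l : List ℚ) {o : ℕ} (ho : 0 < o) (hon : o ≤ n) :
    priceSet v (atTime v o :: l) = insert o (priceSet v l) := by
  ext j
  rw [Finset.mem_insert, mem_priceSet, mem_priceSet, List.mem_cons]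
  constructor
  · rintro ⟨h0, hn, he | he⟩
    · left
      rcases lt_trichotomy j o with hlt | rfl | hlt
      · exact absurd he (h.atTime_lt h0 hlt hon).ne'
      · rfl
      · exact absurd he (h.atTime_lt ho hlt hn).ne
    · exact Or.inr ⟨h0, hn, he⟩
  · rintro (rfl | ⟨h0, hn, he⟩)
    · exact ⟨ho, hon, Or.inl rfl⟩
    · exact ⟨h0, hn, Or.inr he⟩

theorem IsMarket.nil_mem_simInputs (h : IsMarket v p) : ([], typeList v p) ∈ simInputs :=
  ⟨fun _ hq => absurd hq List.not_mem_nil, n, v, p, h, rfl⟩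

/-- The greedy choice of prices is, up to the factor `1 - 1 / e`, as good as any other. -/
theorem IsMarket.le_greedyWelfare_greedyIter (h : IsMarket v p) {O : Finset ℕ} {N : ℕ}
    (hO : ∀ o ∈ O, 0 < o ∧ o ≤ n ∧ 0 < atTime v o) (hN : O.card ≤ N) :
    (1 - 1 / Real.exp 1) *
      ((greedyWelfare (atTime v) (invPrice (atTime v)) (atTime p) n O : ℚ) : ℝ) ≤
      (greedyWelfare (atTime v) (invPrice (atTime v)) (atTime p) n
        (priceSet v (Prog.greedyIter (typeList v p) (min n N))) : ℚ) := by
  have hu := h.invPrice_strictMono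
  have hp := h.atTime_mass_nonneg
  have hv := h.atTime_succ_le
  have hv0 : ∀ j, 0 ≤ atTime v (j + 1) := fun j => h.atTime_nonneg _
  have hOn : O.card ≤ n := by
    refine (Finset.card_le_card (t := Finset.Icc 1 n) fun o ho => ?_).trans (by simp)
    exact Finset.mem_Icc.2 ⟨(hO o ho).1, (hO o ho).2.1⟩
  refine greedy_bound (f := fun K => greedyWelfare (atTime v) (invPrice (atTime v)) (atTime p) n K)
    (G := fun s => priceSet v (Prog.greedyIter (typeList v p) s))
    (fun K K' hK => greedyWelfare_mono hv hv0 hu rfl hp hK)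
    (fun K a b ha hb hab => greedyWelfare_submodular hv hv0 hu rfl hp ha hb hab)
    (greedyWelfare_nonneg hv hv0 hu rfl hp) (fun s _ o ho => ?_) (le_min hOn hN)
  obtain ⟨ho0, hon, hov⟩ := hO o ho
  have hs := Prog.greedyIter_mem_simInputs h.nil_mem_simInputs s
  have hs' := Prog.greedyIter_mem_simInputs h.nil_mem_simInputs (s + 1)
  have h1 := Prog.unservedValue_improve_le (K := Prog.greedyIter (typeList v p) s)
    (mem_typeList.2 ⟨o, ho0, hon, rfl⟩ : (atTime v o, atTime p o) ∈ typeList v p) hov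
  rw [← Prog.greedyIter_succ, h.eval_unservedValue hs'.1, h.eval_unservedValue (fun q hq => by
    rcases List.mem_cons.1 hq with rfl | hq
    · exact hov
    · exact hs.1 q hq), h.priceSet_cons _ ho0 hon] at h1
  linarith

theorem IsMarket.eval_approxScheme (h : IsMarket v p) {M : ℕ} (hM : 1 < M) :
    Prog.approxScheme.eval (encodeInput M v p) = encodeScheme (schemeOfList n
      (greedyScheme (invPrice (atTime v)) (atTime p)
        (priceSet v (Prog.greedyIter (typeList v p) (min n (M - 1)))) n)) := by
  rw [encodeInput, Prog.eval_approxScheme M (by omega), ofFn_eq_reverse_typeList,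
    List.reverse_reverse, List.length_reverse, length_typeList,
    h.eval_sim (Prog.greedyIter_mem_simInputs h.nil_mem_simInputs _).1, encodeScheme_schemeOfList,
    greedyScheme, List.map_cons]
  simp only [marketList, map_desc]
  rfl

end Output

end LimitedSignaling

theorem theorem3 :
    ∃ A : LimitedSignaling.Prog LimitedSignaling.inputTy LimitedSignaling.outputTy,
      A.PolyTimeOn LimitedSignaling.validInputs ∧
      ∀ (n M : ℕ) (v p : Fin n → ℚ), 1 < M → LimitedSignaling.IsMarket v p →
        ∃ (m : ℕ) (X : Fin n → Fin m → ℚ),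
          A.eval (LimitedSignaling.encodeInput M v p) = LimitedSignaling.encodeScheme X ∧
          LimitedSignaling.IsApproxScheme (fun i => (v i : ℝ)) (fun i => (p i : ℝ)) M
            (((M : ℝ) - 1) / (M : ℝ) * (1 - 1 / Real.exp 1))
            (fun i σ => (X i σ : ℝ)) := by
  refine ⟨LimitedSignaling.Prog.approxScheme, LimitedSignaling.Prog.approxScheme_polyTimeOn,
    fun n M v p hM h => ⟨_, _, h.eval_approxScheme hM, ?_, h.isScheme_greedyScheme _,
      fun m' Y hm' hY => ?_⟩⟩
  · rw [LimitedSignaling.greedyScheme, List.length_cons]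
    have h1 := (LimitedSignaling.length_segmentList_le
      (u := LimitedSignaling.invPrice (LimitedSignaling.atTime v))
      (p := LimitedSignaling.atTime p) (i := n)).trans (Finset.card_filter_le
        (LimitedSignaling.priceSet v (LimitedSignaling.Prog.greedyIter
          (LimitedSignaling.typeList v p) (min n (M - 1)))) _)
    have h2 := h1.trans ((h.card_priceSet_le _).trans
      (LimitedSignaling.Prog.length_greedyIter_le _ _))
    have h3 := min_le_right n (M - 1)
    omega
  · obtain ⟨O, hOM, hO, hle⟩ := h.welfare_le hM hm' hY
    have h1 := h.le_greedyWelfare_greedyIter hO hOM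
    have h2 := h.greedyWelfare_le_welfare (LimitedSignaling.Prog.greedyIter_mem_simInputs
      h.nil_mem_simInputs (min n (M - 1))).1
    have h3 : 0 ≤ 1 - 1 / Real.exp 1 := by
      rw [sub_nonneg, div_le_one (Real.exp_pos 1)]
      exact Real.one_le_exp zero_le_one
    refine le_trans (le_of_eq ?_) ((mul_le_mul_of_nonneg_left hle h3).trans (h1.trans h2))
    ring
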